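/- Let $n\ge 2$, let $2<p_1<\dots<p_n$ be integers, let $\lambda_1,\dots,\lambda_n\ge 0$ with $\sum_j\lambda_j=1$, and let $\xi(x)=\sum_{j=1}^n\lambda_j x^{p_j}$. **Parisi measure.** Let $\mathcal K$ be the set of measures $\nu(dx)=\mathbb 1_{[0,1)}(x)\gamma(x)\,dx+\Delta\,\delta_1(dx)$ with $\gamma\ge 0$ right-continuous and nondecreasing on $[0,1)$ and $\Delta>0$, and let $\mathcal Q(\nu)=\frac12\left(\int_0^1\xi'(x)\,\nu(dx)+\int_0^1\frac{dx}{\nu((x,1])}\right)\in[0,\infty]$. The Parisi measure at zero temperature $\nu_P$ is the minimizer of $\mathcal Q$ over $\mathcal K$. For $k\ge1$ it is called $k$-RSB if $$\nu_P(dx)=\sum_{i=1}^k m_i\mathbb 1_{[q_{i-1},q_i)}(x)\,dx+\Delta\,\delta_1(dx)$$ with $0=q_0<q_1<\dots<q_k=1$, $0<m_1<\dots<m_k$ and $\Delta>0$; the points $q_0,\dots,q_k$ are then called its support. (It is $0$-RSB if $\nu_P=\Delta\delta_1$, with support $\{1\}$.) Put $$g(u)=\int_u^1\Big(\xi'(t)-\int_0^t\frac{dr}{\nu_P((r,1])^2}\Big)dt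 .$$ Call $\nu_P$ *nondegenerate* if, whenever $\nu_P$ is $k$-RSB for some $k<n$, one has $g(u)>0$ for all $u\in[0,1]$ outside the support. **The set $\mathcal H^n$.** For $z>0$ let $$h(x,y,z)=\xi(y)-\xi(x)-\xi'(x)(y-x)+[\xi'(y)-\xi'(x)](y-x)\Big(\frac1{z-1}-\frac{z\log z}{(z-1)^2}\Big),$$ where the last bracket is $-\frac12$ at $z=1$ (its continuous extension), and let $$r_1(x,y,z)=\frac{[\xi'(z)-\xi'(y)](z-x)}{(z-y)[\xi'(z)-\xi'(x)]},\qquad r_2(x,y)=\frac{\xi''(y)(y-x)}{\xi'(y)-\xi'(x)} .$$ For $\bar x=(x_0,\dots,x_n)$ with $x_0<\dots<x_n$ put $\mathbf r_l=r_1(x_{l-1},x_{l+1},x_l)$, and with $\epsilon=(-1)^{n-l}$ $$\mathcal F_l=r_2(x_{l-\epsilon},x_l)\prod_{i=1}^{\lfloor (n-l)/2\rfloor}\Big(\frac{\mathbf r_{n+1-2i}}{\mathbf r_{n-2i}}\Big)^{\epsilon}\ (0\le l\le n),\qquad \mathcal A_l=r_1(x_l,x_{l-\epsilon},x_{l+\epsilon})\prod_{i=1}^{\lfloor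 (n-l)/2\rfloor}\Big(\frac{\mathbf r_{n-2i}}{\mathbf r_{n+1-2i}}\Big)^{\epsilon}\ (1\le l\le n-1),$$ where for $l=0$ and $n$ even the undefined $x_{-1}$ cancels formally through $r_2(x_{-1},x_0)/\mathbf r_0=r_2(x_1,x_0)$. Let $\mathcal Z$ be the maximum of all $\mathcal F_l$ with $n-l$ odd and all $\mathcal A_l$ with $n-l$ even, and $\mathcal Y$ the maximum of all $\mathcal F_l$ with $n-l$ even and all $\mathcal A_l$ with $n-l$ odd. Then $\mathcal H^n$ is the set of $\bar x\in[0,1]^{n+1}$ with $x_0<x_1<\dots<x_n$ and, for $1\le l\le n$, $$(-1)^{n-l}h\big(x_{l-1},x_l,\mathcal Z^{(-1)^{n-l+1}}\mathcal F_l^{-1}r_2(x_{l-1},x_l)\big)\ge0,\qquad (-1)^{n-l}h\big(x_{l-1},x_l,\mathcal Y^{(-1)^{n-l}}\mathcal F_l^{-1}r_2(x_{l-1},x_l)\big)\le0 .$$ **Claim.** If $\nu_P$ is $n$-RSB, then there is $\bar x=(0,x_1,\dots,x_{n-1},1)\in\mathcal H^n$. If $\nu_P$ is nondegenerate, then conversely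 the existence of such an $\bar x$ implies that $\nu_P$ is $n$-RSB; thus $\nu_P$ is $n$-RSB if and only if some $(0,x_1,\dots,x_{n-1},1)$ lies in $\mathcal H^n$. -/

import Mathlib

open MeasureTheory Set

noncomputable section

namespace SphericalSpinGlass

/-- The mixture `ξ(x) = ∑ λ_j x^{p_j}` of a model with `n` components. -/
def mixture {n : ℕ} (p : Fin n → ℕ) (lam : Fin n → ℝ) (x : ℝ) : ℝ :=
  ∑ j, lam j * x ^ p j

/-! ### The Parisi measure at zero temperature -/

/-- The collection `𝒦` of measures `1_{[0,1)} γ(x) dx + Δ δ_1`, with `γ` nonnegative,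
right-continuous and nondecreasing on `[0,1)` and `Δ > 0`. -/
def classK : Set (Measure ℝ) :=
  {ν | ∃ (γ : ℝ → ℝ) (Δ : ℝ),
    (∀ x ∈ Ico (0 : ℝ) 1, 0 ≤ γ x) ∧
    (∀ x ∈ Ico (0 : ℝ) 1, ContinuousWithinAt γ (Ici x) x) ∧
    MonotoneOn γ (Ico 0 1) ∧
    0 < Δ ∧
    ν = (volume.restrict (Ico (0 : ℝ) 1)).withDensity (fun x => ENNReal.ofReal (γ x)) +
      ENNReal.ofReal Δ • Measure.dirac (1 : ℝ)}

/-- The Crisanti–Sommers functional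
`𝒬(ν) = (1/2) (∫_0^1 ξ'(x) ν(dx) + ∫_0^1 dx / ν((x,1]))`, with values in `[0,∞]`
(all integrands are nonnegative for the mixtures considered here). -/
def crisantiSommers (ξ : ℝ → ℝ) (ν : Measure ℝ) : ENNReal :=
  (1 / 2) * ((∫⁻ x in Icc (0 : ℝ) 1, ENNReal.ofReal (deriv ξ x) ∂ν) +
    ∫⁻ x in Icc (0 : ℝ) 1, (ν (Ioc x 1))⁻¹)

/-- `ν` is the Parisi measure at zero temperature: the minimizer of `𝒬` over `𝒦`. -/
def IsParisiMeasure (ξ : ℝ → ℝ) (ν : Measure ℝ) : Prop :=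
  ν ∈ classK ∧ ∀ μ ∈ classK, crisantiSommers ξ ν ≤ crisantiSommers ξ μ

/-- `ν = ∑_{i=1}^k m_i 1_{[q_{i-1},q_i)}(x) dx + Δ δ_1` with `0 = q_0 < q_1 < ⋯ < q_k = 1`,
`0 < m_1 < ⋯ < m_k` and `Δ > 0`. As all the jumps are strict, the support, in the sense of the
points of increase of the density together with `1`, is exactly the set of the `k + 1` points
`q_0, …, q_k`. (For `k = 0` this reads `ν = Δ δ_1`, with the only point `1`.) -/
def IsRSBWithSupport (k : ℕ) (ν : Measure ℝ) (q : Fin (k + 1) → ℝ) : Prop :=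
  StrictMono q ∧ (0 < k → q 0 = 0) ∧ q (Fin.last k) = 1 ∧
    ∃ (m : Fin k → ℝ) (Δ : ℝ), StrictMono m ∧ (∀ i, 0 < m i) ∧ 0 < Δ ∧
      ν = volume.withDensity (fun x => ∑ i : Fin k,
          (Ico (q i.castSucc) (q i.succ)).indicator (fun _ => ENNReal.ofReal (m i)) x) +
        ENNReal.ofReal Δ • Measure.dirac (1 : ℝ)

/-- `ν` has `k` steps of replica symmetry breaking (`k`-RSB). -/
def IsRSB (k : ℕ) (ν : Measure ℝ) : Prop :=
  ∃ q : Fin (k + 1) → ℝ, IsRSBWithSupport k ν q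

/-- `g(u) = ∫_u^1 (ξ'(t) - ∫_0^t dr / ν((r,1])²) dt`. For the Parisi measure, `g ≥ 0` on
`[0,1]` and `g` vanishes on the support. -/
def obstacle (ξ : ℝ → ℝ) (ν : Measure ℝ) (u : ℝ) : ℝ :=
  ∫ t in u..1, (deriv ξ t - ∫ r in (0 : ℝ)..t, 1 / (ν.real (Ioc r 1)) ^ 2)

/-- `ν` is not at a boundary between a `k`-RSB phase with `k < n` and a phase with more steps:
if `ν` is `k`-RSB for some `k < n`, then `g > 0` on `[0,1]` off the support. -/
def IsNondegenerate (n : ℕ) (ξ : ℝ → ℝ) (ν : Measure ℝ) : Prop :=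
  ∀ k < n, ∀ q : Fin (k + 1) → ℝ, IsRSBWithSupport k ν q →
    ∀ u ∈ Icc (0 : ℝ) 1, u ∉ range q → 0 < obstacle ξ ν u

/-! ### The sets `𝓗^s` -/

/-- `1/(z-1) - z log z/(z-1)²`, extended by continuity to `z = 1`. -/
def hCoeff (z : ℝ) : ℝ :=
  if z = 1 then -(1 / 2) else 1 / (z - 1) - z / (z - 1) ^ 2 * Real.log z

/-- `h(x,y,z)`. -/
def h (ξ : ℝ → ℝ) (x y z : ℝ) : ℝ :=
  ξ y - ξ x - deriv ξ x * (y - x) + (deriv ξ y - deriv ξ x) * (y - x) * hCoeff z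

/-- `r₁(x,y,z)`. -/
def r₁ (ξ : ℝ → ℝ) (x y z : ℝ) : ℝ :=
  ((deriv ξ z - deriv ξ y) * (z - x)) / ((z - y) * (deriv ξ z - deriv ξ x))

/-- `r₂(x,y)`. -/
def r₂ (ξ : ℝ → ℝ) (x y : ℝ) : ℝ :=
  (deriv (deriv ξ) y * (y - x)) / (deriv ξ y - deriv ξ x)

/-- `𝐫_l(x) = r₁(x_{l-1}, x_{l+1}, x_l)`, for `l ≥ 1`. -/
def rr (ξ : ℝ → ℝ) (x : ℕ → ℝ) (l : ℕ) : ℝ :=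
  r₁ ξ (x (l - 1)) (x (l + 1)) (x l)

/-- `𝓕_l^s(x)`, for `0 ≤ l ≤ s`, where
`𝓕_l^s(x) = r₂(x_{l-(-1)^{s-l}}, x_l) ∏_{i=1}^{⌊(s-l)/2⌋} (𝐫_{s+1-2i}/𝐫_{s-2i})^{(-1)^{s-l}}`.
For `l = 0` and `s` even this formula mentions an index `-1`, in
`r₂(x_{-1}, x_0)` and in the last denominator `𝐫_0`; the unknown `x_{-1}` cancels identically,
`r₂(x_{-1}, x_0) / 𝐫_0 = r₂(x_1, x_0)`, and the first branch is the result of the cancellation. -/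
def calF (ξ : ℝ → ℝ) (s : ℕ) (x : ℕ → ℝ) (l : ℕ) : ℝ :=
  if l = 0 ∧ Even s then
    r₂ ξ (x 1) (x 0) * rr ξ x 1 *
      ∏ i ∈ Finset.Icc 1 (s / 2 - 1), rr ξ x (s + 1 - 2 * i) / rr ξ x (s - 2 * i)
  else
    r₂ ξ (x (if Even (s - l) then l - 1 else l + 1)) (x l) *
      ∏ i ∈ Finset.Icc 1 ((s - l) / 2),
        (rr ξ x (s + 1 - 2 * i) / rr ξ x (s - 2 * i)) ^ ((-1 : ℤ) ^ (s - l))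

/-- `𝓐_l^s(x)`, for `1 ≤ l ≤ s - 1`. -/
def calA (ξ : ℝ → ℝ) (s : ℕ) (x : ℕ → ℝ) (l : ℕ) : ℝ :=
  r₁ ξ (x l) (x (if Even (s - l) then l - 1 else l + 1))
      (x (if Even (s - l) then l + 1 else l - 1)) *
    ∏ i ∈ Finset.Icc 1 ((s - l) / 2),
      (rr ξ x (s - 2 * i) / rr ξ x (s + 1 - 2 * i)) ^ ((-1 : ℤ) ^ (s - l))

/-- `𝓩^s(x)`: the largest of the `𝓕_l^s(x)` with `0 ≤ l ≤ s`, `s - l` odd, and the `𝓐_l^s(x)`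
with `1 ≤ l ≤ s - 1`, `s - l` even (a finite set, nonempty for `s ≥ 1`). -/
def calZ (ξ : ℝ → ℝ) (s : ℕ) (x : ℕ → ℝ) : ℝ :=
  sSup ({v | ∃ l, l ≤ s ∧ Odd (s - l) ∧ v = calF ξ s x l} ∪
    {v | ∃ l, 1 ≤ l ∧ l < s ∧ Even (s - l) ∧ v = calA ξ s x l})

/-- `𝓨^s(x)`: the largest of the `𝓕_l^s(x)` with `0 ≤ l ≤ s`, `s - l` even, and the `𝓐_l^s(x)`
with `1 ≤ l ≤ s - 1`, `s - l` odd (a finite nonempty set). -/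
def calY (ξ : ℝ → ℝ) (s : ℕ) (x : ℕ → ℝ) : ℝ :=
  sSup ({v | ∃ l, l ≤ s ∧ Even (s - l) ∧ v = calF ξ s x l} ∪
    {v | ∃ l, 1 ≤ l ∧ l < s ∧ Odd (s - l) ∧ v = calA ξ s x l})

/-- The condition `ϰ(s)` on `x_0, …, x_s`. -/
def Kappa (ξ : ℝ → ℝ) (s : ℕ) (x : ℕ → ℝ) : Prop :=
  (∀ l, 1 ≤ l → l ≤ s → x (l - 1) < x l) ∧
  ∀ l, 1 ≤ l → l ≤ s →
    0 ≤ (-1 : ℝ) ^ (s - l) * h ξ (x (l - 1)) (x l)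
      (calZ ξ s x ^ ((-1 : ℤ) ^ (s - l + 1)) * (calF ξ s x l)⁻¹ * r₂ ξ (x (l - 1)) (x l)) ∧
    (-1 : ℝ) ^ (s - l) * h ξ (x (l - 1)) (x l)
      (calY ξ s x ^ ((-1 : ℤ) ^ (s - l)) * (calF ξ s x l)⁻¹ * r₂ ξ (x (l - 1)) (x l)) ≤ 0

/-- A tuple `(x_0, …, x_s)` read as a sequence; only the entries of index `≤ s` are used. -/
def toSeq {s : ℕ} (x : Fin (s + 1) → ℝ) (j : ℕ) : ℝ :=
  if hj : j < s + 1 then x ⟨j, hj⟩ else 0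

/-- The set `𝓗^s ⊆ [0,1]^{s+1}`. -/
def setH (ξ : ℝ → ℝ) (s : ℕ) : Set (Fin (s + 1) → ℝ) :=
  {x | (∀ i, x i ∈ Icc (0 : ℝ) 1) ∧ Kappa ξ s (toSeq x)}

end SphericalSpinGlass

end

open Filter Topology

noncomputable section

namespace SphericalSpinGlass

/-! Write `N(t) = ν((t,1])` and `φ = ξ''`. Integration by parts turns `2𝒬(ν)` into `∫ (φ N + 1/N)`,
a strictly convex functional of the positive, decreasing, concave function `N`. A measure with `k`
steps is a concave polygon `N` with `k` pieces. Its force `φ - 1/N²` has the obstacle function `g`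
as second primitive. If `ν` is the minimizer, then `g ≥ 0`, and `g` vanishes and is critical at the
nodes, so on every piece the force is orthogonal to affine functions. Conversely, if a polygon has
this balance and its force has the signs `-, +, -` on each piece, then the force has nonnegative
integral against every concave function, and the polygon is the unique minimizer
(`integral_mul_nonneg_of_concaveOn`, `eq_of_energy_le`, `IsExactChain.isStep`).

What `𝓗` encodes. Along a line over a cell, zero total force fixes only the product of the two end
values, so given nodes carry a one-parameter family of polygons, with parameter `w` (`endVal`,
`nodeVal`). The function `h` is the first moment of the force. Its third argument is the quotient of
the end values, and it is strictly increasing there (`h_eq_integral`, `IsMixture.h_strictMono`). A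
bound by `w` or `1/w` on `𝓕_l` says that the polygon is below `ψ = φ^{-1/2}` at the node `l`, and
such a bound on `𝓐_l` says that it is concave there. Hence `[𝓨, 1/𝓩]` is the set of parameters with
both properties (`IsMixture.mem_Icc_iff`), and `𝓗` prescribes the signs of all first moments at the
two ends of this interval.

From `n`-RSB to `𝓗`: the tail of `ν` is the polygon of some `w` in this interval, all its first
moments vanish, and monotonicity of `h` gives the signs at the ends.

From `𝓗` to `n`-RSB: the polygons with parameters `𝓨` and `1/𝓩` give an interval `[lo l, up l]` at
each node. Take one line per cell with end values in these intervals, chosen independently, so that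
neighbours cross near the node and not at it. An energy is minimized over this box. Its derivative
along a line integrates the positive part of the force over the fixed cell and the negative part
over the piece between crossings. The signs in `𝓗` control the derivatives at the faces of the box,
so that all of them vanish at the minimizer (`IsTrap.derivLeft_eq_zero`,
`IsTrap.derivRight_eq_zero`). Then the force is nonpositive between nodes and crossings, the two
domains of integration may be identified, and the crossing lines form an exact chain.

The number of components enters through the sign pattern: a line of the box exceeds `ψ` on an order
convex set only (`IsMixture.ordConnected_force_pos`). Each cell forces a fall of `-ψ'`, and a second
excursion would give one fall more than `n` components allow (`IsMixture.not_zigzag`). That bound is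
a Rolle argument for power sums with a varying level (`not_alternating`).

By uniqueness the exact chain is the tail of `ν`. If two of its slopes agreed, `ν` would have fewer
steps while `g` vanishes at the superfluous node, which nondegeneracy excludes. -/

/-- The affine function with values `a` at `x` and `b` at `x'`. -/
def seg (x x' a b t : ℝ) : ℝ := (a * (x' - t) + b * (t - x)) / (x' - x)

/-! ### One-sided derivatives of integrals of primitives along minima of lines -/

/-- The primitive of `q t ·` that vanishes at `0`. -/
def prim (q : ℝ → ℝ → ℝ) (t N : ℝ) : ℝ := ∫ u in (0 : ℝ)..N, q t u

theorem continuous_prim {q : ℝ → ℝ → ℝ} (hq : Continuous (Function.uncurry q)) :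
    Continuous (Function.uncurry (prim q)) := by
  have : Continuous fun z : ℝ × ℝ => ∫ u in (0 : ℝ)..z.2, q z.1 u :=
    intervalIntegral.continuous_parametric_intervalIntegral_of_continuous
      (f := fun (z : ℝ × ℝ) u => q z.1 u)
      (by exact hq.comp (by fun_prop : Continuous fun w : (ℝ × ℝ) × ℝ => (w.1.1, w.2)))
      continuous_snd
  exact this

theorem hasDerivAt_prim {q : ℝ → ℝ → ℝ} (hq : Continuous (Function.uncurry q)) (t N : ℝ) :
    HasDerivAt (prim q t) (q t N) N := by
  have hc : Continuous (q t) := hq.comp (by fun_prop : Continuous fun u : ℝ => (t, u))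
  exact intervalIntegral.integral_hasDerivAt_right (hc.intervalIntegrable _ _)
    (hc.stronglyMeasurableAtFilter _ _) hc.continuousAt

theorem prim_sub_le {q : ℝ → ℝ → ℝ} (hq : Continuous (Function.uncurry q)) {t R C : ℝ}
    (hC : ∀ u ∈ Icc (-R) R, |q t u| ≤ C) {M N : ℝ} (hM : M ∈ Icc (-R) R) (hN : N ∈ Icc (-R) R) :
    |prim q t N - prim q t M| ≤ C * |N - M| := by
  have hd : ∀ z ∈ Icc (-R) R, HasDerivWithinAt (prim q t) (q t z) (Icc (-R) R) z :=
    fun z _ => (hasDerivAt_prim hq t z).hasDerivWithinAt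
  have := (convex_Icc (-R) R).norm_image_sub_le_of_norm_hasDerivWithin_le hd
    (fun z hz => by simpa using hC z hz) hM hN
  simpa using this

/-- Right derivative of `∫ prim q (min (u + s φ) (v + s χ))` at `s = 0`. -/
theorem tendsto_slope_integral_prim_min {q : ℝ → ℝ → ℝ} (hq : Continuous (Function.uncurry q))
    {u v φ χ : ℝ → ℝ} (hu : Continuous u) (hv : Continuous v) (hφ : Continuous φ)
    (hχ : Continuous χ) {x x' : ℝ} (w : ℝ → ℝ)
    (hw : ∀ᵐ t, ∀ᶠ s in 𝓝[>] (0 : ℝ),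
      min (u t + s * φ t) (v t + s * χ t) = min (u t) (v t) + s * w t) :
    Tendsto (fun s => ((∫ t in x..x', prim q t (min (u t + s * φ t) (v t + s * χ t))) -
        ∫ t in x..x', prim q t (min (u t) (v t))) / s) (𝓝[>] 0)
      (𝓝 (∫ t in x..x', q t (min (u t) (v t)) * w t)) := by
  have hP := continuous_prim hq
  have hc : ∀ s, Continuous fun t => prim q t (min (u t + s * φ t) (v t + s * χ t)) := fun s =>
    hP.comp (by fun_prop : Continuous fun t => (t, min (u t + s * φ t) (v t + s * χ t)))
  have hc0 : Continuous fun t => prim q t (min (u t) (v t)) :=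
    hP.comp (by fun_prop : Continuous fun t => (t, min (u t) (v t)))
  have hK : IsCompact (uIcc x x') := isCompact_uIcc
  obtain ⟨A, hA⟩ := hK.exists_bound_of_continuousOn
    (f := fun t => |u t| + |v t| + |φ t| + |χ t|) (by fun_prop)
  have hA' : ∀ t ∈ uIcc x x', |u t| + |v t| + |φ t| + |χ t| ≤ A := fun t ht =>
    (le_abs_self _).trans (by simpa using hA t ht)
  have hA0 : 0 ≤ A := le_trans (by positivity) (hA' x left_mem_uIcc)
  -- For `0 ≤ s ≤ 1` the perturbed lines stay in `[-R, R]`, where `C` bounds `q`; the difference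
  -- quotients are then dominated by `C * A`.
  set R := 2 * A + 1 with hR
  obtain ⟨C, hC⟩ := (hK.prod (isCompact_Icc (a := -R) (b := R))).exists_bound_of_continuousOn
    (f := Function.uncurry q) hq.continuousOn
  have heq : ∀ s : ℝ, ((∫ t in x..x', prim q t (min (u t + s * φ t) (v t + s * χ t))) -
        ∫ t in x..x', prim q t (min (u t) (v t))) / s =
      ∫ t in x..x', (prim q t (min (u t + s * φ t) (v t + s * χ t)) -
        prim q t (min (u t) (v t))) / s := by
    intro s
    rw [intervalIntegral.integral_div, intervalIntegral.integral_sub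
      ((hc s).intervalIntegrable _ _) (hc0.intervalIntegrable _ _)]
  simp_rw [heq]
  apply intervalIntegral.tendsto_integral_filter_of_dominated_convergence (fun _ => C * A)
  · exact Eventually.of_forall fun s => ((hc s).sub hc0 |>.div_const s).aestronglyMeasurable
  · have h1 : ∀ᶠ s in 𝓝[>] (0 : ℝ), s < 1 := nhdsWithin_le_nhds (Iio_mem_nhds one_pos)
    filter_upwards [self_mem_nhdsWithin, h1] with s hs hs1
    have hs0 : 0 < s := hs
    refine Eventually.of_forall fun t ht => ?_
    have ht := uIoc_subset_uIcc ht
    have hb := hA' t ht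
    have e1 := abs_nonneg (u t)
    have e2 := abs_nonneg (v t)
    have e3 := abs_nonneg (φ t)
    have e4 := abs_nonneg (χ t)
    have hb1 : ∀ s' : ℝ, 0 ≤ s' → s' ≤ 1 →
        min (u t + s' * φ t) (v t + s' * χ t) ∈ Icc (-R) R := by
      intro s' h0 h1
      have f1 : |u t + s' * φ t| ≤ R := by
        refine (abs_add_le _ _).trans ?_
        rw [abs_mul, abs_of_nonneg h0]
        nlinarith
      have f2 : |v t + s' * χ t| ≤ R := by
        refine (abs_add_le _ _).trans ?_
        rw [abs_mul, abs_of_nonneg h0]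
        nlinarith
      rw [abs_le] at f1 f2
      exact ⟨le_min f1.1 f2.1, (min_le_left _ _).trans f1.2⟩
    have hl := prim_sub_le hq (t := t) (R := R) (C := C)
      (fun z hz => by simpa using hC (t, z) ⟨ht, hz⟩) (by simpa only [zero_mul, add_zero] using hb1 0 le_rfl zero_le_one)
      (hb1 s hs0.le hs1.le)
    have hC0 : 0 ≤ C := (norm_nonneg _).trans (hC (t, 0) ⟨ht, by constructor <;> linarith⟩)
    rw [Real.norm_eq_abs, abs_div, abs_of_pos hs0, div_le_iff₀ hs0]
    refine hl.trans ?_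
    rw [mul_assoc]
    refine mul_le_mul_of_nonneg_left ?_ hC0
    refine (abs_min_sub_min_le_max _ _ _ _).trans (max_le ?_ ?_)
    · rw [add_sub_cancel_left, abs_mul, abs_of_pos hs0]; nlinarith
    · rw [add_sub_cancel_left, abs_mul, abs_of_pos hs0]; nlinarith
  · exact intervalIntegrable_const
  · filter_upwards [hw] with t ht _
    have hd := ((hasDerivAt_prim hq t (min (u t) (v t))).scomp_of_eq (0 : ℝ)
      (((hasDerivAt_id (0 : ℝ)).mul_const (w t)).const_add (min (u t) (v t))) (by simp))
    have := (hasDerivAt_iff_tendsto_slope.1 hd).mono_left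
      (nhdsWithin_mono 0 (show Ioi (0 : ℝ) ⊆ {0}ᶜ from fun z hz => (ne_of_gt hz)))
    rw [show q t (min (u t) (v t)) * w t = (1 * w t) • q t (min (u t) (v t)) by
      simp [mul_comm]]
    refine this.congr' ?_
    filter_upwards [ht] with s hs
    simp [slope_def_field, hs]

/-! ### The derivative along one line and its sign at the faces of the box -/

/-- The directional derivative functional of one affine piece: `q` is the derivative of the
energy along the piece, `[x, x']` the cell and `c`, `c'` the crossings with the neighbours. -/
def lineForm (q : ℝ → ℝ) (x x' c c' : ℝ) (φ : ℝ → ℝ) : ℝ :=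
  (∫ t in x..x', max (q t) 0 * φ t) + ∫ t in c..c', min (q t) 0 * φ t

theorem intervalIntegral_nonpos {f : ℝ → ℝ} {a b : ℝ} (hab : a ≤ b)
    (hf : ∀ t ∈ Icc a b, f t ≤ 0) : ∫ t in a..b, f t ≤ 0 := by
  have := intervalIntegral.integral_nonneg (μ := volume) (f := fun t => -f t) hab fun t ht => by
    simpa using hf t ht
  rw [intervalIntegral.integral_neg] at this
  linarith

theorem max_add_min_zero (y : ℝ) : max y 0 + min y 0 = y := by
  rw [max_add_min, add_zero]

section
variable {q : ℝ → ℝ} {x x' c c' : ℝ}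

theorem intervalIntegrable_max_mul (hq : Continuous q) {φ : ℝ → ℝ} (hφ : Continuous φ) (a b : ℝ) :
    IntervalIntegrable (fun t => max (q t) 0 * φ t) volume a b :=
  ((hq.max continuous_const).mul hφ).intervalIntegrable _ _

theorem intervalIntegrable_min_mul (hq : Continuous q) {φ : ℝ → ℝ} (hφ : Continuous φ) (a b : ℝ) :
    IntervalIntegrable (fun t => min (q t) 0 * φ t) volume a b :=
  ((hq.min continuous_const).mul hφ).intervalIntegrable _ _

theorem integral_eq_max_add_min (hq : Continuous q) {φ : ℝ → ℝ} (hφ : Continuous φ) (a b : ℝ) :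
    ∫ t in a..b, q t * φ t =
      (∫ t in a..b, max (q t) 0 * φ t) + ∫ t in a..b, min (q t) 0 * φ t := by
  rw [← intervalIntegral.integral_add (intervalIntegrable_max_mul hq hφ a b)
    (intervalIntegrable_min_mul hq hφ a b)]
  congr 1; ext t; rw [← add_mul, max_add_min_zero]

/-- Passing from nodes to crossings costs two integrals of `min q 0` between a node and a crossing.
Their signs are known as soon as that of `φ` is, which is what the sign lemmas exploit. -/
theorem lineForm_eq (hq : Continuous q) {φ : ℝ → ℝ} (hφ : Continuous φ) :
    lineForm q x x' c c' φ = (∫ t in x..x', q t * φ t) - (∫ t in x..c, min (q t) 0 * φ t) +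
      ∫ t in x'..c', min (q t) 0 * φ t := by
  have hi := intervalIntegrable_min_mul hq hφ
  rw [lineForm, integral_eq_max_add_min hq hφ]
  have h1 := intervalIntegral.integral_add_adjacent_intervals (hi x c) (hi c c')
  have h2 := intervalIntegral.integral_add_adjacent_intervals (hi x x') (hi x' c')
  linarith

theorem lineForm_linear (hq : Continuous q) {φ χ : ℝ → ℝ} (hφ : Continuous φ) (hχ : Continuous χ)
    (r s : ℝ) : lineForm q x x' c c' (fun t => r * φ t + s * χ t) =
      r * lineForm q x x' c c' φ + s * lineForm q x x' c c' χ := by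
  have e1 : ∀ p : ℝ → ℝ, Continuous p → ∀ a b, ∫ t in a..b, p t * (r * φ t + s * χ t) =
      r * (∫ t in a..b, p t * φ t) + s * ∫ t in a..b, p t * χ t := by
    intro p hp a b
    rw [← intervalIntegral.integral_const_mul, ← intervalIntegral.integral_const_mul,
      ← intervalIntegral.integral_add]
    · congr 1; ext t; ring
    · exact ((hp.mul hφ).const_mul r |>.congr fun t => rfl).intervalIntegrable _ _
    · exact ((hp.mul hχ).const_mul s |>.congr fun t => rfl).intervalIntegrable _ _
  rw [lineForm, e1 _ (hq.max continuous_const), e1 _ (hq.min continuous_const), lineForm, lineForm]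
  ring

/-- The reflection exchanges the two ends of a cell, so every statement about the right end follows
from the one about the left end. -/
theorem lineForm_comp_neg (φ : ℝ → ℝ) :
    lineForm (fun t => q (-t)) (-x') (-x) (-c') (-c) (fun t => φ (-t)) =
      lineForm q x x' c c' φ := by
  unfold lineForm
  rw [intervalIntegral.integral_comp_neg (fun t => max (q t) 0 * φ t),
    intervalIntegral.integral_comp_neg (fun t => min (q t) 0 * φ t)]
  simp

theorem integral_nonneg_of_min_mul {φ : ℝ → ℝ} {a b : ℝ} (hab : a ≤ b)
    (hφ : ∀ t ∈ Icc a b, φ t ≤ 0) : 0 ≤ ∫ t in a..b, min (q t) 0 * φ t :=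
  intervalIntegral.integral_nonneg hab fun t ht =>
    mul_nonneg_of_nonpos_of_nonpos (min_le_right _ _) (hφ t ht)

theorem integral_nonpos_of_min_mul {φ : ℝ → ℝ} {a b : ℝ} (hab : a ≤ b)
    (hφ : ∀ t ∈ Icc a b, 0 ≤ φ t) : ∫ t in a..b, min (q t) 0 * φ t ≤ 0 :=
  intervalIntegral_nonpos hab fun t ht =>
    mul_nonpos_of_nonpos_of_nonneg (min_le_right _ _) (hφ t ht)

/-- At the upper end of the box, raising the left end value does not decrease the energy. -/
theorem lineForm_left_nonneg (hq : Continuous q) {q₂ : ℝ → ℝ} (hq₂ : Continuous q₂) (hx : x < x')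
    (hle : ∀ t ∈ Icc x x', q₂ t ≤ q t) (hγ : 0 ≤ ∫ t in x..x', q₂ t * (x' - t))
    (hc : x ≤ c) (hc' : c ≤ x') : 0 ≤ lineForm q x x' c c' (fun t => x' - t) := by
  rw [lineForm_eq hq (by fun_prop)]
  have h1 : ∫ t in x..x', q₂ t * (x' - t) ≤ ∫ t in x..x', q t * (x' - t) :=
    intervalIntegral.integral_mono_on hx.le
      ((hq₂.mul (by fun_prop)).intervalIntegrable _ _) ((hq.mul (by fun_prop)).intervalIntegrable _ _)
      fun t ht => mul_le_mul_of_nonneg_right (hle t ht) (by linarith [ht.2])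
  -- Both corrections help: `x' - t ≥ 0` on `[x, c]`, and the weight changes sign at `x'` together
  -- with the orientation of the integral from `x'` to `c'`.
  have h2 : ∫ t in x..c, min (q t) 0 * (x' - t) ≤ 0 :=
    integral_nonpos_of_min_mul (φ := fun t => x' - t) hc fun t ht => by linarith [ht.2]
  have h3 : 0 ≤ ∫ t in x'..c', min (q t) 0 * (x' - t) := by
    rcases le_total x' c' with h | h
    · exact integral_nonneg_of_min_mul (φ := fun t => x' - t) h fun t ht => by linarith [ht.1]
    · rw [intervalIntegral.integral_symm, neg_nonneg]
      exact integral_nonpos_of_min_mul (φ := fun t => x' - t) h fun t ht => by linarith [ht.2]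
  linarith

/-- A continuous function on `[x, x']` that is positive on an order convex set is `≤ 0`, `≥ 0`,
`≤ 0` on three successive intervals. -/
theorem exists_sign_pattern (hx : x ≤ x')
    (hd : OrdConnected {t | t ∈ Icc x x' ∧ 0 < q t}) :
    ∃ d₁ d₂, x ≤ d₁ ∧ d₁ ≤ d₂ ∧ d₂ ≤ x' ∧ (∀ t ∈ Ico x d₁, q t ≤ 0) ∧
      (∀ t ∈ Ioo d₁ d₂, 0 ≤ q t) ∧ (∀ t ∈ Ioc d₂ x', q t ≤ 0) ∧
      (∀ t ∈ Icc x x', 0 < q t → t ∈ Icc d₁ d₂) := by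
  set S := {t | t ∈ Icc x x' ∧ 0 < q t} with hS
  rcases S.eq_empty_or_nonempty with h | h
  · have : ∀ t ∈ Icc x x', q t ≤ 0 := fun t ht => by
      by_contra hlt; exact (h ▸ (⟨ht, not_le.1 hlt⟩ : t ∈ S) : t ∈ (∅ : Set ℝ))
    exact ⟨x, x, le_rfl, le_rfl, hx, by simp, by simp, fun t ht => this t ⟨ht.1.le, ht.2⟩,
      fun t ht h0 => absurd (this t ht) (not_le.2 h0)⟩
  · have hb : BddBelow S := ⟨x, fun t ht => ht.1.1⟩
    have ha : BddAbove S := ⟨x', fun t ht => ht.1.2⟩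
    obtain ⟨s, hs⟩ := h
    have hne : S.Nonempty := ⟨s, hs⟩
    have i1 : sInf S ≤ s := csInf_le hb hs
    have i2 : s ≤ sSup S := le_csSup ha hs
    have i3 : x ≤ sInf S := le_csInf hne fun t ht => ht.1.1
    have i4 : sSup S ≤ x' := csSup_le hne fun t ht => ht.1.2
    refine ⟨sInf S, sSup S, i3, i1.trans i2, i4, ?_, ?_, ?_, ?_⟩
    · intro t ht
      by_contra hlt
      exact (not_le.2 ht.2) (csInf_le hb ⟨⟨ht.1, by linarith [ht.2, hs.1.2]⟩, not_le.1 hlt⟩)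
    · intro t ht
      obtain ⟨s₁, hs₁, hs₁'⟩ := exists_lt_of_csInf_lt hne ht.1
      obtain ⟨s₂, hs₂, hs₂'⟩ := exists_lt_of_lt_csSup hne ht.2
      exact (hd.out hs₁ hs₂ ⟨hs₁'.le, hs₂'.le⟩).2.le
    · intro t ht
      by_contra hlt
      exact (not_le.2 ht.1) (le_csSup ha ⟨⟨by linarith [ht.1, hs.1.1], ht.2⟩, not_le.1 hlt⟩)
    · intro t ht h0
      exact ⟨csInf_le hb ⟨ht, h0⟩, le_csSup ha ⟨ht, h0⟩⟩

/-- Partial moments of a function with sign pattern `-, +, -`. -/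
theorem integral_mul_sub_nonpos (hq : Continuous q) (hx : x < x')
    (hd : OrdConnected {t | t ∈ Icc x x' ∧ 0 < q t}) (h0 : ∫ t in x..x', q t = 0)
    (hγ : ∫ t in x..x', q t * (x' - t) ≤ 0) {u : ℝ} (hu : u ∈ Icc x x') :
    ∫ t in x..u, q t * (u - t) ≤ 0 := by
  obtain ⟨d₁, d₂, hd₁, h12, hd₂, n1, p, n2, -⟩ := exists_sign_pattern hx.le hd
  have hi : ∀ a b v : ℝ, IntervalIntegrable (fun t => q t * (v - t)) volume a b := fun a b v =>
    (hq.mul (by fun_prop)).intervalIntegrable _ _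
  have hi' : ∀ a b : ℝ, IntervalIntegrable q volume a b := fun a b => hq.intervalIntegrable _ _
  -- `F(u) = ∫_x^u q(t)(u - t) dt` satisfies `F'' = q` and `F(x) = F'(x) = 0`. It is concave on `[x,
  -- d₁]`, hence nonpositive there. At `x'` one has `F' = 0` and `F ≤ 0`, so concavity on `[d₂, x']`
  -- gives the same. In between `F` is convex with nonpositive end values.
  have L : ∀ u ∈ Icc x d₁, ∫ t in x..u, q t * (u - t) ≤ 0 := by
    intro u hu
    apply intervalIntegral_nonpos hu.1
    intro t ht
    rcases eq_or_lt_of_le ht.2 with rfl | h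
    · simp
    · exact mul_nonpos_of_nonpos_of_nonneg (n1 t ⟨ht.1, h.trans_le hu.2⟩) (by linarith)
  have key : ∀ u v a b : ℝ, ∫ t in a..b, q t * (v - t) =
      (∫ t in a..b, q t * (u - t)) + (v - u) * ∫ t in a..b, q t := by
    intro u v a b
    rw [← intervalIntegral.integral_const_mul, ← intervalIntegral.integral_add (hi _ _ _)
      ((hi' _ _).const_mul _)]
    congr 1; ext t; ring
  have Rr : ∀ u ∈ Icc d₂ x', ∫ t in x..u, q t * (u - t) ≤ 0 := by
    intro u hu
    have e1 := intervalIntegral.integral_add_adjacent_intervals (hi x u u) (hi u x' u)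
    have e2 := key x' u x x'
    have e3 : 0 ≤ ∫ t in u..x', q t * (u - t) := by
      apply intervalIntegral.integral_nonneg hu.2
      intro t ht
      rcases eq_or_lt_of_le ht.1 with rfl | h
      · simp
      · exact mul_nonneg_of_nonpos_of_nonpos (n2 t ⟨hu.1.trans_lt h, ht.2⟩) (by linarith)
    rw [h0] at e2
    linarith
  rcases le_or_gt u d₁ with h | h
  · exact L u ⟨hu.1, h⟩
  rcases le_or_gt d₂ u with h' | h'
  · exact Rr u ⟨h', hu.2⟩
  have hw : (0 : ℝ) < d₂ - d₁ := by linarith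
  have A := L d₁ ⟨hd₁, le_rfl⟩
  have B := Rr d₂ ⟨le_rfl, hd₂⟩
  -- `d₂ - d₁` times the moment at `u` is at most a combination of the moments at `d₁` and `d₂`
  have e1 := intervalIntegral.integral_add_adjacent_intervals (hi x d₁ u) (hi d₁ u u)
  have e2 := intervalIntegral.integral_add_adjacent_intervals (hi x u d₂) (hi u d₂ d₂)
  have e3 := intervalIntegral.integral_add_adjacent_intervals (hi x d₁ d₂) (hi d₁ u d₂)
  have e4 := key d₁ u x d₁
  have e5 := key d₁ d₂ x d₁
  have e6 : 0 ≤ ∫ t in u..d₂, q t * (d₂ - t) := intervalIntegral.integral_nonneg h'.le fun t ht => by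
    rcases eq_or_lt_of_le ht.2 with rfl | h2
    · simp
    · exact mul_nonneg (p t ⟨h.trans_le ht.1, h2⟩) (by linarith)
  have e7 : (d₂ - d₁) * ∫ t in d₁..u, q t * (u - t) ≤ (u - d₁) * ∫ t in d₁..u, q t * (d₂ - t) := by
    rw [← intervalIntegral.integral_const_mul, ← intervalIntegral.integral_const_mul]
    apply intervalIntegral.integral_mono_on h.le ((hi _ _ _).const_mul _) ((hi _ _ _).const_mul _)
    intro t ht
    rcases eq_or_lt_of_le ht.1 with rfl | h2
    · exact le_of_eq (by ring)
    · have := mul_nonneg (p t ⟨h2, ht.2.trans_lt h'⟩) (mul_nonneg (sub_nonneg.2 h2.le) (sub_nonneg.2 h'.le))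
      nlinarith
  nlinarith [mul_nonneg (sub_nonneg.2 h.le) e6, mul_nonpos_of_nonneg_of_nonpos (sub_nonneg.2 h.le) B,
    mul_nonpos_of_nonneg_of_nonpos (sub_nonneg.2 h'.le) A]

/-- At the lower end of the box, the derivative in the direction that fixes the right crossing is
nonpositive. -/
theorem lineForm_left_nonpos (hq : Continuous q) {q₁ : ℝ → ℝ} (hq₁ : Continuous q₁) (hx : x < x')
    (hle : ∀ t ∈ Icc x x', q t ≤ q₁ t) (h0 : ∫ t in x..x', q₁ t = 0)
    (hγ : ∫ t in x..x', q₁ t * (x' - t) ≤ 0)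
    (hd : OrdConnected {t | t ∈ Icc x x' ∧ 0 < q₁ t})
    (hc : c ≤ x) (hc' : x ≤ c') : lineForm q x x' c c' (fun t => c' - t) ≤ 0 := by
  have hi : ∀ p : ℝ → ℝ, Continuous p → ∀ a b v : ℝ,
      IntervalIntegrable (fun t => p t * (v - t)) volume a b := fun p hp a b v =>
    (hp.mul (by fun_prop)).intervalIntegrable _ _
  rw [lineForm_eq hq (by fun_prop)]
  have h2 : 0 ≤ ∫ t in x..c, min (q t) 0 * (c' - t) := by
    rw [intervalIntegral.integral_symm, neg_nonneg]
    exact integral_nonpos_of_min_mul (φ := fun t => c' - t) hc fun t ht => by linarith [ht.2]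
  -- If the crossing is beyond the cell, `c' - t = (x' - t) + (c' - x')` and the total of `q₁` is
  -- zero. If it is inside, only `max q 0` acts on `[c', x']`, against a nonpositive weight, and the
  -- rest is bounded by the partial moment of `q₁` at `c'`.
  rcases le_total x' c' with h | h
  · have h3 : ∫ t in x'..c', min (q t) 0 * (c' - t) ≤ 0 :=
      integral_nonpos_of_min_mul (φ := fun t => c' - t) h fun t ht => by linarith [ht.2]
    have h1 : ∫ t in x..x', q t * (c' - t) ≤ ∫ t in x..x', q₁ t * (c' - t) :=
      intervalIntegral.integral_mono_on hx.le (hi q hq _ _ _) (hi q₁ hq₁ _ _ _)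
        fun t ht => mul_le_mul_of_nonneg_right (hle t ht) (by linarith [ht.2])
    have h4 : ∫ t in x..x', q₁ t * (c' - t) = (∫ t in x..x', q₁ t * (x' - t)) +
        (c' - x') * ∫ t in x..x', q₁ t := by
      rw [← intervalIntegral.integral_const_mul, ← intervalIntegral.integral_add (hi q₁ hq₁ _ _ _)
        ((hq₁.intervalIntegrable _ _).const_mul _)]
      congr 1; ext t; ring
    rw [h0] at h4
    linarith
  · have e1 := intervalIntegral.integral_add_adjacent_intervals (hi q hq x c' c') (hi q hq c' x' c')
    have e2 := integral_eq_max_add_min hq (φ := fun t => c' - t) (by fun_prop) c' x'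
    have e3 : ∫ t in x'..c', min (q t) 0 * (c' - t) = -∫ t in c'..x', min (q t) 0 * (c' - t) :=
      intervalIntegral.integral_symm _ _
    have e4 : ∫ t in c'..x', max (q t) 0 * (c' - t) ≤ 0 :=
      intervalIntegral_nonpos h fun t ht =>
        mul_nonpos_of_nonneg_of_nonpos (le_max_right _ _) (by linarith [ht.1])
    have e5 : ∫ t in x..c', q t * (c' - t) ≤ ∫ t in x..c', q₁ t * (c' - t) :=
      intervalIntegral.integral_mono_on hc' (hi q hq _ _ _) (hi q₁ hq₁ _ _ _)
        fun t ht => mul_le_mul_of_nonneg_right (hle t ⟨ht.1, ht.2.trans h⟩) (by linarith [ht.2])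
    have e6 := integral_mul_sub_nonpos hq₁ hx hd h0 hγ ⟨hc', h⟩
    linarith

/-- If the form vanishes on affine functions, then `q ≤ 0` between the node and the crossing. -/
theorem nonpos_of_lineForm_eq_zero (hq : Continuous q) (hx : x < x')
    (hd : OrdConnected {t | t ∈ Icc x x' ∧ 0 < q t})
    (h0 : ∀ s, lineForm q x x' c c' (fun t => s - t) = 0) (hcx : c ≤ x') :
    ∀ t ∈ Ico x c, q t ≤ 0 := by
  intro t₀ ht₀
  by_contra hpos
  rw [not_le] at hpos
  obtain ⟨d₁, d₂, hd₁, h12, hd₂, n1, p, n2, hin⟩ := exists_sign_pattern hx.le hd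
  have ht₀I : t₀ ∈ Icc x x' := ⟨ht₀.1, ht₀.2.le.trans hcx⟩
  have hcd : d₁ < c := (hin t₀ ht₀I hpos).1.trans_lt ht₀.2
  -- With the test function `σ - t` both terms of the form are nonnegative: the weight is
  -- nonnegative where `q > 0` in the cell, and on `[c, c']` to the left of `σ` the negative part
  -- vanishes. Since `t₀ < c ≤ σ`, the first term would even be positive.
  set σ := max d₂ c with hσ
  have s1 : d₂ ≤ σ := le_max_left _ _
  have s2 : c ≤ σ := le_max_right _ _
  have hA0 : ∀ t ∈ Icc x x', 0 ≤ max (q t) 0 * (σ - t) := by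
    intro t ht
    rcases le_or_gt t σ with h | h
    · exact mul_nonneg (le_max_right _ _) (by linarith)
    · rw [max_eq_right (n2 t ⟨s1.trans_lt h, ht.2⟩), zero_mul]
  have hB : 0 ≤ ∫ t in c..c', min (q t) 0 * (σ - t) := by
    rcases le_total c c' with h | h
    · apply intervalIntegral.integral_nonneg h
      intro t ht
      rcases le_or_gt σ t with h' | h'
      · exact mul_nonneg_of_nonpos_of_nonpos (min_le_right _ _) (by linarith)
      · have : t < d₂ := by
          rcases lt_max_iff.1 h' with h' | h'
          · exact h'
          · exact absurd ht.1 (not_le.2 h')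
        rw [min_eq_right (p t ⟨hcd.trans_le ht.1, this⟩), zero_mul]
    · rw [intervalIntegral.integral_symm, neg_nonneg]
      exact integral_nonpos_of_min_mul (φ := fun t => σ - t) h fun t ht => by linarith [ht.2]
  have hA : ∫ t in x..x', max (q t) 0 * (σ - t) ≤ 0 := by
    have := h0 σ
    rw [lineForm] at this
    linarith
  have hcont : ContinuousOn (fun t => max (q t) 0 * (σ - t)) (Icc x x') := by fun_prop
  have := intervalIntegral.integral_pos hx hcont (fun t ht => hA0 t ⟨ht.1.le, ht.2⟩)
    ⟨t₀, ht₀I, mul_pos (lt_max_of_lt_left hpos) (by linarith [ht₀.2])⟩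
  linarith

end

/-! ### Affine functions given by their end values -/

/-- Minus the slope of `seg`. -/
def steep (x x' a b : ℝ) : ℝ := (a - b) / (x' - x)

section seg
variable {x x' : ℝ}

theorem seg_eq_left (hx : x < x') (a b t : ℝ) : seg x x' a b t = a - steep x x' a b * (t - x) := by
  have : x' - x ≠ 0 := (sub_pos.2 hx).ne'
  unfold seg steep; field_simp; ring

theorem seg_eq_right (hx : x < x') (a b t : ℝ) :
    seg x x' a b t = b - steep x x' a b * (t - x') := by
  have : x' - x ≠ 0 := (sub_pos.2 hx).ne'
  unfold seg steep; field_simp; ring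

@[fun_prop]
theorem continuous_seg (a b : ℝ) : Continuous (seg x x' a b) := by
  unfold seg; fun_prop

theorem seg_left (hx : x < x') (a b : ℝ) : seg x x' a b x = a := by
  rw [seg_eq_left hx]; ring

theorem seg_right (hx : x < x') (a b : ℝ) : seg x x' a b x' = b := by
  rw [seg_eq_right hx]; ring

theorem seg_add_mul (a b a' b' s t : ℝ) :
    seg x x' (a + s * a') (b + s * b') t = seg x x' a b t + s * seg x x' a' b' t := by
  unfold seg; ring

theorem seg_mono (hx : x < x') {a b a' b' t : ℝ} (ha : a ≤ a') (hb : b ≤ b') (ht : t ∈ Icc x x') :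
    seg x x' a b t ≤ seg x x' a' b' t := by
  have : 0 < x' - x := sub_pos.2 hx
  unfold seg
  rw [div_le_div_iff_of_pos_right this]
  nlinarith [mul_nonneg (sub_nonneg.2 ha) (sub_nonneg.2 ht.2),
    mul_nonneg (sub_nonneg.2 hb) (sub_nonneg.2 ht.1)]

theorem le_seg (hx : x < x') {a b m t : ℝ} (ha : m ≤ a) (hb : m ≤ b) (ht : t ∈ Icc x x') :
    m ≤ seg x x' a b t := by
  have h := seg_mono hx ha hb ht
  have : seg x x' m m t = m := by
    rw [seg_eq_left hx, steep]; simp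
  rwa [this] at h

end seg

/-! ### Traps, families of lines and their energy -/

/-- The data for the construction of an exact chain: cells `[X j, X (j+1)]`, `j ≤ k`, with a range
`[lo l, up l]` of admissible values at each node. -/
structure IsTrap (k : ℕ) (q : ℝ → ℝ → ℝ) (X lo up : ℕ → ℝ) : Prop where
  cont : Continuous (Function.uncurry q)
  mono : ∀ t, Monotone (q t)
  lt : ∀ j ≤ k, X j < X (j + 1)
  le : ∀ l, lo l ≤ up l
  bal₁ : ∀ j ≤ k, ∫ t in X j..X (j + 1), q t (seg (X j) (X (j + 1)) (lo j) (up (j + 1)) t) = 0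
  bal₂ : ∀ j ≤ k, ∫ t in X j..X (j + 1), q t (seg (X j) (X (j + 1)) (up j) (lo (j + 1)) t) = 0
  mom₁ : ∀ j ≤ k, ∫ t in X j..X (j + 1),
    q t (seg (X j) (X (j + 1)) (lo j) (up (j + 1)) t) * (X (j + 1) - t) ≤ 0
  mom₂ : ∀ j ≤ k, 0 ≤ ∫ t in X j..X (j + 1),
    q t (seg (X j) (X (j + 1)) (up j) (lo (j + 1)) t) * (X (j + 1) - t)
  conc : ∀ j < k, steep (X j) (X (j + 1)) (up j) (lo (j + 1)) ≤
    steep (X (j + 1)) (X (j + 2)) (lo (j + 1)) (up (j + 2))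
  dip : ∀ j ≤ k, ∀ a ∈ Icc (lo j) (up j), ∀ b ∈ Icc (lo (j + 1)) (up (j + 1)),
    OrdConnected {t | t ∈ Icc (X j) (X (j + 1)) ∧ 0 < q t (seg (X j) (X (j + 1)) a b t)}
  pos : ∀ j ≤ k, ∀ a ∈ Icc (lo j) (up j), ∀ b ∈ Icc (lo (j + 1)) (up (j + 1)),
    ∀ t₀ ∈ Icc (X j) (X (j + 1)),
      seg (X j) (X (j + 1)) (lo j) (up (j + 1)) t₀ ≤ seg (X j) (X (j + 1)) a b t₀ →
      seg (X j) (X (j + 1)) (up j) (lo (j + 1)) t₀ ≤ seg (X j) (X (j + 1)) a b t₀ →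
      ∃ t ∈ Icc (X j) (X (j + 1)), 0 < q t (seg (X j) (X (j + 1)) a b t)

/-- The admissible end values. -/
def InBox (lo up a b : ℕ → ℝ) : Prop :=
  ∀ j, a j ∈ Icc (lo j) (up j) ∧ b j ∈ Icc (lo (j + 1)) (up (j + 1))

/-- The `j`-th line. -/
def line (X a b : ℕ → ℝ) (j : ℕ) (t : ℝ) : ℝ := seg (X j) (X (j + 1)) (a j) (b j) t

/-- Minus the slope of the `j`-th line. -/
def lineSteep (X a b : ℕ → ℝ) (j : ℕ) : ℝ := steep (X j) (X (j + 1)) (a j) (b j)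

/-- The crossing of the lines `j` and `j + 1`. -/
def crossing (X a b : ℕ → ℝ) (j : ℕ) : ℝ :=
  X (j + 1) + (a (j + 1) - b j) / (lineSteep X a b (j + 1) - lineSteep X a b j)

/-- The end points of the linear pieces. -/
def breakpt (k : ℕ) (X a b : ℕ → ℝ) : ℕ → ℝ
  | 0 => X 0
  | j + 1 => if j < k then crossing X a b j else X (j + 1)

/-- The energy of a family of lines. -/
def chainEnergy (k : ℕ) (q : ℝ → ℝ → ℝ) (X a b : ℕ → ℝ) : ℝ :=
  (∑ j ∈ Finset.range (k + 1), ∫ t in X j..X (j + 1), prim q t (line X a b j t)) +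
  ∑ j ∈ Finset.range k,
    ((∫ t in X j..X (j + 2),
        prim (fun t u => min (q t u) 0) t (min (line X a b j t) (line X a b (j + 1) t))) -
      (∫ t in X j..X (j + 1), prim (fun t u => min (q t u) 0) t (line X a b j t)) -
      ∫ t in X (j + 1)..X (j + 2), prim (fun t u => min (q t u) 0) t (line X a b (j + 1) t))

theorem continuous_chainEnergy (k : ℕ) {q : ℝ → ℝ → ℝ} (hq : Continuous (Function.uncurry q))
    (X : ℕ → ℝ) : Continuous fun p : (ℕ → ℝ) × (ℕ → ℝ) => chainEnergy k q X p.1 p.2 := by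
  have hr : Continuous (Function.uncurry fun t u => min (q t u) 0) := hq.min continuous_const
  have hl : ∀ j, Continuous fun z : ((ℕ → ℝ) × (ℕ → ℝ)) × ℝ => line X z.1.1 z.1.2 j z.2 := by
    intro j; unfold line seg; fun_prop
  have hP := continuous_prim hq
  have hR := continuous_prim hr
  unfold chainEnergy
  refine (continuous_finsetSum _ fun j _ => ?_).add (continuous_finsetSum _ fun j _ => ?_)
  · exact intervalIntegral.continuous_parametric_intervalIntegral_of_continuous'
      (f := fun (p : (ℕ → ℝ) × (ℕ → ℝ)) t => prim q t (line X p.1 p.2 j t))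
      (hP.comp (continuous_snd.prodMk (hl j))) _ _
  · refine (Continuous.sub ?_ ?_).sub ?_
    · exact intervalIntegral.continuous_parametric_intervalIntegral_of_continuous'
        (f := fun (p : (ℕ → ℝ) × (ℕ → ℝ)) t => prim (fun t u => min (q t u) 0) t
          (min (line X p.1 p.2 j t) (line X p.1 p.2 (j + 1) t)))
        (hR.comp (continuous_snd.prodMk ((hl j).min (hl (j + 1))))) _ _
    · exact intervalIntegral.continuous_parametric_intervalIntegral_of_continuous'
        (f := fun (p : (ℕ → ℝ) × (ℕ → ℝ)) t => prim (fun t u => min (q t u) 0) t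
          (line X p.1 p.2 j t)) (hR.comp (continuous_snd.prodMk (hl j))) _ _
    · exact intervalIntegral.continuous_parametric_intervalIntegral_of_continuous'
        (f := fun (p : (ℕ → ℝ) × (ℕ → ℝ)) t => prim (fun t u => min (q t u) 0) t
          (line X p.1 p.2 (j + 1) t)) (hR.comp (continuous_snd.prodMk (hl (j + 1)))) _ _

/-- The box is a product of compact intervals, also over the indices that the energy does not see,
and the energy is continuous for the product topology. -/
theorem exists_min_chainEnergy (k : ℕ) {q : ℝ → ℝ → ℝ} (hq : Continuous (Function.uncurry q))
    (X : ℕ → ℝ) {lo up : ℕ → ℝ} (hle : ∀ l, lo l ≤ up l) :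
    ∃ a b, InBox lo up a b ∧ ∀ a' b', InBox lo up a' b' →
      chainEnergy k q X a b ≤ chainEnergy k q X a' b' := by
  set f : (ℕ → ℝ) × (ℕ → ℝ) → ℝ := fun p => chainEnergy k q X p.1 p.2 with hf
  have hfc : Continuous f := continuous_chainEnergy k hq X
  set K : Set ((ℕ → ℝ) × (ℕ → ℝ)) := {p | InBox lo up p.1 p.2} with hKdef
  have hKe : K = (univ.pi fun j => Icc (lo j) (up j)) ×ˢ
      (univ.pi fun j => Icc (lo (j + 1)) (up (j + 1))) := by
    ext p
    simp only [hKdef, InBox, mem_ofPred_eq, mem_prod, mem_univ_pi, forall_and]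
  have hK : IsCompact K := by
    rw [hKe]
    exact (isCompact_univ_pi fun _ => isCompact_Icc).prod (isCompact_univ_pi fun _ => isCompact_Icc)
  have hne : K.Nonempty := ⟨(lo, fun j => lo (j + 1)), fun j => ⟨⟨le_rfl, hle j⟩, ⟨le_rfl, hle _⟩⟩⟩
  obtain ⟨p, hp, hmin⟩ := hK.exists_isMinOn hne hfc.continuousOn
  exact ⟨p.1, p.2, hp, fun a' b' h => isMinOn_iff.1 hmin (a', b') h⟩

theorem line_eq_left {X : ℕ → ℝ} {j : ℕ} (h : X j < X (j + 1)) (a b : ℕ → ℝ) (t : ℝ) :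
    line X a b j t = a j - lineSteep X a b j * (t - X j) := seg_eq_left h _ _ _

theorem line_eq_right {X : ℕ → ℝ} {j : ℕ} (h : X j < X (j + 1)) (a b : ℕ → ℝ) (t : ℝ) :
    line X a b j t = b j - lineSteep X a b j * (t - X (j + 1)) := seg_eq_right h _ _ _

@[fun_prop]
theorem continuous_line (X a b : ℕ → ℝ) (j : ℕ) : Continuous (line X a b j) := continuous_seg _ _

theorem line_sub_line {X : ℕ → ℝ} {j : ℕ} (h : X j < X (j + 1)) (h' : X (j + 1) < X (j + 2))
    (a b : ℕ → ℝ) (t : ℝ) :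
    line X a b j t - line X a b (j + 1) t =
      (lineSteep X a b (j + 1) - lineSteep X a b j) * (t - X (j + 1)) - (a (j + 1) - b j) := by
  rw [line_eq_right h, line_eq_left h']; ring

theorem line_sub_line_eq {X : ℕ → ℝ} {j : ℕ} (h : X j < X (j + 1)) (h' : X (j + 1) < X (j + 2))
    {a b : ℕ → ℝ} (hJ : lineSteep X a b j < lineSteep X a b (j + 1) ∨
      (lineSteep X a b j = lineSteep X a b (j + 1) ∧ a (j + 1) = b j)) (t : ℝ) :
    line X a b j t - line X a b (j + 1) t =
      (lineSteep X a b (j + 1) - lineSteep X a b j) * (t - crossing X a b j) := by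
  rw [line_sub_line h h']
  rcases hJ with hJ | ⟨hJ, hab⟩
  · have : lineSteep X a b (j + 1) - lineSteep X a b j ≠ 0 := (sub_pos.2 hJ).ne'
    rw [crossing]; field_simp; ring
  · rw [hJ, hab]; ring

/-- A direction in which the crossings behave regularly. -/
def Regular (X a b da db : ℕ → ℝ) (j : ℕ) : Prop :=
  lineSteep X a b j < lineSteep X a b (j + 1) ∨
    (lineSteep X a b j = lineSteep X a b (j + 1) ∧ a (j + 1) = b j ∧ da (j + 1) = db j ∧
      lineSteep X da db j ≤ lineSteep X da db (j + 1))

/-- Off the crossing the lower of two distinct lines stays the lower one for small `s`. Coincident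
lines, perturbed in a regular direction, keep meeting at the node, and the order of the perturbing
slopes decides which is lower on each side. -/
theorem eventually_min_line {X : ℕ → ℝ} {j : ℕ} (h : X j < X (j + 1)) (h' : X (j + 1) < X (j + 2))
    {a b da db : ℕ → ℝ} (hr : Regular X a b da db j) {t : ℝ} (ht : t ≠ crossing X a b j) :
    ∀ᶠ s in 𝓝[>] (0 : ℝ), min (line X a b j t + s * line X da db j t)
        (line X a b (j + 1) t + s * line X da db (j + 1) t) =
      min (line X a b j t) (line X a b (j + 1) t) +
        s * (if t < crossing X a b j then line X da db j t else line X da db (j + 1) t) := by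
  have key := line_sub_line_eq h h' (hr.imp id fun h => ⟨h.1, h.2.1⟩) t
  rcases hr with hJ | ⟨hJ, hab, hd, hdJ⟩
  · have hc : ∀ u v φ χ : ℝ, u < v → ∀ᶠ s in 𝓝[>] (0 : ℝ), u + s * φ < v + s * χ := by
      intro u v φ χ huv
      have h1 : Tendsto (fun s : ℝ => u + s * φ) (𝓝[>] 0) (𝓝 (u + 0 * φ)) :=
        ((continuous_const.add (continuous_id.mul continuous_const)).tendsto 0).mono_left
          nhdsWithin_le_nhds
      have h2 : Tendsto (fun s : ℝ => v + s * χ) (𝓝[>] 0) (𝓝 (v + 0 * χ)) :=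
        ((continuous_const.add (continuous_id.mul continuous_const)).tendsto 0).mono_left
          nhdsWithin_le_nhds
      exact h1.eventually_lt h2 (by simpa using huv)
    rcases lt_or_gt_of_ne ht with hlt | hgt
    · have hl : line X a b j t < line X a b (j + 1) t := by
        nlinarith
      filter_upwards [hc _ _ (line X da db j t) (line X da db (j + 1) t) hl] with s hs
      rw [min_eq_left hs.le, min_eq_left hl.le, if_pos hlt]
    · have hl : line X a b (j + 1) t < line X a b j t := by
        nlinarith
      filter_upwards [hc _ _ (line X da db (j + 1) t) (line X da db j t) hl] with s hs
      rw [min_eq_right hs.le, min_eq_right hl.le, if_neg (not_lt.2 hgt.le)]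
  · have heq : line X a b j t = line X a b (j + 1) t := by
      rw [hJ, sub_self, zero_mul] at key; linarith
    have hcr : crossing X a b j = X (j + 1) := by rw [crossing, hJ]; simp
    have hdiff := line_sub_line h h' da db t
    rw [hd, sub_self, sub_zero] at hdiff
    filter_upwards [self_mem_nhdsWithin] with s hs
    have hs0 : 0 < s := hs
    rw [hcr, heq, min_self, min_add_add_left]
    congr 1
    split_ifs with hlt
    · exact min_eq_left (mul_le_mul_of_nonneg_left (by nlinarith) hs0.le)
    · rw [not_lt] at hlt
      exact min_eq_right (mul_le_mul_of_nonneg_left (by nlinarith) hs0.le)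

theorem tendsto_slope_integral_prim {q : ℝ → ℝ → ℝ} (hq : Continuous (Function.uncurry q))
    {u φ : ℝ → ℝ} (hu : Continuous u) (hφ : Continuous φ) (x x' : ℝ) :
    Tendsto (fun s => ((∫ t in x..x', prim q t (u t + s * φ t)) -
        ∫ t in x..x', prim q t (u t)) / s) (𝓝[>] 0) (𝓝 (∫ t in x..x', q t (u t) * φ t)) := by
  simpa only [min_self] using tendsto_slope_integral_prim_min hq hu hu hφ hφ (x := x) (x' := x') φ
    (Eventually.of_forall fun t => Eventually.of_forall fun s => by simp only [min_self])

/-! ### Position of the crossings and the derivative of the energy -/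

section
variable {k : ℕ} {q : ℝ → ℝ → ℝ} {X lo up a b : ℕ → ℝ}

/-- The gap of two successive slopes is the concavity gap of the reference lines plus four slacks of
end values. In the box every term is nonnegative, so the slopes are always ordered, and equal slopes
force all slacks to vanish. -/
theorem lineSteep_sub (X lo up a b : ℕ → ℝ) (j : ℕ) :
    lineSteep X a b (j + 1) - lineSteep X a b j =
      (steep (X (j + 1)) (X (j + 2)) (lo (j + 1)) (up (j + 2)) -
        steep (X j) (X (j + 1)) (up j) (lo (j + 1))) +
      (a (j + 1) - lo (j + 1)) / (X (j + 2) - X (j + 1)) +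
      (up (j + 2) - b (j + 1)) / (X (j + 2) - X (j + 1)) +
      (up j - a j) / (X (j + 1) - X j) + (b j - lo (j + 1)) / (X (j + 1) - X j) := by
  unfold lineSteep steep; ring

theorem IsTrap.gap_terms (H : IsTrap k q X lo up) (hab : InBox lo up a b) {j : ℕ} (hj : j < k) :
    0 ≤ steep (X (j + 1)) (X (j + 2)) (lo (j + 1)) (up (j + 2)) -
        steep (X j) (X (j + 1)) (up j) (lo (j + 1)) ∧
      0 ≤ (a (j + 1) - lo (j + 1)) / (X (j + 2) - X (j + 1)) ∧
      0 ≤ (up (j + 2) - b (j + 1)) / (X (j + 2) - X (j + 1)) ∧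
      0 ≤ (up j - a j) / (X (j + 1) - X j) ∧ 0 ≤ (b j - lo (j + 1)) / (X (j + 1) - X j) := by
  have h1 := sub_pos.2 (H.lt j hj.le)
  have h2 := sub_pos.2 (H.lt (j + 1) hj)
  exact ⟨sub_nonneg.2 (H.conc j hj), div_nonneg (sub_nonneg.2 (hab (j + 1)).1.1) h2.le,
    div_nonneg (sub_nonneg.2 (hab (j + 1)).2.2) h2.le,
    div_nonneg (sub_nonneg.2 (hab j).1.2) h1.le, div_nonneg (sub_nonneg.2 (hab j).2.1) h1.le⟩

theorem IsTrap.lineSteep_le (H : IsTrap k q X lo up) (hab : InBox lo up a b) {j : ℕ} (hj : j < k) :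
    lineSteep X a b j ≤ lineSteep X a b (j + 1) := by
  obtain ⟨h1, h2, h3, h4, h5⟩ := H.gap_terms hab hj
  have := lineSteep_sub X lo up a b j
  linarith

/-- Two neighbouring lines either cross properly or coincide, with extremal end values. -/
theorem IsTrap.lt_or_coincide (H : IsTrap k q X lo up) (hab : InBox lo up a b) {j : ℕ}
    (hj : j < k) : lineSteep X a b j < lineSteep X a b (j + 1) ∨
      (lineSteep X a b j = lineSteep X a b (j + 1) ∧ a (j + 1) = lo (j + 1) ∧
        b j = lo (j + 1) ∧ a j = up j ∧ b (j + 1) = up (j + 2)) := by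
  rcases (H.lineSteep_le hab hj).lt_or_eq with h | h
  · exact Or.inl h
  right
  obtain ⟨h1, h2, h3, h4, h5⟩ := H.gap_terms hab hj
  have he := lineSteep_sub X lo up a b j
  have e1 := (sub_pos.2 (H.lt j hj.le)).ne'
  have e2 := (sub_pos.2 (H.lt (j + 1) hj)).ne'
  have z : ∀ {y L : ℝ}, L ≠ 0 → y / L = 0 → y = 0 := fun hL hy => by
    rcases div_eq_zero_iff.1 hy with h | h
    · exact h
    · exact absurd h hL
  refine ⟨h, ?_, ?_, ?_, ?_⟩
  · have := z e2 (le_antisymm (by linarith) h2); linarith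
  · have := z e1 (le_antisymm (by linarith) h5); linarith
  · have := z e1 (le_antisymm (by linarith) h4); linarith
  · have := z e2 (le_antisymm (by linarith) h3); linarith

/-- The slope gap dominates each slack at the common node divided by the length of its cell, so the
crossing is at most one cell away from the node. For coincident lines, division by zero puts it at
the node. -/
theorem IsTrap.crossing_mem (H : IsTrap k q X lo up) (hab : InBox lo up a b) {j : ℕ} (hj : j < k) :
    crossing X a b j ∈ Icc (X j) (X (j + 2)) := by
  have e1 := sub_pos.2 (H.lt j hj.le)
  have e2 := sub_pos.2 (H.lt (j + 1) hj)
  rcases H.lt_or_coincide hab hj with h | ⟨h, -⟩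
  · obtain ⟨h1, h2, h3, h4, h5⟩ := H.gap_terms hab hj
    have he := lineSteep_sub X lo up a b j
    have hJ := sub_pos.2 h
    have i1 : (a (j + 1) - lo (j + 1)) / (X (j + 2) - X (j + 1)) ≤
      lineSteep X a b (j + 1) - lineSteep X a b j := by linarith
    have i2 : (b j - lo (j + 1)) / (X (j + 1) - X j) ≤
      lineSteep X a b (j + 1) - lineSteep X a b j := by linarith
    rw [div_le_iff₀ e2] at i1
    rw [div_le_iff₀ e1] at i2
    have b1 := (hab (j + 1)).1.1
    have b2 := (hab j).2.1
    have u1 : (a (j + 1) - b j) / (lineSteep X a b (j + 1) - lineSteep X a b j) ≤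
        X (j + 2) - X (j + 1) := by
      rw [div_le_iff₀ hJ]; linarith
    have u2 : -(X (j + 1) - X j) ≤
        (a (j + 1) - b j) / (lineSteep X a b (j + 1) - lineSteep X a b j) := by
      rw [le_div_iff₀ hJ]; linarith
    unfold crossing
    constructor <;> linarith
  · unfold crossing
    rw [h]
    constructor <;> simp <;> linarith

theorem IsTrap.le_crossing (H : IsTrap k q X lo up) (hab : InBox lo up a b) {j : ℕ} (hj : j < k)
    (h : b j ≤ a (j + 1)) : X (j + 1) ≤ crossing X a b j := by
  unfold crossing
  have := div_nonneg (sub_nonneg.2 h) (sub_nonneg.2 (H.lineSteep_le hab hj))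
  linarith

theorem IsTrap.crossing_le (H : IsTrap k q X lo up) (hab : InBox lo up a b) {j : ℕ} (hj : j < k)
    (h : a (j + 1) ≤ b j) : crossing X a b j ≤ X (j + 1) := by
  unfold crossing
  have := div_nonpos_of_nonpos_of_nonneg (sub_nonpos.2 h) (sub_nonneg.2 (H.lineSteep_le hab hj))
  linarith

/-- The derivative of the energy along line `j` as a functional of the perturbation. -/
def chainForm (k : ℕ) (q : ℝ → ℝ → ℝ) (X a b : ℕ → ℝ) (j : ℕ) (φ : ℝ → ℝ) : ℝ :=
  lineForm (fun t => q t (line X a b j t)) (X j) (X (j + 1)) (breakpt k X a b j)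
    (breakpt k X a b (j + 1)) φ

theorem IsTrap.line_le_line_iff (H : IsTrap k q X lo up) (hab : InBox lo up a b) {j : ℕ}
    (hj : j < k) (t : ℝ) : line X a b j t - line X a b (j + 1) t =
      (lineSteep X a b (j + 1) - lineSteep X a b j) * (t - crossing X a b j) :=
  line_sub_line_eq (H.lt j hj.le) (H.lt (j + 1) hj) ((H.lt_or_coincide hab hj).imp id
    fun h => ⟨h.1, h.2.1.trans h.2.2.1.symm⟩) t

/-- The right derivative of the energy. -/
theorem IsTrap.tendsto_energy (H : IsTrap k q X lo up) (hab : InBox lo up a b) {da db : ℕ → ℝ}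
    (hr : ∀ j < k, Regular X a b da db j) :
    Tendsto (fun s => (chainEnergy k q X (fun j => a j + s * da j) (fun j => b j + s * db j) -
        chainEnergy k q X a b) / s) (𝓝[>] 0)
      (𝓝 (∑ j ∈ Finset.range (k + 1), chainForm k q X a b j (line X da db j))) := by
  have hrc : Continuous (Function.uncurry fun t u => min (q t u) 0) := H.cont.min continuous_const
  have hqc : ∀ u : ℝ → ℝ, Continuous u → Continuous fun t => q t (u t) := fun u hu =>
    H.cont.comp (continuous_id.prodMk hu)
  have hlin : ∀ j s t, line X (fun j => a j + s * da j) (fun j => b j + s * db j) j t =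
      line X a b j t + s * line X da db j t := fun j s t => seg_add_mul _ _ _ _ _ _
  have T1 : ∀ j, Tendsto (fun s => ((∫ t in X j..X (j + 1), prim q t
        (line X a b j t + s * line X da db j t)) -
        ∫ t in X j..X (j + 1), prim q t (line X a b j t)) / s) (𝓝[>] 0)
      (𝓝 (∫ t in X j..X (j + 1), q t (line X a b j t) * line X da db j t)) := fun j =>
    tendsto_slope_integral_prim H.cont (by fun_prop) (by fun_prop) _ _
  have T2 : ∀ i x x', Tendsto (fun s => ((∫ t in x..x', prim (fun t u => min (q t u) 0) t
        (line X a b i t + s * line X da db i t)) -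
        ∫ t in x..x', prim (fun t u => min (q t u) 0) t (line X a b i t)) / s) (𝓝[>] 0)
      (𝓝 (∫ t in x..x', min (q t (line X a b i t)) 0 * line X da db i t)) := fun j _ _ =>
    tendsto_slope_integral_prim hrc (by fun_prop) (by fun_prop) _ _
  have T3 : ∀ j < k, Tendsto (fun s => ((∫ t in X j..X (j + 2),
        prim (fun t u => min (q t u) 0) t (min (line X a b j t + s * line X da db j t)
          (line X a b (j + 1) t + s * line X da db (j + 1) t))) -
        ∫ t in X j..X (j + 2), prim (fun t u => min (q t u) 0) t
          (min (line X a b j t) (line X a b (j + 1) t))) / s) (𝓝[>] 0)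
      (𝓝 ((∫ t in X j..crossing X a b j, min (q t (line X a b j t)) 0 * line X da db j t) +
        ∫ t in crossing X a b j..X (j + 2),
          min (q t (line X a b (j + 1) t)) 0 * line X da db (j + 1) t)) := by
    intro j hj
    have hcm := H.crossing_mem hab hj
    have hgap := sub_nonneg.2 (H.lineSteep_le hab hj)
    have := tendsto_slope_integral_prim_min hrc (u := line X a b j) (v := line X a b (j + 1))
      (φ := line X da db j) (χ := line X da db (j + 1)) (by fun_prop) (by fun_prop) (by fun_prop)
      (by fun_prop) (x := X j) (x' := X (j + 2))
      (fun t => if t < crossing X a b j then line X da db j t else line X da db (j + 1) t) (by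
        have h0 : ∀ᵐ t : ℝ, t ≠ crossing X a b j := by simp [ae_iff, measure_singleton]
        filter_upwards [h0] with t ht
        exact eventually_min_line (H.lt j hj.le) (H.lt (j + 1) hj) (hr j hj) ht)
    convert this using 2
    have e1 : EqOn (fun t => min (q t (line X a b j t)) 0 * line X da db j t)
        (fun t => min (q t (min (line X a b j t) (line X a b (j + 1) t))) 0 *
          if t < crossing X a b j then line X da db j t else line X da db (j + 1) t)
        (Ioo (X j) (crossing X a b j)) := by
      intro t ht
      have := H.line_le_line_iff hab hj t
      have hle : line X a b j t ≤ line X a b (j + 1) t := by nlinarith [ht.2]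
      simp only [min_eq_left hle, if_pos ht.2]
    have e2 : EqOn (fun t => min (q t (line X a b (j + 1) t)) 0 * line X da db (j + 1) t)
        (fun t => min (q t (min (line X a b j t) (line X a b (j + 1) t))) 0 *
          if t < crossing X a b j then line X da db j t else line X da db (j + 1) t)
        (Ioo (crossing X a b j) (X (j + 2))) := by
      intro t ht
      have := H.line_le_line_iff hab hj t
      have hle : line X a b (j + 1) t ≤ line X a b j t := by nlinarith [ht.1]
      simp only [min_eq_right hle, if_neg (not_lt.2 ht.1.le)]
    have i1 : IntervalIntegrable (fun t => min (q t (line X a b j t)) 0 * line X da db j t) volume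
        (X j) (crossing X a b j) :=
      (((hqc _ (by fun_prop)).min continuous_const).mul (by fun_prop)).intervalIntegrable _ _
    have i2 : IntervalIntegrable
        (fun t => min (q t (line X a b (j + 1) t)) 0 * line X da db (j + 1) t) volume
        (crossing X a b j) (X (j + 2)) :=
      (((hqc _ (by fun_prop)).min continuous_const).mul (by fun_prop)).intervalIntegrable _ _
    rw [← intervalIntegral.integral_add_adjacent_intervals
      (i1.congr_uIoo (by simpa [uIoo_of_le hcm.1] using e1))
      (i2.congr_uIoo (by simpa [uIoo_of_le hcm.2] using e2))]
    congr 1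
    · exact intervalIntegral.integral_congr_uIoo (by simpa [uIoo_of_le hcm.1] using e1)
    · exact intervalIntegral.integral_congr_uIoo (by simpa [uIoo_of_le hcm.2] using e2)
  have hmin : ∀ i φ, Continuous φ → ∀ x x', IntervalIntegrable
      (fun t => min (q t (line X a b i t)) 0 * φ t) volume x x' := fun i φ hφ x x' =>
    (((hqc _ (by fun_prop)).min continuous_const).mul hφ).intervalIntegrable _ _
  -- Each correction term of the energy moves the end of the negative parts of lines `j` and `j + 1`
  -- from the node to their crossing. Regrouped by lines, the derivative is a sum of line forms.
  have hlim : ∑ j ∈ Finset.range (k + 1), chainForm k q X a b j (line X da db j) =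
      (∑ j ∈ Finset.range (k + 1),
        ∫ t in X j..X (j + 1), q t (line X a b j t) * line X da db j t) +
      ∑ j ∈ Finset.range k,
        (((∫ t in X j..crossing X a b j, min (q t (line X a b j t)) 0 * line X da db j t) +
        ∫ t in crossing X a b j..X (j + 2),
          min (q t (line X a b (j + 1) t)) 0 * line X da db (j + 1) t) -
        (∫ t in X j..X (j + 1), min (q t (line X a b j t)) 0 * line X da db j t) -
        ∫ t in X (j + 1)..X (j + 2),
          min (q t (line X a b (j + 1) t)) 0 * line X da db (j + 1) t) := by
    have e1 : ∀ j, chainForm k q X a b j (line X da db j) =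
        (∫ t in X j..X (j + 1), q t (line X a b j t) * line X da db j t) -
        (∫ t in X j..breakpt k X a b j, min (q t (line X a b j t)) 0 * line X da db j t) +
        ∫ t in X (j + 1)..breakpt k X a b (j + 1),
          min (q t (line X a b j t)) 0 * line X da db j t := fun j =>
      lineForm_eq (hqc _ (by fun_prop)) (by fun_prop)
    simp_rw [e1, Finset.sum_add_distrib, Finset.sum_sub_distrib]
    rw [Finset.sum_range_succ' (fun j => ∫ t in X j..breakpt k X a b j,
        min (q t (line X a b j t)) 0 * line X da db j t),
      Finset.sum_range_succ (fun j => ∫ t in X (j + 1)..breakpt k X a b (j + 1),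
        min (q t (line X a b j t)) 0 * line X da db j t)]
    have e2 : breakpt k X a b (k + 1) = X (k + 1) := by simp [breakpt]
    rw [e2, show breakpt k X a b 0 = X 0 from rfl, intervalIntegral.integral_same,
      intervalIntegral.integral_same, add_zero, add_zero, sub_add, ← Finset.sum_sub_distrib,
      sub_eq_add_neg, ← Finset.sum_neg_distrib, ← Finset.sum_sub_distrib,
      ← Finset.sum_sub_distrib]
    congr 1
    apply Finset.sum_congr rfl
    intro j hj
    have e3 : breakpt k X a b (j + 1) = crossing X a b j := by
      simp [breakpt, Finset.mem_range.1 hj]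
    rw [e3]
    have f1 := intervalIntegral.integral_add_adjacent_intervals
      (hmin j (line X da db j) (by fun_prop) (X j) (X (j + 1)))
      (hmin j (line X da db j) (by fun_prop) (X (j + 1)) (crossing X a b j))
    have f2 := intervalIntegral.integral_add_adjacent_intervals
      (hmin (j + 1) (line X da db (j + 1)) (by fun_prop) (X (j + 1)) (crossing X a b j))
      (hmin (j + 1) (line X da db (j + 1)) (by fun_prop) (crossing X a b j) (X (j + 2)))
    linarith
  rw [hlim]
  have T4 := (tendsto_finsetSum (Finset.range (k + 1)) fun j _ => T1 j).add
    (tendsto_finsetSum (Finset.range k) fun j hj =>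
      ((T3 j (Finset.mem_range.1 hj)).sub (T2 j (X j) (X (j + 1)))).sub
        (T2 (j + 1) (X (j + 1)) (X (j + 2))))
  refine T4.congr fun s => ?_
  simp only [chainEnergy, hlin]
  rw [add_sub_add_comm, ← Finset.sum_sub_distrib, ← Finset.sum_sub_distrib, add_div,
    Finset.sum_div, Finset.sum_div]
  congr 1
  apply Finset.sum_congr rfl
  intro j _
  ring

end

/-! ### Right end of a cell by reflection, and degenerate crossings -/

section lineForm
variable {q : ℝ → ℝ} {x x' c c' : ℝ}

theorem integral_comp_neg_mul (p φ : ℝ → ℝ) (a b : ℝ) :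
    ∫ t in (-b)..(-a), p (-t) * φ (-t) = ∫ t in a..b, p t * φ t := by
  rw [intervalIntegral.integral_comp_neg (fun t => p t * φ t)]; simp

theorem ordConnected_comp_neg (hd : OrdConnected {t | t ∈ Icc x x' ∧ 0 < q t}) :
    OrdConnected {t | t ∈ Icc (-x') (-x) ∧ 0 < q (-t)} := by
  constructor
  intro s hs t ht u hu
  have := hd.out (x := -t) (y := -s) ⟨⟨by linarith [ht.1.2], by linarith [ht.1.1]⟩, ht.2⟩
    ⟨⟨by linarith [hs.1.2], by linarith [hs.1.1]⟩, hs.2⟩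
    (show -u ∈ Icc (-t) (-s) from ⟨by linarith [hu.2], by linarith [hu.1]⟩)
  exact ⟨⟨by linarith [this.1.2], by linarith [this.1.1]⟩, this.2⟩

theorem integral_mul_sub_left (hq : Continuous q) (h0 : ∫ t in x..x', q t = 0) :
    ∫ t in x..x', q t * (t - x) = -∫ t in x..x', q t * (x' - t) := by
  have h1 : (∫ t in x..x', q t * (t - x)) + ∫ t in x..x', q t * (x' - t) =
      (x' - x) * ∫ t in x..x', q t := by
    rw [← intervalIntegral.integral_add
      ((by fun_prop : Continuous fun t => q t * (t - x)).intervalIntegrable _ _)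
      ((by fun_prop : Continuous fun t => q t * (x' - t)).intervalIntegrable _ _),
      ← intervalIntegral.integral_const_mul]
    congr 1; ext t; ring
  rw [h0] at h1
  linarith

theorem lineForm_right_nonneg (hq : Continuous q) {q₁ : ℝ → ℝ} (hq₁ : Continuous q₁) (hx : x < x')
    (hle : ∀ t ∈ Icc x x', q₁ t ≤ q t) (h0 : ∫ t in x..x', q₁ t = 0)
    (hγ : ∫ t in x..x', q₁ t * (x' - t) ≤ 0)
    (hc : x ≤ c') (hc' : c' ≤ x') : 0 ≤ lineForm q x x' c c' (fun t => t - x) := by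
  have h1 : 0 ≤ ∫ t in x..x', q₁ t * (t - x) := by rw [integral_mul_sub_left hq₁ h0]; linarith
  rw [← integral_comp_neg_mul q₁ (fun t => t - x)] at h1
  rw [← lineForm_comp_neg]
  have e : ∀ t : ℝ, -t - x = -x - t := fun t => by ring
  simp only [e] at h1 ⊢
  exact lineForm_left_nonneg (hq.comp continuous_neg) (hq₁.comp continuous_neg) (by linarith)
    (fun t ht => hle (-t) ⟨by linarith [ht.2], by linarith [ht.1]⟩) h1 (by linarith) (by linarith)

theorem lineForm_right_nonpos (hq : Continuous q) {q₂ : ℝ → ℝ} (hq₂ : Continuous q₂) (hx : x < x')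
    (hle : ∀ t ∈ Icc x x', q t ≤ q₂ t) (h0 : ∫ t in x..x', q₂ t = 0)
    (hγ : 0 ≤ ∫ t in x..x', q₂ t * (x' - t))
    (hd : OrdConnected {t | t ∈ Icc x x' ∧ 0 < q₂ t})
    (hc : c ≤ x') (hc' : x' ≤ c') : lineForm q x x' c c' (fun t => t - c) ≤ 0 := by
  have h1 : ∫ t in x..x', q₂ t * (t - x) ≤ 0 := by rw [integral_mul_sub_left hq₂ h0]; linarith
  have h0' : ∫ t in (-x')..(-x), q₂ (-t) = 0 := by
    rw [intervalIntegral.integral_comp_neg]; simpa using h0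
  rw [← integral_comp_neg_mul q₂ (fun t => t - x)] at h1
  rw [← lineForm_comp_neg]
  have e : ∀ t s : ℝ, -t - s = -s - t := fun t s => by ring
  simp only [e] at h1 ⊢
  have := lineForm_left_nonpos (c := -c') (c' := -c) (hq.comp continuous_neg)
    (hq₂.comp continuous_neg) (neg_lt_neg hx)
    (fun t ht => hle (-t) ⟨by linarith [ht.2], by linarith [ht.1]⟩) h0'
    (by simpa only [Function.comp_apply] using h1) (ordConnected_comp_neg hd) (by linarith) (by linarith)
  exact this

/-- Degenerate case of `lineForm_left_nonpos`. -/
theorem lineForm_left_nonpos_of_eq (hq : Continuous q) (hx : x < x') (hc : c ≤ x)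
    (h : lineForm q x x' c x (fun t => t - x) ≤ 0) :
    lineForm q x x' c x (fun t => x' - t) ≤ 0 := by
  rw [lineForm] at h ⊢
  have h2 : 0 ≤ ∫ t in c..x, min (q t) 0 * (t - x) :=
    integral_nonneg_of_min_mul (φ := fun t => t - x) hc fun t ht => by linarith [ht.2]
  have h3 : ∫ t in c..x, min (q t) 0 * (x' - t) ≤ 0 :=
    integral_nonpos_of_min_mul (φ := fun t => x' - t) hc fun t ht => by linarith [ht.2]
  -- Both terms of `h` are nonnegative, the right crossing being at `x`; so the positive part of the
  -- force vanishes throughout the cell.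
  have hz : ∀ t ∈ Ioo x x', max (q t) 0 = 0 := by
    intro t ht
    by_contra hne
    have hpos : 0 < max (q t) 0 := lt_of_le_of_ne (le_max_right _ _) (Ne.symm hne)
    have hcont : ContinuousOn (fun t => max (q t) 0 * (t - x)) (Icc x x') := by fun_prop
    have := intervalIntegral.integral_pos hx hcont
      (fun t ht => mul_nonneg (le_max_right _ _) (by linarith [ht.1]))
      ⟨t, ⟨ht.1.le, ht.2.le⟩, mul_pos hpos (by linarith [ht.1])⟩
    linarith
  have h4 : ∫ t in x..x', max (q t) 0 * (x' - t) = 0 := by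
    rw [intervalIntegral.integral_congr_Ioo_of_le (g := fun _ => 0) hx.le
      (fun t ht => by simp [hz t ht])]
    simp
  linarith

theorem lineForm_right_nonpos_of_eq (hq : Continuous q) (hx : x < x') (hc : x' ≤ c')
    (h : lineForm q x x' x' c' (fun t => x' - t) ≤ 0) :
    lineForm q x x' x' c' (fun t => t - x) ≤ 0 := by
  rw [← lineForm_comp_neg] at h ⊢
  have e : ∀ t : ℝ, -t - x = -x - t := fun t => by ring
  have e' : ∀ t : ℝ, x' - -t = t - -x' := fun t => by ring
  simp only [e, e'] at h ⊢
  exact lineForm_left_nonpos_of_eq (hq.comp continuous_neg) (neg_lt_neg hx) (by linarith) h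

theorem nonpos_Icc_of_nonpos_Ico (hq : Continuous q) {a b : ℝ} (hab : a < b)
    (h : ∀ t ∈ Ico a b, q t ≤ 0) : ∀ t ∈ Icc a b, q t ≤ 0 := by
  intro t ht
  rw [← closure_Ico hab.ne] at ht
  exact closure_minimal (t := {t | q t ≤ 0}) h (isClosed_le hq continuous_const) ht

theorem nonpos_left_of_lineForm_eq_zero (hq : Continuous q) (hx : x < x')
    (hd : OrdConnected {t | t ∈ Icc x x' ∧ 0 < q t})
    (h0 : ∀ s, lineForm q x x' c c' (fun t => s - t) = 0) (hcx : c ≤ x') (hxc : x < c) :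
    ∀ t ∈ Icc x c, q t ≤ 0 :=
  nonpos_Icc_of_nonpos_Ico hq hxc (nonpos_of_lineForm_eq_zero hq hx hd h0 hcx)

theorem nonpos_right_of_lineForm_eq_zero (hq : Continuous q) (hx : x < x')
    (hd : OrdConnected {t | t ∈ Icc x x' ∧ 0 < q t})
    (h0 : ∀ s, lineForm q x x' c c' (fun t => t - s) = 0) (hcx : x ≤ c') (hxc : c' < x') :
    ∀ t ∈ Icc c' x', q t ≤ 0 := by
  intro t ht
  have := nonpos_left_of_lineForm_eq_zero (q := fun t => q (-t)) (x := -x') (x' := -x) (c := -c')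
    (c' := -c) (hq.comp continuous_neg) (neg_lt_neg hx) (ordConnected_comp_neg hd) (fun s => by
      have := h0 (-s)
      rw [← lineForm_comp_neg] at this
      rw [← this]; congr 1; ext t; ring) (by linarith) (by linarith) (-t)
    ⟨by linarith [ht.2], by linarith [ht.1]⟩
  simpa using this

end lineForm

/-! ### Derivatives in the end values and first order conditions -/

section
variable {k : ℕ} {q : ℝ → ℝ → ℝ} {X lo up a b : ℕ → ℝ}

theorem IsTrap.steep_le_lineSteep (H : IsTrap k q X lo up) (hab : InBox lo up a b) {j : ℕ}
    (hj : j ≤ k) : steep (X j) (X (j + 1)) (lo j) (up (j + 1)) ≤ lineSteep X a b j := by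
  have := sub_pos.2 (H.lt j hj)
  exact div_le_div_of_nonneg_right (by linarith [(hab j).1.1, (hab j).2.2]) this.le

theorem IsTrap.lineSteep_le_steep (H : IsTrap k q X lo up) (hab : InBox lo up a b) {j : ℕ}
    (hj : j ≤ k) : lineSteep X a b j ≤ steep (X j) (X (j + 1)) (up j) (lo (j + 1)) := by
  have := sub_pos.2 (H.lt j hj)
  exact div_le_div_of_nonneg_right (by linarith [(hab j).1.2, (hab j).2.1]) this.le

/-- Derivative of the energy with respect to the left end value of line `j`. -/
def derivLeft (k : ℕ) (q : ℝ → ℝ → ℝ) (X a b : ℕ → ℝ) (j : ℕ) : ℝ :=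
  chainForm k q X a b j (fun t => X (j + 1) - t) / (X (j + 1) - X j)

/-- Derivative of the energy with respect to the right end value of line `j`. -/
def derivRight (k : ℕ) (q : ℝ → ℝ → ℝ) (X a b : ℕ → ℝ) (j : ℕ) : ℝ :=
  chainForm k q X a b j (fun t => t - X j) / (X (j + 1) - X j)

theorem IsTrap.continuous_line (H : IsTrap k q X lo up) (a b : ℕ → ℝ) (j : ℕ) :
    Continuous fun t => q t (line X a b j t) :=
  H.cont.comp (continuous_id.prodMk (SphericalSpinGlass.continuous_line X a b j))

theorem IsTrap.continuous_seg (H : IsTrap k q X lo up) (x x' a b : ℝ) :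
    Continuous fun t => q t (seg x x' a b t) :=
  H.cont.comp (continuous_id.prodMk (SphericalSpinGlass.continuous_seg a b))

theorem IsTrap.chainForm_eq (H : IsTrap k q X lo up) (a b : ℕ → ℝ) {j : ℕ} (hj : j ≤ k)
    (φ : ℝ → ℝ) (α β : ℝ)
    (hφ : ∀ t, φ t = α * (X (j + 1) - t) + β * (t - X j)) :
    chainForm k q X a b j φ = (X (j + 1) - X j) *
      (α * derivLeft k q X a b j + β * derivRight k q X a b j) := by
  have h := (sub_pos.2 (H.lt j hj)).ne'
  obtain rfl : φ = fun t => α * (X (j + 1) - t) + β * (t - X j) := funext hφ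
  rw [chainForm, lineForm_linear (H.continuous_line a b j) (by fun_prop) (by fun_prop), derivLeft,
    derivRight, chainForm, chainForm]
  field_simp

/-- First order conditions at a minimizer. -/
theorem IsTrap.first_order (H : IsTrap k q X lo up) (hab : InBox lo up a b)
    (hmin : ∀ a' b', InBox lo up a' b' → chainEnergy k q X a b ≤ chainEnergy k q X a' b')
    {da db : ℕ → ℝ} (hsupp : ∀ j, k < j → da j = 0 ∧ db j = 0)
    (hfa : ∀ j, (0 < da j → a j < up j) ∧ (da j < 0 → lo j < a j))
    (hfb : ∀ j, (0 < db j → b j < up (j + 1)) ∧ (db j < 0 → lo (j + 1) < b j))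
    (hreg : ∀ i < k, lineSteep X a b i = lineSteep X a b (i + 1) → da (i + 1) = db i ∧ 0 ≤ db i) :
    0 ≤ ∑ j ∈ Finset.range (k + 1),
      (da j * derivLeft k q X a b j + db j * derivRight k q X a b j) := by
  have hr : ∀ j < k, Regular X a b da db j := by
    intro j hj
    rcases H.lt_or_coincide hab hj with h | ⟨h, h1, h2, h3, h4⟩
    · exact Or.inl h
    · obtain ⟨e, h0⟩ := hreg j hj h
      refine Or.inr ⟨h, h1.trans h2.symm, e, ?_⟩
      -- At a coincidence the far end values `a j` and `b (j + 1)` are at their upper bounds and can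
      -- only move down. With `0 ≤ db j` this orders the perturbing slopes, as `Regular` demands.
      have f1 : da j ≤ 0 := by
        by_contra hlt
        exact absurd h3 ((hfa j).1 (not_le.1 hlt)).ne
      have f2 : db (j + 1) ≤ 0 := by
        by_contra hlt
        exact absurd h4 ((hfb (j + 1)).1 (not_le.1 hlt)).ne
      have l1 := sub_pos.2 (H.lt j hj.le)
      have l2 := sub_pos.2 (H.lt (j + 1) hj)
      exact (div_nonpos_of_nonpos_of_nonneg (by linarith) l1.le).trans
        (div_nonneg (by linarith) l2.le)
  have hT := H.tendsto_energy hab hr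
  have hin : ∀ (l u y d : ℝ), y ∈ Icc l u → (0 < d → y < u) → (d < 0 → l < y) →
      ∀ᶠ s in 𝓝[>] (0 : ℝ), y + s * d ∈ Icc l u := by
    intro l u y d hy h1 h2
    have ht : Tendsto (fun s : ℝ => y + s * d) (𝓝[>] 0) (𝓝 y) := by
      have := ((by fun_prop : Continuous fun s : ℝ => y + s * d).tendsto 0).mono_left
          (nhdsWithin_le_nhds (s := Ioi 0))
      simpa using this
    rcases lt_trichotomy d 0 with hd | hd | hd
    · filter_upwards [ht.eventually_const_lt (h2 hd), self_mem_nhdsWithin] with s hs hs0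
      have : 0 < s := hs0
      exact ⟨hs.le, by nlinarith [hy.2]⟩
    · subst hd; exact Eventually.of_forall fun s => by simpa using hy
    · filter_upwards [ht.eventually_lt_const (h1 hd), self_mem_nhdsWithin] with s hs hs0
      have : 0 < s := hs0
      exact ⟨by nlinarith [hy.1], hs.le⟩
  have hbox : ∀ᶠ s in 𝓝[>] (0 : ℝ), InBox lo up (fun j => a j + s * da j)
      (fun j => b j + s * db j) := by
    have h1 : ∀ᶠ s in 𝓝[>] (0 : ℝ), ∀ j ∈ Finset.range (k + 1),
        a j + s * da j ∈ Icc (lo j) (up j) ∧ b j + s * db j ∈ Icc (lo (j + 1)) (up (j + 1)) :=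
      (Filter.eventually_all_finset _).2 fun j _ =>
        (hin _ _ _ _ (hab j).1 (hfa j).1 (hfa j).2).and (hin _ _ _ _ (hab j).2 (hfb j).1 (hfb j).2)
    filter_upwards [h1] with s hs j
    rcases Nat.lt_or_ge k j with hj | hj
    · simpa [(hsupp j hj).1, (hsupp j hj).2] using hab j
    · exact hs j (Finset.mem_range.2 (Nat.lt_succ_of_le hj))
  have h0 : 0 ≤ ∑ j ∈ Finset.range (k + 1), chainForm k q X a b j (line X da db j) := by
    refine ge_of_tendsto hT ?_
    filter_upwards [hbox, self_mem_nhdsWithin] with s hs hs0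
    exact div_nonneg (sub_nonneg.2 (hmin _ _ hs)) (le_of_lt hs0)
  refine h0.trans_eq (Finset.sum_congr rfl fun j hj => ?_)
  have hj' : j ≤ k := Nat.lt_succ_iff.1 (Finset.mem_range.1 hj)
  have hL := (sub_pos.2 (H.lt j hj')).ne'
  rw [H.chainForm_eq a b hj' (line X da db j) (da j / (X (j + 1) - X j))
    (db j / (X (j + 1) - X j))]
  · field_simp
  · intro t; unfold line seg; field_simp

end

/-! ### At a minimizer all derivatives vanish -/

section
variable {k : ℕ} {q : ℝ → ℝ → ℝ} {X lo up a b : ℕ → ℝ}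

theorem breakpt_succ (hj : j < k) : breakpt k X a b (j + 1) = crossing X a b j := by
  simp [breakpt, hj]

theorem breakpt_last : breakpt k X a b (k + 1) = X (k + 1) := by simp [breakpt]

/-- `(a, b)` minimizes the energy over the box. -/
def IsBoxMin (k : ℕ) (q : ℝ → ℝ → ℝ) (X lo up a b : ℕ → ℝ) : Prop :=
  InBox lo up a b ∧ ∀ a' b', InBox lo up a' b' → chainEnergy k q X a b ≤ chainEnergy k q X a' b'

theorem sum_single_mul {j : ℕ} (hj : j ≤ k) (r : ℝ) (A : ℕ → ℝ) :
    ∑ i ∈ Finset.range (k + 1), (Pi.single j r : ℕ → ℝ) i * A i = r * A j := by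
  rw [Finset.sum_eq_single j (fun i _ hi => by simp [hi])
    (fun h => absurd (Finset.mem_range.2 (Nat.lt_succ_of_le hj)) h)]
  simp

theorem IsTrap.single_left (H : IsTrap k q X lo up) (hm : IsBoxMin k q X lo up a b) {j : ℕ}
    (hj : j ≤ k) (r : ℝ) (h1 : 0 < r → a j < up j) (h2 : r < 0 → lo j < a j)
    (hreg : ∀ i < k, lineSteep X a b i = lineSteep X a b (i + 1) → i + 1 ≠ j) :
    0 ≤ r * derivLeft k q X a b j := by
  have := H.first_order hm.1 hm.2 (da := Pi.single j r) (db := 0)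
    (fun i hi => by simp [(hj.trans_lt hi).ne'])
    (fun i => by
      rcases eq_or_ne i j with rfl | hi
      · simpa using ⟨h1, h2⟩
      · simp [hi])
    (fun i => by simp) (fun i hi hs => by simp [hreg i hi hs])
  rw [Finset.sum_add_distrib, sum_single_mul hj] at this
  simpa using this

theorem IsTrap.single_right (H : IsTrap k q X lo up) (hm : IsBoxMin k q X lo up a b) {j : ℕ}
    (hj : j ≤ k) (r : ℝ) (h1 : 0 < r → b j < up (j + 1)) (h2 : r < 0 → lo (j + 1) < b j)
    (hreg : j < k → lineSteep X a b j ≠ lineSteep X a b (j + 1)) :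
    0 ≤ r * derivRight k q X a b j := by
  have := H.first_order hm.1 hm.2 (da := 0) (db := Pi.single j r)
    (fun i hi => by simp [(hj.trans_lt hi).ne'])
    (fun i => by simp)
    (fun i => by
      rcases eq_or_ne i j with rfl | hi
      · simpa using ⟨h1, h2⟩
      · simp [hi])
    (fun i hi hs => by
      rcases eq_or_ne i j with rfl | hij
      · exact absurd hs (hreg hi)
      · simp [hij])
  rw [Finset.sum_add_distrib, sum_single_mul hj] at this
  simpa using this

/-- For coincident lines, moving only one of the two values at the common node is not a regular
direction. Raising both together is, since the lines keep meeting there. -/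
theorem IsTrap.joint (H : IsTrap k q X lo up) (hm : IsBoxMin k q X lo up a b) {j : ℕ}
    (hj : j < k) (h1 : a (j + 1) < up (j + 1)) (h2 : b j < up (j + 1)) :
    0 ≤ derivLeft k q X a b (j + 1) + derivRight k q X a b j := by
  have := H.first_order hm.1 hm.2 (da := Pi.single (j + 1) 1) (db := Pi.single j 1)
    (fun i hi => by
      have e1 : i ≠ j := by omega
      have e2 : i ≠ j + 1 := by omega
      simp [e1, e2])
    (fun i => by
      rcases eq_or_ne i (j + 1) with rfl | hi
      · simp [h1]
      · simp [hi])
    (fun i => by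
      rcases eq_or_ne i j with rfl | hi
      · simp [h2]
      · simp [hi])
    (fun i hi hs => by
      rcases eq_or_ne i j with rfl | hij
      · simp
      · simp [hij])
  rw [Finset.sum_add_distrib, sum_single_mul hj, sum_single_mul hj.le] at this
  simpa using this

theorem IsTrap.breakpt_mem_left (H : IsTrap k q X lo up) (hab : InBox lo up a b) {j : ℕ}
    (hj : j ≤ k) : breakpt k X a b j ≤ X (j + 1) ∧ X j ≤ breakpt k X a b (j + 1) := by
  constructor
  · cases j with
    | zero => exact (H.lt 0 hj).le
    | succ i => rw [breakpt_succ hj]; exact (H.crossing_mem hab hj).2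
  · rcases hj.lt_or_eq with h | rfl
    · rw [breakpt_succ h]; exact (H.crossing_mem hab h).1
    · rw [breakpt_last]; exact (H.lt j le_rfl).le

theorem IsTrap.le_breakpt (H : IsTrap k q X lo up) (hab : InBox lo up a b) {j : ℕ}
    (hj : j ≤ k) (h : a j = up j) : X j ≤ breakpt k X a b j := by
  cases j with
  | zero => exact le_rfl
  | succ i => rw [breakpt_succ hj]; exact H.le_crossing hab hj (h ▸ (hab i).2.2)

theorem IsTrap.breakpt_le (H : IsTrap k q X lo up) (hab : InBox lo up a b) {j : ℕ}
    (hj : j ≤ k) (h : a j = lo j) : breakpt k X a b j ≤ X j := by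
  cases j with
  | zero => exact le_rfl
  | succ i => rw [breakpt_succ hj]; exact H.crossing_le hab hj (h ▸ (hab i).2.1)

theorem IsTrap.breakpt_succ_le (H : IsTrap k q X lo up) (hab : InBox lo up a b) {j : ℕ}
    (hj : j ≤ k) (h : b j = up (j + 1)) : breakpt k X a b (j + 1) ≤ X (j + 1) := by
  rcases hj.lt_or_eq with hj | rfl
  · rw [breakpt_succ hj]; exact H.crossing_le hab hj (h ▸ (hab (j + 1)).1.2)
  · rw [breakpt_last]

theorem IsTrap.le_breakpt_succ (H : IsTrap k q X lo up) (hab : InBox lo up a b) {j : ℕ}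
    (hj : j ≤ k) (h : b j = lo (j + 1)) : X (j + 1) ≤ breakpt k X a b (j + 1) := by
  rcases hj.lt_or_eq with hj | rfl
  · rw [breakpt_succ hj]; exact H.le_crossing hab hj (h ▸ (hab (j + 1)).1.1)
  · rw [breakpt_last]

/-- At the upper face the line is above the reference line from `up j` to `lo (j + 1)`, so its force
is at least the reference force, whose moment is nonnegative by `mom₂`; the left crossing lies to
the right of the node. -/
theorem IsTrap.derivLeft_of_up (H : IsTrap k q X lo up) (hab : InBox lo up a b) {j : ℕ}
    (hj : j ≤ k) (h : a j = up j) : 0 ≤ derivLeft k q X a b j := by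
  refine div_nonneg ?_ (sub_nonneg.2 (H.lt j hj).le)
  exact lineForm_left_nonneg (H.continuous_line a b j) (H.continuous_seg _ _ _ _) (H.lt j hj)
    (fun t ht => H.mono t (seg_mono (H.lt j hj) h.ge (hab j).2.1 ht)) (H.mom₂ j hj)
    (H.le_breakpt hab hj h) (H.breakpt_mem_left hab hj).1

theorem IsTrap.derivRight_of_up (H : IsTrap k q X lo up) (hab : InBox lo up a b) {j : ℕ}
    (hj : j ≤ k) (h : b j = up (j + 1)) : 0 ≤ derivRight k q X a b j := by
  refine div_nonneg ?_ (sub_nonneg.2 (H.lt j hj).le)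
  exact lineForm_right_nonneg (H.continuous_line a b j) (H.continuous_seg _ _ _ _) (H.lt j hj)
    (fun t ht => H.mono t (seg_mono (H.lt j hj) (hab j).1.1 h.ge ht)) (H.bal₁ j hj) (H.mom₁ j hj)
    (H.breakpt_mem_left hab hj).2 (H.breakpt_succ_le hab hj h)

/-- At the lower face the line is below the reference line from `lo j` to `up (j + 1)`. The
direction that vanishes at the right crossing is the one whose sign can be decided wherever that
crossing lies; it mixes the two end derivatives. -/
theorem IsTrap.derivLeft_of_lo (H : IsTrap k q X lo up) (hab : InBox lo up a b) {j : ℕ}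
    (hj : j ≤ k) (h : a j = lo j) :
    (breakpt k X a b (j + 1) - X j) * derivLeft k q X a b j +
      (breakpt k X a b (j + 1) - X (j + 1)) * derivRight k q X a b j ≤ 0 := by
  have hL := sub_pos.2 (H.lt j hj)
  have := lineForm_left_nonpos (H.continuous_line a b j) (H.continuous_seg (X j) (X (j + 1)) (lo j)
    (up (j + 1))) (H.lt j hj)
    (fun t ht => H.mono t (seg_mono (H.lt j hj) h.le (hab j).2.2 ht)) (H.bal₁ j hj) (H.mom₁ j hj)
    (H.dip j hj _ ⟨le_rfl, H.le j⟩ _ ⟨H.le _, le_rfl⟩) (H.breakpt_le hab hj h)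
    (H.breakpt_mem_left hab hj).2
  have e := H.chainForm_eq a b hj (fun t => breakpt k X a b (j + 1) - t)
    ((breakpt k X a b (j + 1) - X j) / (X (j + 1) - X j))
    ((breakpt k X a b (j + 1) - X (j + 1)) / (X (j + 1) - X j)) (fun t => by field_simp; ring)
  rw [chainForm] at e
  rw [e] at this
  have e2 : (X (j + 1) - X j) * ((breakpt k X a b (j + 1) - X j) / (X (j + 1) - X j) *
      derivLeft k q X a b j + (breakpt k X a b (j + 1) - X (j + 1)) / (X (j + 1) - X j) *
      derivRight k q X a b j) = (breakpt k X a b (j + 1) - X j) * derivLeft k q X a b j +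
      (breakpt k X a b (j + 1) - X (j + 1)) * derivRight k q X a b j := by
    field_simp
  rwa [e2] at this

theorem IsTrap.derivRight_of_lo (H : IsTrap k q X lo up) (hab : InBox lo up a b) {j : ℕ}
    (hj : j ≤ k) (h : b j = lo (j + 1)) :
    (X j - breakpt k X a b j) * derivLeft k q X a b j +
      (X (j + 1) - breakpt k X a b j) * derivRight k q X a b j ≤ 0 := by
  have hL := sub_pos.2 (H.lt j hj)
  have := lineForm_right_nonpos (H.continuous_line a b j) (H.continuous_seg (X j) (X (j + 1)) (up j)
    (lo (j + 1))) (H.lt j hj)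
    (fun t ht => H.mono t (seg_mono (H.lt j hj) (hab j).1.2 h.le ht)) (H.bal₂ j hj) (H.mom₂ j hj)
    (H.dip j hj _ ⟨H.le j, le_rfl⟩ _ ⟨le_rfl, H.le _⟩)
    (H.breakpt_mem_left hab hj).1 (H.le_breakpt_succ hab hj h)
  have e := H.chainForm_eq a b hj (fun t => t - breakpt k X a b j)
    ((X j - breakpt k X a b j) / (X (j + 1) - X j))
    ((X (j + 1) - breakpt k X a b j) / (X (j + 1) - X j)) (fun t => by field_simp; ring)
  rw [chainForm] at e
  rw [e] at this
  have e2 : (X (j + 1) - X j) * ((X j - breakpt k X a b j) / (X (j + 1) - X j) *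
      derivLeft k q X a b j + (X (j + 1) - breakpt k X a b j) / (X (j + 1) - X j) *
      derivRight k q X a b j) = (X j - breakpt k X a b j) * derivLeft k q X a b j +
      (X (j + 1) - breakpt k X a b j) * derivRight k q X a b j := by
    field_simp
  rwa [e2] at this

theorem breakpt_of_coincide {j : ℕ} (hj : j < k)
    (h : lineSteep X a b j = lineSteep X a b (j + 1)) : breakpt k X a b (j + 1) = X (j + 1) := by
  rw [breakpt_succ hj, crossing, h]; simp

/-- Either the value can be raised, or it is at the upper face, where the trap decides; the only
obstruction to raising it alone is a coincidence with the left neighbour. -/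
theorem IsTrap.derivLeft_nonneg (H : IsTrap k q X lo up) (hm : IsBoxMin k q X lo up a b) {j : ℕ}
    (hj : j ≤ k) (hreg : ∀ i < k, lineSteep X a b i = lineSteep X a b (i + 1) → i + 1 ≠ j) :
    0 ≤ derivLeft k q X a b j := by
  rcases (hm.1 j).1.2.lt_or_eq with h | h
  · simpa using H.single_left hm hj 1 (fun _ => h) (fun h => by norm_num at h) hreg
  · exact H.derivLeft_of_up hm.1 hj h

theorem IsTrap.derivRight_nonneg (H : IsTrap k q X lo up) (hm : IsBoxMin k q X lo up a b) {j : ℕ}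
    (hj : j ≤ k) (hreg : j < k → lineSteep X a b j ≠ lineSteep X a b (j + 1)) :
    0 ≤ derivRight k q X a b j := by
  rcases (hm.1 j).2.2.lt_or_eq with h | h
  · simpa using H.single_right hm hj 1 (fun _ => h) (fun h => by norm_num at h) hreg
  · exact H.derivRight_of_up hm.1 hj h

theorem IsTrap.derivLeft_nonpos_of_lt (H : IsTrap k q X lo up) (hm : IsBoxMin k q X lo up a b)
    {j : ℕ} (hj : j ≤ k) (h : lo j < a j) : derivLeft k q X a b j ≤ 0 := by
  have := H.single_left hm hj (-1) (fun h => by norm_num at h) (fun _ => h) (by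
    rintro i hi hs rfl
    rcases H.lt_or_coincide hm.1 hi with h' | ⟨-, h', -⟩
    · exact h'.ne hs
    · exact h.ne' h')
  linarith

theorem IsTrap.derivRight_nonpos_of_lt (H : IsTrap k q X lo up) (hm : IsBoxMin k q X lo up a b)
    {j : ℕ} (hj : j ≤ k) (h : lo (j + 1) < b j) : derivRight k q X a b j ≤ 0 := by
  have := H.single_right hm hj (-1) (fun h => by norm_num at h) (fun _ => h) (by
    rintro hi hs
    rcases H.lt_or_coincide hm.1 hi with h' | ⟨-, -, h', -⟩
    · exact h'.ne hs
    · exact h.ne' h')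
  linarith

theorem IsTrap.derivLeft_nonpos (H : IsTrap k q X lo up) (hm : IsBoxMin k q X lo up a b)
    {j : ℕ} (hj : j ≤ k) : derivLeft k q X a b j ≤ 0 := by
  have hL := H.lt j hj
  rcases (hm.1 j).1.1.lt_or_eq with h | h
  · exact H.derivLeft_nonpos_of_lt hm hj h
  have hlo := H.derivLeft_of_lo hm.1 hj h.symm
  -- With the right crossing at the node, the mixed inequality is the claim. Otherwise line `j` does
  -- not coincide with the next one, so the right derivative is nonnegative. It is zero if `b j` can
  -- be lowered, and if `b j` is minimal it enters with a nonnegative factor.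
  rcases eq_or_ne (breakpt k X a b (j + 1)) (X (j + 1)) with hc | hc
  · rw [hc] at hlo
    nlinarith
  have hB : 0 ≤ derivRight k q X a b j := H.derivRight_nonneg hm hj fun hjk hs =>
    hc (breakpt_of_coincide hjk hs)
  have hcm := (H.breakpt_mem_left hm.1 hj).2
  rcases (hm.1 j).2.1.lt_or_eq with hb | hb
  · have hB0 : derivRight k q X a b j = 0 := le_antisymm (H.derivRight_nonpos_of_lt hm hj hb) hB
    rcases hcm.lt_or_eq with hcl | hcl
    · rw [hB0] at hlo
      nlinarith
    · refine div_nonpos_of_nonpos_of_nonneg ?_ (sub_nonneg.2 hL.le)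
      rw [chainForm, ← hcl]
      refine lineForm_left_nonpos_of_eq (H.continuous_line a b j) hL
        (H.breakpt_le hm.1 hj h.symm) ?_
      have := hB0
      rw [derivRight, chainForm, ← hcl, div_eq_zero_iff] at this
      exact (this.resolve_right (sub_pos.2 hL).ne').le
  · have := H.le_breakpt_succ hm.1 hj hb.symm
    nlinarith [mul_nonneg (sub_nonneg.2 this) hB]

theorem IsTrap.derivRight_nonpos (H : IsTrap k q X lo up) (hm : IsBoxMin k q X lo up a b)
    {j : ℕ} (hj : j ≤ k) : derivRight k q X a b j ≤ 0 := by
  have hL := H.lt j hj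
  rcases (hm.1 j).2.1.lt_or_eq with h | h
  · exact H.derivRight_nonpos_of_lt hm hj h
  have hlo := H.derivRight_of_lo hm.1 hj h.symm
  rcases eq_or_ne (breakpt k X a b j) (X j) with hc | hc
  · rw [hc] at hlo
    nlinarith
  have hA : 0 ≤ derivLeft k q X a b j := H.derivLeft_nonneg hm hj (by
    rintro i hi hs rfl
    exact hc (breakpt_of_coincide hi hs))
  have hcm := (H.breakpt_mem_left hm.1 hj).1
  rcases (hm.1 j).1.1.lt_or_eq with hb | hb
  · have hA0 : derivLeft k q X a b j = 0 := le_antisymm (H.derivLeft_nonpos_of_lt hm hj hb) hA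
    rcases hcm.lt_or_eq with hcl | hcl
    · rw [hA0] at hlo
      nlinarith
    · refine div_nonpos_of_nonpos_of_nonneg ?_ (sub_nonneg.2 hL.le)
      rw [chainForm, hcl]
      refine lineForm_right_nonpos_of_eq (H.continuous_line a b j) hL
        (H.le_breakpt_succ hm.1 hj h.symm) ?_
      have := hA0
      rw [derivLeft, chainForm, hcl, div_eq_zero_iff] at this
      exact (this.resolve_right (sub_pos.2 hL).ne').le
  · have := H.breakpt_le hm.1 hj hb.symm
    nlinarith [mul_nonneg (sub_nonneg.2 this) hA]

theorem IsTrap.deriv_add_nonneg (H : IsTrap k q X lo up) (hm : IsBoxMin k q X lo up a b)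
    {i : ℕ} (hi : i < k) (hs : lineSteep X a b i = lineSteep X a b (i + 1)) :
    0 ≤ derivLeft k q X a b (i + 1) + derivRight k q X a b i := by
  obtain ⟨-, h1, h2, -, -⟩ := (H.lt_or_coincide hm.1 hi).resolve_left fun h => h.ne hs
  rcases (H.le (i + 1)).lt_or_eq with h | h
  · exact H.joint hm hi (h1 ▸ h) (h2 ▸ h)
  · exact add_nonneg (H.derivLeft_of_up hm.1 hi (h1.trans h))
      (H.derivRight_of_up hm.1 hi.le (h2.trans h))

/-- At a coincidence only the sum of the two derivatives at the common node is known to be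
nonnegative, but neither summand is positive, so both vanish. -/
theorem IsTrap.derivLeft_eq_zero (H : IsTrap k q X lo up) (hm : IsBoxMin k q X lo up a b)
    {j : ℕ} (hj : j ≤ k) : derivLeft k q X a b j = 0 := by
  refine le_antisymm (H.derivLeft_nonpos hm hj) ?_
  by_cases hreg : ∃ i < k, lineSteep X a b i = lineSteep X a b (i + 1) ∧ i + 1 = j
  · obtain ⟨i, hi, hs, rfl⟩ := hreg
    linarith [H.deriv_add_nonneg hm hi hs, H.derivRight_nonpos hm hi.le]
  · push Not at hreg
    exact H.derivLeft_nonneg hm hj hreg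

theorem IsTrap.derivRight_eq_zero (H : IsTrap k q X lo up) (hm : IsBoxMin k q X lo up a b)
    {j : ℕ} (hj : j ≤ k) : derivRight k q X a b j = 0 := by
  refine le_antisymm (H.derivRight_nonpos hm hj) ?_
  by_cases hreg : j < k ∧ lineSteep X a b j = lineSteep X a b (j + 1)
  · linarith [H.deriv_add_nonneg hm hreg.1 hreg.2, H.derivLeft_nonpos hm hreg.1]
  · push Not at hreg
    exact H.derivRight_nonneg hm hj hreg

theorem IsTrap.chainForm_affine (H : IsTrap k q X lo up) (hm : IsBoxMin k q X lo up a b)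
    {j : ℕ} (hj : j ≤ k) (r s : ℝ) : chainForm k q X a b j (fun t => r + s * t) = 0 := by
  have hL := (sub_pos.2 (H.lt j hj)).ne'
  rw [H.chainForm_eq a b hj _ ((r + s * X j) / (X (j + 1) - X j))
    ((r + s * X (j + 1)) / (X (j + 1) - X j)) (fun t => by field_simp; ring),
    H.derivLeft_eq_zero hm hj, H.derivRight_eq_zero hm hj]
  ring

theorem IsTrap.nonpos_left (H : IsTrap k q X lo up) (hm : IsBoxMin k q X lo up a b)
    {j : ℕ} (hj : j ≤ k) (hlt : X j < breakpt k X a b j) :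
    ∀ t ∈ Icc (X j) (breakpt k X a b j), q t (line X a b j t) ≤ 0 :=
  nonpos_left_of_lineForm_eq_zero (H.continuous_line a b j) (H.lt j hj)
    (H.dip j hj _ (hm.1 j).1 _ (hm.1 j).2) (fun s => by
      simpa [sub_eq_add_neg, chainForm] using H.chainForm_affine hm hj s (-1))
    (H.breakpt_mem_left hm.1 hj).1 hlt

theorem IsTrap.nonpos_right (H : IsTrap k q X lo up) (hm : IsBoxMin k q X lo up a b)
    {j : ℕ} (hj : j ≤ k) (hlt : breakpt k X a b (j + 1) < X (j + 1)) :
    ∀ t ∈ Icc (breakpt k X a b (j + 1)) (X (j + 1)), q t (line X a b j t) ≤ 0 :=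
  nonpos_right_of_lineForm_eq_zero (H.continuous_line a b j) (H.lt j hj)
    (H.dip j hj _ (hm.1 j).1 _ (hm.1 j).2) (fun s => by
      have := H.chainForm_affine hm hj (-s) 1
      rw [← this, chainForm]; congr 1; ext t; ring)
    (H.breakpt_mem_left hm.1 hj).2 hlt

/-- If the ends of a piece were in the wrong order, the force would be nonpositive along the line on
the entire cell. But by concavity the line is above both reference lines at its left break point,
which by `pos` makes the force positive somewhere. -/
theorem IsTrap.breakpt_lt (H : IsTrap k q X lo up) (hm : IsBoxMin k q X lo up a b)
    {j : ℕ} (hj : j ≤ k) : breakpt k X a b j < breakpt k X a b (j + 1) := by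
  by_contra hle
  rw [not_lt] at hle
  have hL := H.lt j hj
  obtain ⟨m1, m2⟩ := H.breakpt_mem_left hm.1 hj
  have hneg : ∀ t ∈ Icc (X j) (X (j + 1)), q t (line X a b j t) ≤ 0 := by
    have hA : X j < breakpt k X a b j ∨ breakpt k X a b (j + 1) < X (j + 1) := by
      by_contra hcon
      push Not at hcon
      linarith
    intro t ht
    rcases lt_or_ge (X j) (breakpt k X a b j) with h1 | h1
    · rcases le_or_gt t (breakpt k X a b j) with h2 | h2
      · exact H.nonpos_left hm hj h1 t ⟨ht.1, h2⟩
      · exact H.nonpos_right hm hj (by linarith [ht.2]) t ⟨by linarith, ht.2⟩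
    · have h3 := hA.resolve_left (not_lt.2 h1)
      exact H.nonpos_right hm hj h3 t ⟨by linarith [ht.1], ht.2⟩
  set t₀ := breakpt k X a b j with ht₀
  -- At `t₀ ≥ X j` the line agrees with its left neighbour, which passes the node at height at least
  -- `lo j` and, by `conc`, descends no faster than the reference line.
  have h₁ : seg (X j) (X (j + 1)) (lo j) (up (j + 1)) t₀ ≤ line X a b j t₀ := by
    have hge : X j ≤ t₀ := m2.trans hle
    rcases j.eq_zero_or_pos with rfl | hpos
    · have : t₀ = X 0 := rfl
      rw [this, seg_left hL, line, seg_left hL]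
      exact (hm.1 0).1.1
    · obtain ⟨i, rfl⟩ := Nat.exists_eq_add_of_le' hpos
      have hi : i < k := hj
      have hcr : t₀ = crossing X a b i := breakpt_succ hi
      have heq := H.line_le_line_iff hm.1 hi t₀
      rw [hcr, sub_self, mul_zero, ← hcr] at heq
      rw [← sub_eq_zero.1 heq, line_eq_right (H.lt i hi.le), seg_eq_left hL]
      have s1 := H.lineSteep_le_steep hm.1 hi.le
      have s2 := H.conc i hi
      have := mul_le_mul_of_nonneg_right (s1.trans s2) (sub_nonneg.2 hge)
      linarith [(hm.1 i).2.1]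
  have h₂ : seg (X j) (X (j + 1)) (up j) (lo (j + 1)) t₀ ≤ line X a b j t₀ := by
    rcases hj.lt_or_eq with hjk | rfl
    · have hcr : breakpt k X a b (j + 1) = crossing X a b j := breakpt_succ hjk
      have heq := H.line_le_line_iff hm.1 hjk t₀
      have hge : line X a b (j + 1) t₀ ≤ line X a b j t₀ := by
        have := mul_nonneg (sub_nonneg.2 (H.lineSteep_le hm.1 hjk))
          (sub_nonneg.2 (hcr ▸ hle : crossing X a b j ≤ t₀))
        linarith
      refine le_trans ?_ hge
      rw [line_eq_left (H.lt (j + 1) hjk), seg_eq_right hL]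
      have s1 := H.steep_le_lineSteep hm.1 (j := j + 1) hjk
      have s2 := H.conc j hjk
      have := mul_le_mul_of_nonneg_right (s2.trans s1) (sub_nonneg.2 m1)
      linarith [(hm.1 (j + 1)).1.1]
    · rw [breakpt_last] at hle
      have : t₀ = X (j + 1) := le_antisymm m1 hle
      rw [this, seg_right hL, line, seg_right hL]
      exact (hm.1 j).2.1
  obtain ⟨t, ht, hpos⟩ := H.pos j hj _ (hm.1 j).1 _ (hm.1 j).2 t₀ ⟨m2.trans hle, m1⟩ h₁ h₂
  exact absurd (hneg t ht) (not_le.2 hpos)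

/-! ### From the minimizer to an exact chain -/

/-- An exact chain: consecutive lines meeting at the points `c j`, each satisfying two balance
conditions on its own interval, with sign pattern `-, +, -`. -/
structure IsExactChain (k : ℕ) (q : ℝ → ℝ → ℝ) (c : ℕ → ℝ) (ℓ m : ℕ → ℝ) : Prop where
  lt : ∀ j ≤ k, c j < c (j + 1)
  steep_le : ∀ j < k, m j ≤ m (j + 1)
  meet : ∀ j < k, ℓ j - m j * c (j + 1) = ℓ (j + 1) - m (j + 1) * c (j + 1)
  bal : ∀ j ≤ k, ∀ r s : ℝ, ∫ t in c j..c (j + 1), q t (ℓ j - m j * t) * (r + s * t) = 0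
  dip : ∀ j ≤ k, OrdConnected {t | t ∈ Icc (c j) (c (j + 1)) ∧ 0 < q t (ℓ j - m j * t)}

theorem line_eq_affine {j : ℕ} (h : X j < X (j + 1)) (a b : ℕ → ℝ) (t : ℝ) :
    line X a b j t = (a j + lineSteep X a b j * X j) - lineSteep X a b j * t := by
  rw [line_eq_left h]; ring

/-- Between its left crossing and its node, a line is below its left neighbour, on which the force
is already nonpositive, and the force is monotone in the value. -/
theorem IsTrap.nonpos_of_lt_node (H : IsTrap k q X lo up) (hm : IsBoxMin k q X lo up a b)
    {j : ℕ} (hj : j ≤ k) {t : ℝ} (h1 : breakpt k X a b j ≤ t) (h2 : t < X j) :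
    q t (line X a b j t) ≤ 0 := by
  rcases j.eq_zero_or_pos with rfl | hpos
  · exact absurd (h1.trans_lt h2) (lt_irrefl (X 0))
  · obtain ⟨i, rfl⟩ := Nat.exists_eq_add_of_le' hpos
    have hi : i < k := hj
    have heq := H.line_le_line_iff hm.1 hi t
    have hcr : breakpt k X a b (i + 1) = crossing X a b i := breakpt_succ hi
    have := mul_nonneg (sub_nonneg.2 (H.lineSteep_le hm.1 hi))
        (sub_nonneg.2 (hcr ▸ h1 : crossing X a b i ≤ t))
    exact (H.mono t (by linarith)).trans
      (H.nonpos_right hm hi.le (h1.trans_lt h2) t ⟨h1, h2.le⟩)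

theorem IsTrap.nonpos_of_node_lt (H : IsTrap k q X lo up) (hm : IsBoxMin k q X lo up a b)
    {j : ℕ} (hj : j ≤ k) {t : ℝ} (h1 : X (j + 1) < t) (h2 : t ≤ breakpt k X a b (j + 1)) :
    q t (line X a b j t) ≤ 0 := by
  rcases hj.lt_or_eq with hjk | rfl
  · have heq := H.line_le_line_iff hm.1 hjk t
    have hcr : breakpt k X a b (j + 1) = crossing X a b j := breakpt_succ hjk
    have := mul_nonneg (sub_nonneg.2 (H.lineSteep_le hm.1 hjk))
        (sub_nonneg.2 (hcr ▸ h2 : t ≤ crossing X a b j))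
    exact (H.mono t (by linarith)).trans
      (H.nonpos_left hm hjk (h1.trans_le h2) t ⟨h1.le, h2⟩)
  · rw [breakpt_last] at h2
    exact absurd (h1.trans_le h2) (lt_irrefl _)

theorem IsTrap.nonpos_between_left (H : IsTrap k q X lo up) (hm : IsBoxMin k q X lo up a b)
    {j : ℕ} (hj : j ≤ k) {t : ℝ} (ht : t ∈ uIoo (X j) (breakpt k X a b j)) :
    q t (line X a b j t) ≤ 0 := by
  rcases le_or_gt (X j) (breakpt k X a b j) with h | h
  · rw [uIoo_of_le h] at ht
    exact H.nonpos_left hm hj (ht.1.trans ht.2) t ⟨ht.1.le, ht.2.le⟩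
  · rw [uIoo_of_gt h] at ht
    exact H.nonpos_of_lt_node hm hj ht.1.le ht.2

theorem IsTrap.nonpos_between_right (H : IsTrap k q X lo up) (hm : IsBoxMin k q X lo up a b)
    {j : ℕ} (hj : j ≤ k) {t : ℝ} (ht : t ∈ uIoo (X (j + 1)) (breakpt k X a b (j + 1))) :
    q t (line X a b j t) ≤ 0 := by
  rcases le_or_gt (breakpt k X a b (j + 1)) (X (j + 1)) with h | h
  · rw [uIoo_of_ge h] at ht
    exact H.nonpos_right hm hj (ht.1.trans ht.2) t ⟨ht.1.le, ht.2.le⟩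
  · rw [uIoo_of_lt h] at ht
    exact H.nonpos_of_node_lt hm hj ht.1 ht.2.le

theorem integral_max_mul_eq_zero {p φ : ℝ → ℝ} {x c : ℝ} (h : ∀ t ∈ uIoo x c, p t ≤ 0) :
    ∫ t in x..c, max (p t) 0 * φ t = 0 := by
  rw [intervalIntegral.integral_congr_uIoo (g := fun _ => 0)
    (fun t ht => by simp [max_eq_right (h t ht)])]
  simp

theorem IsTrap.mem_cell_of_pos (H : IsTrap k q X lo up) (hm : IsBoxMin k q X lo up a b)
    {j : ℕ} (hj : j ≤ k) {t : ℝ} (ht : t ∈ Icc (breakpt k X a b j) (breakpt k X a b (j + 1)))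
    (hpos : 0 < q t (line X a b j t)) : t ∈ Icc (X j) (X (j + 1)) := by
  constructor
  · by_contra h
    exact absurd (H.nonpos_of_lt_node hm hj ht.1 (not_le.1 h)) (not_le.2 hpos)
  · by_contra h
    exact absurd (H.nonpos_of_node_lt hm hj (not_le.1 h) ht.2) (not_le.2 hpos)

/-- Since the force is nonpositive between nodes and crossings, its positive part has the same
integral over the cell and over the piece. The vanishing form thus becomes the balance of the whole
force on the piece. -/
theorem IsTrap.isExactChain (H : IsTrap k q X lo up) (hm : IsBoxMin k q X lo up a b) :
    IsExactChain k q (breakpt k X a b) (fun j => a j + lineSteep X a b j * X j)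
      (lineSteep X a b) where
  lt j hj := H.breakpt_lt hm hj
  steep_le j hj := H.lineSteep_le hm.1 hj
  meet j hj := by
    rw [← line_eq_affine (H.lt j hj.le), ← line_eq_affine (H.lt (j + 1) hj), ← sub_eq_zero,
      breakpt_succ hj, H.line_le_line_iff hm.1 hj, sub_self, mul_zero]
  bal j hj r s := by
    simp_rw [← line_eq_affine (H.lt j hj)]
    have hq := H.continuous_line a b j
    have hφ : Continuous fun t : ℝ => r + s * t := by fun_prop
    have h0 := H.chainForm_affine hm hj r s
    rw [chainForm, lineForm] at h0
    rw [integral_eq_max_add_min hq hφ]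
    have i := intervalIntegrable_max_mul hq hφ
    have e1 := intervalIntegral.integral_add_adjacent_intervals
      (i (X j) (breakpt k X a b j)) (i (breakpt k X a b j) (breakpt k X a b (j + 1)))
    have e2 := intervalIntegral.integral_add_adjacent_intervals
      (i (X j) (X (j + 1))) (i (X (j + 1)) (breakpt k X a b (j + 1)))
    rw [integral_max_mul_eq_zero fun t ht => H.nonpos_between_left hm hj ht] at e1
    rw [integral_max_mul_eq_zero fun t ht => H.nonpos_between_right hm hj ht] at e2
    linarith
  dip j hj := by
    simp_rw [← line_eq_affine (H.lt j hj)]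
    have h1 := H.dip j hj _ (hm.1 j).1 _ (hm.1 j).2
    have h2 : OrdConnected (Icc (breakpt k X a b j) (breakpt k X a b (j + 1))) := ordConnected_Icc
    convert h1.inter h2 using 1
    ext t
    constructor
    · intro ht
      exact ⟨⟨H.mem_cell_of_pos hm hj ht.1 ht.2, ht.2⟩, ht.1⟩
    · intro ht
      exact ⟨ht.2, ht.1.2⟩

/-- On its own piece a line is bounded below by any lower bound of the box. -/
theorem IsTrap.le_line (H : IsTrap k q X lo up) (hm : IsBoxMin k q X lo up a b) {η : ℝ}
    (hη : ∀ l, η ≤ lo l) {j : ℕ} (hj : j ≤ k) {t : ℝ}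
    (ht : t ∈ Icc (breakpt k X a b j) (breakpt k X a b (j + 1))) : η ≤ line X a b j t := by
  have hcell : ∀ i ≤ k, ∀ t ∈ Icc (X i) (X (i + 1)), η ≤ line X a b i t := fun i hi t ht =>
    le_seg (H.lt i hi) ((hη i).trans (hm.1 i).1.1) ((hη (i + 1)).trans (hm.1 i).2.1) ht
  obtain ⟨m1, m2⟩ := H.breakpt_mem_left hm.1 hj
  have hmeet : ∀ i < k, line X a b i (breakpt k X a b (i + 1)) =
      line X a b (i + 1) (breakpt k X a b (i + 1)) := fun i hi => by
    rw [← sub_eq_zero, breakpt_succ hi, H.line_le_line_iff hm.1 hi, sub_self, mul_zero]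
  have hl : η ≤ line X a b j (breakpt k X a b j) := by
    rcases le_or_gt (X j) (breakpt k X a b j) with h | h
    · exact hcell j hj _ ⟨h, m1⟩
    · rcases j.eq_zero_or_pos with rfl | hpos
      · exact absurd h (lt_irrefl (X 0))
      · obtain ⟨i, rfl⟩ := Nat.exists_eq_add_of_le' hpos
        rw [← hmeet i hj]
        exact hcell i (Nat.le_of_succ_le hj) _
          ⟨(H.breakpt_mem_left hm.1 (Nat.le_of_succ_le hj)).2, h.le⟩
  have hr : η ≤ line X a b j (breakpt k X a b (j + 1)) := by
    rcases le_or_gt (breakpt k X a b (j + 1)) (X (j + 1)) with h | h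
    · exact hcell j hj _ ⟨m2, h⟩
    · rcases hj.lt_or_eq with hjk | rfl
      · rw [hmeet j hjk]
        exact hcell (j + 1) hjk _ ⟨h.le, (H.breakpt_mem_left hm.1 (j := j + 1) hjk).1⟩
      · rw [breakpt_last] at h
        exact absurd h (lt_irrefl _)
  rw [line_eq_left (H.lt j hj)] at hl hr ⊢
  rcases le_total 0 (lineSteep X a b j) with h | h
  · nlinarith [mul_nonneg h (sub_nonneg.2 ht.2)]
  · nlinarith [mul_nonneg (neg_nonneg.2 h) (sub_nonneg.2 ht.1)]

end

/-- **Existence of an exact chain inside a trap.** -/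
theorem IsTrap.exists_exactChain {k : ℕ} {q : ℝ → ℝ → ℝ} {X lo up : ℕ → ℝ}
    (H : IsTrap k q X lo up) {η : ℝ} (hη : ∀ l, η ≤ lo l) :
    ∃ c ℓ m : ℕ → ℝ, IsExactChain k q c ℓ m ∧ c 0 = X 0 ∧ c (k + 1) = X (k + 1) ∧
      ∀ j ≤ k, ∀ t ∈ Icc (c j) (c (j + 1)), η ≤ ℓ j - m j * t := by
  obtain ⟨a, b, hab, hmin⟩ := exists_min_chainEnergy k H.cont X H.le
  refine ⟨_, _, _, H.isExactChain ⟨hab, hmin⟩, rfl, breakpt_last, fun j hj t ht => ?_⟩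
  rw [← line_eq_affine (H.lt j hj)]
  exact H.le_line ⟨hab, hmin⟩ hη hj ht

/-! ### Power sums -/

section PowerSum
variable {ι : Type*} [Fintype ι]

/-- The power sum `∑ c_j t^{e_j}`. -/
def powerSum (c : ι → ℝ) (e : ι → ℕ) (t : ℝ) : ℝ := ∑ j, c j * t ^ e j

theorem hasDerivAt_powerSum (c : ι → ℝ) (e : ι → ℕ) (t : ℝ) :
    HasDerivAt (powerSum c e) (powerSum (fun j => c j * e j) (fun j => e j - 1) t) t := by
  unfold powerSum
  have : ∀ j, HasDerivAt (fun t : ℝ => c j * t ^ e j) (c j * e j * t ^ (e j - 1)) t := fun j => by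
    have := (hasDerivAt_pow (e j) t).const_mul (c j)
    rwa [← mul_assoc] at this
  simpa using HasDerivAt.fun_sum fun j (_ : j ∈ Finset.univ) => this j

theorem deriv_powerSum (c : ι → ℝ) (e : ι → ℕ) :
    deriv (powerSum c e) = powerSum (fun j => c j * e j) (fun j => e j - 1) :=
  funext fun t => (hasDerivAt_powerSum c e t).deriv

@[fun_prop]
theorem continuous_powerSum (c : ι → ℝ) (e : ι → ℕ) : Continuous (powerSum c e) := by
  unfold powerSum; fun_prop

theorem powerSum_pos {c : ι → ℝ} {e : ι → ℕ} (hc : ∀ j, 0 ≤ c j) (hpos : ∃ j, 0 < c j) {t : ℝ}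
    (ht : 0 < t) : 0 < powerSum c e t := by
  obtain ⟨j, hj⟩ := hpos
  exact Finset.sum_pos' (fun i _ => mul_nonneg (hc i) (pow_nonneg ht.le _))
    ⟨j, Finset.mem_univ _, mul_pos hj (pow_pos ht _)⟩

theorem powerSum_mono {c : ι → ℝ} {e : ι → ℕ} (hc : ∀ j, 0 ≤ c j) {s t : ℝ} (hs : 0 ≤ s)
    (hst : s ≤ t) : powerSum c e s ≤ powerSum c e t :=
  Finset.sum_le_sum fun j _ => mul_le_mul_of_nonneg_left (pow_le_pow_left₀ hs hst _) (hc j)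

theorem powerSum_zero {c : ι → ℝ} {e : ι → ℕ} (he : ∀ j, e j ≠ 0) : powerSum c e 0 = 0 := by
  simp [powerSum, he]

end PowerSum

/-! ### Sign alternations of `∑ α_i t^{e_i + 1} - X ∑ β_i t^{e_i}` with varying level `X` -/

section Alternation
variable {ι : Type*}

/-- `∑ α_i t^{e_i + 1} - X ∑ β_i t^{e_i}`. -/
def levelSum (S : Finset ι) (e : ι → ℕ) (α β : ι → ℝ) (X t : ℝ) : ℝ :=
  ∑ i ∈ S, (α i * t ^ (e i + 1) - X * (β i * t ^ e i))

/-- This is what lets the level vary from point to point: lowering it preserves positive values,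
raising it preserves negative ones. -/
theorem levelSum_anti {S : Finset ι} {e : ι → ℕ} {α β : ι → ℝ} (hβ : ∀ i ∈ S, 0 ≤ β i)
    {X Y t : ℝ} (ht : 0 ≤ t) (hXY : X ≤ Y) :
    levelSum S e α β Y t ≤ levelSum S e α β X t :=
  Finset.sum_le_sum fun i hi => sub_le_sub_left
    (mul_le_mul_of_nonneg_right hXY (mul_nonneg (hβ i hi) (pow_nonneg ht _))) _

theorem hasDerivAt_levelSum (S : Finset ι) (e : ι → ℕ) (α β : ι → ℝ) (X : ℝ) {t : ℝ}
    (ht : t ≠ 0) (d : ℕ) :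
    HasDerivAt (levelSum S e α β X) ((levelSum S e (fun i => α i * (e i + 1 - d))
      (fun i => β i * (e i - d)) X t + d * levelSum S e α β X t) / t) t := by
  have h : ∀ i ∈ S, HasDerivAt (fun t : ℝ => α i * t ^ (e i + 1) - X * (β i * t ^ e i))
      (α i * ((e i + 1) * t ^ e i) - X * (β i * (e i * t ^ (e i - 1)))) t := by
    intro i _
    have h1 := (hasDerivAt_pow (e i + 1) t).const_mul (α i)
    have h2 := ((hasDerivAt_pow (e i) t).const_mul (β i)).const_mul X
    exact (h1.sub h2).congr_deriv (by push_cast; rfl)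
  have hs := HasDerivAt.fun_sum h
  refine hs.congr_deriv ?_
  rw [eq_div_iff ht, Finset.sum_mul, levelSum, levelSum, Finset.mul_sum, ← Finset.sum_add_distrib]
  refine Finset.sum_congr rfl fun i _ => ?_
  rcases Nat.eq_zero_or_pos (e i) with h0 | h0
  · rw [h0]; push_cast; ring
  · obtain ⟨r, hr⟩ := Nat.exists_eq_add_of_le' h0
    rw [hr]; push_cast; ring

/-- If `f` increases from negative to positive, then `t f' - d f` is positive in between. -/
theorem exists_levelSum_pos (S : Finset ι) (e : ι → ℕ) (α β : ι → ℝ) (X : ℝ) (d : ℕ) {x y : ℝ}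
    (hx : 0 < x) (hxy : x < y) (h1 : levelSum S e α β X x < 0) (h2 : 0 < levelSum S e α β X y) :
    ∃ z ∈ Ioo x y, 0 < levelSum S e (fun i => α i * (e i + 1 - d)) (fun i => β i * (e i - d)) X z := by
  set f := levelSum S e α β X with hf
  set g := levelSum S e (fun i => α i * (e i + 1 - d)) (fun i => β i * (e i - d)) X with hg
  -- The mean value theorem is applied to `f / t^d`, whose derivative is `(t f' - d f) / t^{d+1}`;
  -- the sign change survives division by `t^d`.
  have hd : ∀ t ∈ Icc x y, HasDerivAt (fun t => f t / t ^ d) (g t / t ^ (d + 1)) t := by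
    intro t ht
    have ht0 : 0 < t := hx.trans_le ht.1
    have := (hasDerivAt_levelSum S e α β X ht0.ne' d).div (hasDerivAt_pow d t) (pow_pos ht0 d).ne'
    refine this.congr_deriv ?_
    rw [← hf, ← hg]
    rcases Nat.eq_zero_or_pos d with h0 | h0
    · subst h0; simp
    · obtain ⟨r, rfl⟩ := Nat.exists_eq_add_of_le' h0
      rw [Nat.add_sub_cancel]
      have : t ≠ 0 := ht0.ne'
      field_simp
      ring
  obtain ⟨z, hz, hz'⟩ := exists_hasDerivAt_eq_slope (fun t => f t / t ^ d)
    (fun t => g t / t ^ (d + 1)) hxy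
    (fun t ht => (hd t ht).continuousAt.continuousWithinAt) (fun t ht => hd t ⟨ht.1.le, ht.2.le⟩)
  refine ⟨z, hz, ?_⟩
  have hpos : 0 < g z / z ^ (d + 1) := by
    rw [hz']
    have e1 : f x / x ^ d < 0 := div_neg_of_neg_of_pos h1 (pow_pos hx d)
    have e2 : 0 < f y / y ^ d := div_pos h2 (pow_pos (hx.trans hxy) d)
    exact div_pos (by linarith) (by linarith)
  have hz0 : 0 < z ^ (d + 1) := pow_pos (hx.trans hz.1) _
  by_contra hneg
  exact absurd hpos (not_lt.2 (div_nonpos_of_nonpos_of_nonneg (not_lt.1 hneg) hz0.le))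

theorem levelSum_neg (S : Finset ι) (e : ι → ℕ) (α β : ι → ℝ) (X t : ℝ) :
    levelSum S e (fun i => -α i) (fun i => -β i) X t = -levelSum S e α β X t := by
  simp only [levelSum, ← Finset.sum_neg_distrib]
  exact Finset.sum_congr rfl fun i _ => by ring

theorem exists_levelSum_neg (S : Finset ι) (e : ι → ℕ) (α β : ι → ℝ) (X : ℝ) (d : ℕ) {x y : ℝ}
    (hx : 0 < x) (hxy : x < y) (h1 : 0 < levelSum S e α β X x) (h2 : levelSum S e α β X y < 0) :
    ∃ z ∈ Ioo x y, levelSum S e (fun i => α i * (e i + 1 - d)) (fun i => β i * (e i - d)) X z < 0 := by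
  obtain ⟨z, hz, h⟩ := exists_levelSum_pos S e (fun i => -α i) (fun i => -β i) X d hx hxy
    (by rw [levelSum_neg]; linarith) (by rw [levelSum_neg]; linarith)
  refine ⟨z, hz, ?_⟩
  simp only [neg_mul, levelSum_neg] at h
  linarith

/-- A levelled power sum with `#S` exponents does not alternate `2 #S` times. -/
theorem not_alternating [LinearOrder ι] (e : ι → ℕ) (he : StrictMono e) (S : Finset ι) :
    ∀ (α β : ι → ℝ), (∀ i ∈ S, 0 ≤ α i) → (∀ i ∈ S, 0 ≤ β i) → ∀ τ σ X X' : ℕ → ℝ, 0 < τ 0 →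
      (∀ i < S.card, τ i < σ i ∧ σ i < τ (i + 1) ∧ X' i ≤ X i ∧ X' i ≤ X (i + 1) ∧
        levelSum S e α β (X' i) (σ i) < 0) →
      ¬ ∀ i ≤ S.card, 0 < levelSum S e α β (X i) (τ i) := by
  induction S using Finset.induction_on_min with
  | empty =>
    intro α β _ _ τ σ X X' _ _ h
    simpa [levelSum] using h 0 le_rfl
  | insert a s has ih =>
    intro α β hα hβ τ σ X X' h0 hσ hτ
    have hnot : a ∉ s := fun h => lt_irrefl _ (has a h)
    rw [Finset.card_insert_of_notMem hnot] at hσ hτ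
    have hle : ∀ i ∈ insert a s, (e a : ℝ) ≤ e i := by
      intro i hi
      rcases Finset.mem_insert.1 hi with rfl | hi
      · exact le_rfl
      · exact_mod_cast he.monotone (has i hi).le
    have hlt : ∀ i ∈ s, (e a : ℝ) + 1 ≤ e i := fun i hi => by exact_mod_cast he (has i hi)
    have hpos : ∀ i ≤ s.card + 1, 0 < τ i := by
      intro i
      induction i with
      | zero => intro _; exact h0
      | succ i ihi =>
        intro hi
        obtain ⟨h1, h2, -⟩ := hσ i (by omega)
        linarith [ihi (by omega)]
    -- The operator `t f' - d f` with `d = e a` annihilates the term of `β a`, and a second pass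
    -- with `d = e a + 1` that of `α a`. The other coefficients stay nonnegative because their
    -- exponents are at least `e a + 1`. The two passes together cost one exponent and one pair of
    -- alternations.
    set α₁ : ι → ℝ := fun i => α i * (e i + 1 - e a) with hα₁
    set β₁ : ι → ℝ := fun i => β i * (e i - e a) with hβ₁
    have hβ₁0 : ∀ i ∈ insert a s, 0 ≤ β₁ i := fun i hi =>
      mul_nonneg (hβ i hi) (sub_nonneg.2 (hle i hi))
    have step1 : ∀ i, ∃ z, i < s.card + 1 → z ∈ Ioo (τ i) (σ i) ∧
        levelSum (insert a s) e α₁ β₁ (X' i) z < 0 := by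
      intro i
      by_cases hi : i < s.card + 1
      · obtain ⟨h1, h2, h3, h4, h5⟩ := hσ i hi
        have hp := hpos i hi.le
        obtain ⟨z, hz, hz'⟩ := exists_levelSum_neg (insert a s) e α β (X' i) (e a) hp h1
          ((hτ i hi.le).trans_le (levelSum_anti hβ hp.le h3)) h5
        exact ⟨z, fun _ => ⟨hz, hz'⟩⟩
      · exact ⟨0, fun h => absurd h hi⟩
    have step2 : ∀ i, ∃ z, i < s.card + 1 → z ∈ Ioo (σ i) (τ (i + 1)) ∧
        0 < levelSum (insert a s) e α₁ β₁ (X (i + 1)) z := by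
      intro i
      by_cases hi : i < s.card + 1
      · obtain ⟨h1, h2, h3, h4, h5⟩ := hσ i hi
        have hp := (hpos i hi.le).trans h1
        obtain ⟨z, hz, hz'⟩ := exists_levelSum_pos (insert a s) e α β (X (i + 1)) (e a) hp h2
          ((levelSum_anti hβ hp.le h4).trans_lt h5) (hτ (i + 1) hi)
        exact ⟨z, fun _ => ⟨hz, hz'⟩⟩
      · exact ⟨0, fun h => absurd h hi⟩
    choose sg hsg using step1
    choose tt htt using step2
    set α₂ : ι → ℝ := fun i => α₁ i * (e i + 1 - (e a + 1 : ℕ)) with hα₂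
    set β₂ : ι → ℝ := fun i => β₁ i * (e i - (e a + 1 : ℕ)) with hβ₂
    have hins : ∀ Y t, levelSum (insert a s) e α₂ β₂ Y t = levelSum s e α₂ β₂ Y t := by
      intro Y t
      rw [levelSum, Finset.sum_insert hnot, levelSum]
      simp [hα₂, hβ₂, hβ₁]
    have step3 : ∀ i, ∃ z, i < s.card + 1 → z ∈ Ioo (sg i) (tt i) ∧
        0 < levelSum s e α₂ β₂ (X (i + 1)) z := by
      intro i
      by_cases hi : i < s.card + 1
      · obtain ⟨h1, h2⟩ := hsg i hi
        obtain ⟨h3, h4⟩ := htt i hi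
        obtain ⟨-, -, -, h5, -⟩ := hσ i hi
        have hp := (hpos i hi.le).trans h1.1
        obtain ⟨z, hz, hz'⟩ := exists_levelSum_pos (insert a s) e α₁ β₁ (X (i + 1)) (e a + 1) hp
          (h1.2.trans h3.1) ((levelSum_anti hβ₁0 hp.le h5).trans_lt h2) h4
        exact ⟨z, fun _ => ⟨hz, by rw [← hins]; exact hz'⟩⟩
      · exact ⟨0, fun h => absurd h hi⟩
    have step4 : ∀ i, ∃ z, i < s.card → z ∈ Ioo (tt i) (sg (i + 1)) ∧
        levelSum s e α₂ β₂ (X' (i + 1)) z < 0 := by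
      intro i
      by_cases hi : i < s.card
      · obtain ⟨h1, h2⟩ := hsg (i + 1) (by omega)
        obtain ⟨h3, h4⟩ := htt i (by omega)
        obtain ⟨h6, -, h5, -⟩ := hσ (i + 1) (by omega)
        have hp : 0 < tt i := ((hpos i (by omega)).trans (hσ i (by omega)).1).trans h3.1
        obtain ⟨z, hz, hz'⟩ := exists_levelSum_neg (insert a s) e α₁ β₁ (X' (i + 1)) (e a + 1) hp
          (h3.2.trans h1.1) (h4.trans_le (levelSum_anti hβ₁0 hp.le h5)) h2
        exact ⟨z, fun _ => ⟨hz, by rw [← hins]; exact hz'⟩⟩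
      · exact ⟨0, fun h => absurd h hi⟩
    choose τ' hτ' using step3
    choose σ' hσ' using step4
    refine ih α₂ β₂ ?_ ?_ τ' σ' (fun i => X (i + 1)) (fun i => X' (i + 1)) ?_ ?_ ?_
    · intro i hi
      have := hlt i hi
      refine mul_nonneg (mul_nonneg (hα i (Finset.mem_insert_of_mem hi)) (by linarith)) ?_
      push_cast; linarith
    · intro i hi
      have := hlt i hi
      refine mul_nonneg (mul_nonneg (hβ i (Finset.mem_insert_of_mem hi)) (by linarith)) ?_
      push_cast; linarith
    · exact (h0.trans (hsg 0 (by omega)).1.1).trans (hτ' 0 (by omega)).1.1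
    · intro i hi
      exact ⟨(hτ' i (by omega)).1.2.trans (hσ' i hi).1.1,
        (hσ' i hi).1.2.trans (hτ' (i + 1) (by omega)).1.1, (hσ (i + 1) (by omega)).2.2.1,
        (hσ (i + 1) (by omega)).2.2.2.1, (hσ' i hi).2⟩
    · intro i hi
      exact (hτ' i (by omega)).2

end Alternation

/-! ### The second derivative of a mixture -/

/-- The standing assumptions on the exponents and weights of a mixture. -/
structure IsMixture {n : ℕ} (p : Fin n → ℕ) (lam : Fin n → ℝ) : Prop where
  mono : StrictMono p
  two_lt : ∀ j, 2 < p j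
  nonneg : ∀ j, 0 ≤ lam j
  sum_eq : ∑ j, lam j = 1

/-- `ξ''`. -/
def phi {n : ℕ} (p : Fin n → ℕ) (lam : Fin n → ℝ) : ℝ → ℝ :=
  powerSum (fun j => lam j * p j * (p j - 1 : ℕ)) fun j => p j - 1 - 1

/-- `ξ'''`. -/
def phi₁ {n : ℕ} (p : Fin n → ℕ) (lam : Fin n → ℝ) : ℝ → ℝ :=
  powerSum (fun j => lam j * p j * (p j - 1 : ℕ) * (p j - 1 - 1 : ℕ)) fun j => p j - 1 - 1 - 1

/-- `ξ''''`. -/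
def phi₂ {n : ℕ} (p : Fin n → ℕ) (lam : Fin n → ℝ) : ℝ → ℝ := deriv (phi₁ p lam)

/-- `(ξ'')^{-1/2}`. -/
def psi {n : ℕ} (p : Fin n → ℕ) (lam : Fin n → ℝ) (t : ℝ) : ℝ := (√(phi p lam t))⁻¹

/-- `-2 ψ'` for `ψ = (ξ'')^{-1/2}`. -/
def kap {n : ℕ} (p : Fin n → ℕ) (lam : Fin n → ℝ) (t : ℝ) : ℝ := phi₁ p lam t * psi p lam t ^ 3

section
variable {n : ℕ} {p : Fin n → ℕ} {lam : Fin n → ℝ}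

theorem deriv_mixture : deriv (mixture p lam) = powerSum (fun j => lam j * p j) fun j => p j - 1 :=
  deriv_powerSum lam p

theorem deriv_deriv_mixture : deriv (deriv (mixture p lam)) = phi p lam := by
  rw [deriv_mixture, deriv_powerSum]; rfl

theorem hasDerivAt_mixture (t : ℝ) : HasDerivAt (mixture p lam) (deriv (mixture p lam) t) t := by
  rw [deriv_mixture]; exact hasDerivAt_powerSum lam p t

theorem hasDerivAt_deriv_mixture (t : ℝ) :
    HasDerivAt (deriv (mixture p lam)) (phi p lam t) t := by
  rw [deriv_mixture]; exact hasDerivAt_powerSum _ _ t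

@[fun_prop]
theorem continuous_deriv_mixture : Continuous (deriv (mixture p lam)) := by
  rw [deriv_mixture]; fun_prop

@[fun_prop]
theorem continuous_phi : Continuous (phi p lam) := continuous_powerSum _ _

theorem hasDerivAt_phi (t : ℝ) : HasDerivAt (phi p lam) (phi₁ p lam t) t :=
  hasDerivAt_powerSum _ _ t

theorem hasDerivAt_phi₁ (t : ℝ) : HasDerivAt (phi₁ p lam) (phi₂ p lam t) t :=
  (hasDerivAt_powerSum _ _ t).differentiableAt.hasDerivAt

variable (M : IsMixture p lam)
include M

theorem IsMixture.exists_pos : ∃ j, 0 < lam j := by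
  by_contra h
  push Not at h
  have : ∑ j, lam j ≤ 0 := Finset.sum_nonpos fun j _ => h j
  rw [M.sum_eq] at this
  linarith

theorem IsMixture.one_le_cast (j : Fin n) : (0 : ℝ) < p j ∧ (0 : ℝ) < (p j - 1 : ℕ) ∧
    (0 : ℝ) < (p j - 1 - 1 : ℕ) := by
  have := M.two_lt j
  refine ⟨?_, ?_, ?_⟩ <;> (norm_cast; omega)

theorem IsMixture.phi_pos {t : ℝ} (ht : 0 < t) : 0 < phi p lam t := by
  obtain ⟨j, hj⟩ := M.exists_pos
  refine powerSum_pos (fun i => ?_) ⟨j, ?_⟩ ht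
  · exact mul_nonneg (mul_nonneg (M.nonneg i) (M.one_le_cast i).1.le) (M.one_le_cast i).2.1.le
  · exact mul_pos (mul_pos hj (M.one_le_cast j).1) (M.one_le_cast j).2.1

theorem IsMixture.phi₁_pos {t : ℝ} (ht : 0 < t) : 0 < phi₁ p lam t := by
  obtain ⟨j, hj⟩ := M.exists_pos
  have h := M.one_le_cast
  refine powerSum_pos (fun i => ?_) ⟨j, ?_⟩ ht
  · exact mul_nonneg (mul_nonneg (mul_nonneg (M.nonneg i) (h i).1.le) (h i).2.1.le) (h i).2.2.le
  · exact mul_pos (mul_pos (mul_pos hj (h j).1) (h j).2.1) (h j).2.2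

theorem IsMixture.phi_zero : phi p lam 0 = 0 :=
  powerSum_zero fun j => by have := M.two_lt j; omega

theorem IsMixture.deriv_mixture_zero : deriv (mixture p lam) 0 = 0 := by
  rw [deriv_mixture]; exact powerSum_zero fun j => by have := M.two_lt j; omega

theorem IsMixture.phi_nonneg {t : ℝ} (ht : 0 ≤ t) : 0 ≤ phi p lam t := by
  rcases ht.eq_or_lt with rfl | h
  · rw [M.phi_zero]
  · exact (M.phi_pos h).le

theorem IsMixture.phi_mono {s t : ℝ} (hs : 0 ≤ s) (hst : s ≤ t) : phi p lam s ≤ phi p lam t :=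
  powerSum_mono (fun i => mul_nonneg (mul_nonneg (M.nonneg i) (M.one_le_cast i).1.le)
    (M.one_le_cast i).2.1.le) hs hst

theorem IsMixture.psi_pos {t : ℝ} (ht : 0 < t) : 0 < psi p lam t :=
  inv_pos.2 (Real.sqrt_pos.2 (M.phi_pos ht))

theorem IsMixture.phi_mul_psi_sq {t : ℝ} (ht : 0 < t) : phi p lam t * psi p lam t ^ 2 = 1 := by
  have h := M.phi_pos ht
  rw [psi, inv_pow, Real.sq_sqrt h.le, mul_inv_cancel₀ h.ne']

theorem IsMixture.hasDerivAt_psi {t : ℝ} (ht : 0 < t) :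
    HasDerivAt (psi p lam) (-kap p lam t / 2) t := by
  have h := M.phi_pos ht
  have hs := Real.sqrt_pos.2 h
  refine (((hasDerivAt_phi t).sqrt h.ne').inv hs.ne').congr_deriv ?_
  rw [kap, psi]
  field_simp

theorem IsMixture.hasDerivAt_kap {t : ℝ} (ht : 0 < t) :
    HasDerivAt (kap p lam) (-(psi p lam t ^ 5 *
      (3 / 2 * phi₁ p lam t ^ 2 - phi p lam t * phi₂ p lam t))) t := by
  have h := M.phi_mul_psi_sq ht
  refine ((hasDerivAt_phi₁ t).mul ((M.hasDerivAt_psi ht).pow 3)).congr_deriv ?_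
  rw [kap]
  simp only [Pi.pow_apply]
  linear_combination (-(phi₂ p lam t) * psi p lam t ^ 3) * h

/-- The function `t + 2 ξ'' / ξ'''`. -/
theorem IsMixture.hasDerivAt_level {t : ℝ} (ht : 0 < t) :
    HasDerivAt (fun t => t + 2 * phi p lam t / phi₁ p lam t)
      (2 * (3 / 2 * phi₁ p lam t ^ 2 - phi p lam t * phi₂ p lam t) / phi₁ p lam t ^ 2) t := by
  have h := M.phi₁_pos ht
  refine ((hasDerivAt_id t).add (((hasDerivAt_phi t).const_mul 2).div (hasDerivAt_phi₁ t)
    h.ne')).congr_deriv ?_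
  field_simp
  ring

/-- `t + 2ξ''/ξ'''` is the point where the tangent to `ψ` at `t` meets the axis. After clearing the
denominator, its position relative to `X` is the sign of a levelled power sum with one exponent per
component. -/
theorem IsMixture.levelSum_eq {t : ℝ} (ht : 0 < t) (X : ℝ) :
    levelSum Finset.univ (fun j => p j - 1 - 1)
      (fun j => lam j * p j * (p j - 1 : ℕ) * ((p j - 1 - 1 : ℕ) + 2))
      (fun j => lam j * p j * (p j - 1 : ℕ) * (p j - 1 - 1 : ℕ)) X t =
    t * phi₁ p lam t * (t + 2 * phi p lam t / phi₁ p lam t - X) := by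
  have h := M.phi₁_pos ht
  have e1 : t * phi₁ p lam t * (t + 2 * phi p lam t / phi₁ p lam t - X) =
      t * (t * phi₁ p lam t) + 2 * t * phi p lam t - X * (t * phi₁ p lam t) := by
    field_simp
  have e2 : t * phi₁ p lam t =
      ∑ j, lam j * p j * (p j - 1 : ℕ) * (p j - 1 - 1 : ℕ) * t ^ (p j - 1 - 1) := by
    rw [phi₁, powerSum, Finset.mul_sum]
    refine Finset.sum_congr rfl fun j _ => ?_
    obtain ⟨r, hr⟩ : ∃ r, p j - 1 - 1 = r + 1 := ⟨p j - 1 - 1 - 1, by have := M.two_lt j; omega⟩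
    rw [hr, Nat.add_sub_cancel]
    ring
  rw [e1, e2, phi, powerSum, levelSum, Finset.mul_sum, Finset.mul_sum, Finset.mul_sum,
    ← Finset.sum_add_distrib, ← Finset.sum_sub_distrib]
  refine Finset.sum_congr rfl fun j _ => ?_
  ring

omit M in
theorem exists_gt_of_hasDerivAt_pos {f : ℝ → ℝ} {f' t s : ℝ} (hf : HasDerivAt f f' t) (h : 0 < f')
    (hts : t < s) : ∃ r ∈ Ioo t s, f t < f r := by
  have h1 := (hasDerivAt_iff_tendsto_slope.1 hf).eventually (lt_mem_nhds h)
  have h2 : ∀ᶠ r in 𝓝[>] t, 0 < slope f t r :=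
    (nhdsWithin_mono t fun r (hr : t < r) => hr.ne') h1
  obtain ⟨r, hr, hr'⟩ := (h2.and (Ioo_mem_nhdsGT hts)).exists
  refine ⟨r, hr', ?_⟩
  rw [slope_def_field] at hr
  have := (div_pos_iff_of_pos_right (sub_pos.2 hr'.1)).1 hr
  linarith

omit M in
theorem exists_gt_of_hasDerivAt_neg {f : ℝ → ℝ} {f' t s : ℝ} (hf : HasDerivAt f f' t) (h : f' < 0)
    (hst : s < t) : ∃ r ∈ Ioo s t, f t < f r := by
  have h1 := (hasDerivAt_iff_tendsto_slope.1 hf).eventually (gt_mem_nhds h)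
  have h2 : ∀ᶠ r in 𝓝[<] t, slope f t r < 0 :=
    (nhdsWithin_mono t fun r (hr : r < t) => hr.ne) h1
  obtain ⟨r, hr, hr'⟩ := (h2.and (Ioo_mem_nhdsLT hst)).exists
  refine ⟨r, hr', ?_⟩
  rw [slope_def_field] at hr
  by_contra hle
  exact absurd hr (not_lt.2 (div_nonneg_of_nonpos (by linarith) (by linarith [hr'.2])))

omit M in
/-- A point between `t` and `s` where `f` exceeds both end values. -/
theorem exists_gt_both {f : ℝ → ℝ} {f' g' t s : ℝ} (hf : HasDerivAt f f' t) (h : 0 < f')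
    (hg : HasDerivAt f g' s) (h' : g' < 0) (hts : t < s) :
    ∃ r ∈ Ioo t s, f t < f r ∧ f s < f r := by
  obtain ⟨r₁, hr₁, h₁⟩ := exists_gt_of_hasDerivAt_pos hf h hts
  obtain ⟨r₂, hr₂, h₂⟩ := exists_gt_of_hasDerivAt_neg hg h' hts
  rcases le_total (f r₁) (f r₂) with hle | hle
  · exact ⟨r₂, hr₂, h₁.trans_le hle, h₂⟩
  · exact ⟨r₁, hr₁, h₁, h₂.trans_le hle⟩

/-- `-(ξ'')^{-1/2}'` does not zigzag more than the number of components allows. -/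
theorem IsMixture.not_zigzag (u v : ℕ → ℝ) (h0 : 0 < u 0)
    (huv : ∀ i ≤ n, u i < v i ∧ kap p lam (v i) < kap p lam (u i))
    (hvu : ∀ i < n, v i < u (i + 1) ∧ kap p lam (v i) < kap p lam (u (i + 1))) : False := by
  -- `W` is, up to positive factors, both `-kap'` and `y'`. So each fall of `kap` yields a point
  -- where `y` rises, and each rise one where `y` falls.
  set W : ℝ → ℝ := fun t => 3 / 2 * phi₁ p lam t ^ 2 - phi p lam t * phi₂ p lam t with hW
  set y : ℝ → ℝ := fun t => t + 2 * phi p lam t / phi₁ p lam t with hy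
  have hu0 : ∀ i ≤ n, 0 < u i := by
    intro i
    induction i with
    | zero => intro _; exact h0
    | succ i ih =>
      intro hi
      exact (ih (by omega)).trans ((huv i (by omega)).1.trans (hvu i (by omega)).1)
  have mvt : ∀ {a b : ℝ}, 0 < a → a < b → ∃ z ∈ Ioo a b,
      -(psi p lam z ^ 5 * W z) = (kap p lam b - kap p lam a) / (b - a) := fun ha hab =>
    exists_hasDerivAt_eq_slope _ _ hab
      (fun t ht => (M.hasDerivAt_kap (ha.trans_le ht.1)).continuousAt.continuousWithinAt)
      fun t ht => M.hasDerivAt_kap (ha.trans ht.1)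
  have step1 : ∀ i, ∃ z, i ≤ n → z ∈ Ioo (u i) (v i) ∧ 0 < W z := by
    intro i
    by_cases hi : i ≤ n
    · obtain ⟨h1, h2⟩ := huv i hi
      obtain ⟨z, hz, hz'⟩ := mvt (hu0 i hi) h1
      have hneg : (kap p lam (v i) - kap p lam (u i)) / (v i - u i) < 0 :=
        div_neg_of_neg_of_pos (by linarith) (by linarith)
      have h5 := pow_pos (M.psi_pos ((hu0 i hi).trans hz.1)) 5
      refine ⟨z, fun _ => ⟨hz, ?_⟩⟩
      by_contra hle
      have := mul_nonpos_of_nonneg_of_nonpos h5.le (not_lt.1 hle)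
      linarith
    · exact ⟨0, fun h => absurd h hi⟩
  have step2 : ∀ i, ∃ z, i < n → z ∈ Ioo (v i) (u (i + 1)) ∧ W z < 0 := by
    intro i
    by_cases hi : i < n
    · obtain ⟨h1, h2⟩ := hvu i hi
      have hv0 := (hu0 i hi.le).trans (huv i hi.le).1
      obtain ⟨z, hz, hz'⟩ := mvt hv0 h1
      have hpos : 0 < (kap p lam (u (i + 1)) - kap p lam (v i)) / (u (i + 1) - v i) :=
        div_pos (by linarith) (by linarith)
      have h5 := pow_pos (M.psi_pos (hv0.trans hz.1)) 5
      refine ⟨z, fun _ => ⟨hz, ?_⟩⟩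
      by_contra hle
      have := mul_nonneg h5.le (not_lt.1 hle)
      linarith
    · exact ⟨0, fun h => absurd h hi⟩
  choose t ht using step1
  choose s hs using step2
  have ht0 : ∀ i ≤ n, 0 < t i := fun i hi => (hu0 i hi).trans (ht i hi).1.1
  have hts : ∀ i < n, t i < s i := fun i hi => (ht i hi.le).1.2.trans (hs i hi).1.1
  have hst : ∀ i < n, s i < t (i + 1) := fun i hi =>
    (hs i hi).1.2.trans (ht (i + 1) hi).1.1
  have hs0 : ∀ i < n, 0 < s i := fun i hi => (ht0 i hi.le).trans (hts i hi)
  have hyt : ∀ i ≤ n, 0 < 2 * W (t i) / phi₁ p lam (t i) ^ 2 := fun i hi =>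
    div_pos (by linarith [(ht i hi).2]) (pow_pos (M.phi₁_pos (ht0 i hi)) 2)
  have hys : ∀ i < n, 2 * W (s i) / phi₁ p lam (s i) ^ 2 < 0 := fun i hi =>
    div_neg_of_neg_of_pos (by linarith [(hs i hi).2]) (pow_pos (M.phi₁_pos (hs0 i hi)) 2)
  have step3 : ∀ i, ∃ r, (i < n → r ∈ Ioo (t i) (s i) ∧ y (t i) < y r ∧ y (s i) < y r) ∧
      (i = n → t i < r ∧ y (t i) < y r) := by
    intro i
    rcases lt_trichotomy i n with hi | hi | hi
    · obtain ⟨r, hr, hr'⟩ := exists_gt_both (M.hasDerivAt_level (ht0 i hi.le)) (hyt i hi.le)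
        (M.hasDerivAt_level (hs0 i hi)) (hys i hi) (hts i hi)
      exact ⟨r, fun _ => ⟨hr, hr'⟩, fun h => absurd h hi.ne⟩
    · obtain ⟨r, hr, hr'⟩ := exists_gt_of_hasDerivAt_pos (M.hasDerivAt_level (ht0 i hi.le))
        (hyt i hi.le) (lt_add_one (t i))
      exact ⟨r, fun h => absurd hi h.ne, fun _ => ⟨hr.1, hr'⟩⟩
    · exact ⟨0, fun h => absurd h (by omega), fun h => absurd h (by omega)⟩
  have step4 : ∀ i, ∃ r, i < n → r ∈ Ioo (s i) (t (i + 1)) ∧ y r < y (s i) ∧ y r < y (t (i + 1)) := by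
    intro i
    by_cases hi : i < n
    · obtain ⟨r, hr, h1, h2⟩ := exists_gt_both (M.hasDerivAt_level (hs0 i hi)).neg
        (by linarith [hys i hi]) (M.hasDerivAt_level (ht0 (i + 1) hi)).neg
        (by linarith [hyt (i + 1) hi]) (hst i hi)
      exact ⟨r, fun _ => ⟨hr, neg_lt_neg_iff.1 h1, neg_lt_neg_iff.1 h2⟩⟩
    · exact ⟨0, fun h => absurd h hi⟩
  choose τ hτ hτn using step3
  choose σ hσ using step4
  have hc := M.one_le_cast
  have htτ : ∀ i ≤ n, t i < τ i := fun i hi => by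
    rcases hi.lt_or_eq with h | h
    · exact (hτ i h).1.1
    · exact (hτn i h).1
  -- The levels are maxima and minima of `y` at neighbouring points. Each lower level shares a value
  -- of `y` with both adjacent upper ones, which gives the inequalities between levels; `n + 1`
  -- positive values then contradict `n` exponents.
  refine not_alternating (fun j => p j - 1 - 1) (fun i j hij => by
      have h1 := M.mono hij; have h2 := M.two_lt i; dsimp only; omega) Finset.univ
    (fun j => lam j * p j * (p j - 1 : ℕ) * ((p j - 1 - 1 : ℕ) + 2))
    (fun j => lam j * p j * (p j - 1 : ℕ) * (p j - 1 - 1 : ℕ))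
    (fun i _ => mul_nonneg (mul_nonneg (mul_nonneg (M.nonneg i) (hc i).1.le) (hc i).2.1.le)
      (by linarith [(hc i).2.2]))
    (fun i _ => mul_nonneg (mul_nonneg (mul_nonneg (M.nonneg i) (hc i).1.le) (hc i).2.1.le)
      (hc i).2.2.le)
    τ σ (fun i => if i < n then max (y (t i)) (y (s i)) else y (t i))
    (fun i => min (y (s i)) (y (t (i + 1)))) ((ht0 0 (Nat.zero_le _)).trans (htτ 0 (Nat.zero_le _)))
    ?_ ?_
  · rw [Finset.card_univ, Fintype.card_fin]
    intro i hi
    obtain ⟨h1, h2, h3⟩ := hσ i hi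
    refine ⟨(hτ i hi).1.2.trans h1.1, h1.2.trans (htτ (i + 1) hi), ?_, ?_, ?_⟩
    · rw [if_pos hi]; exact (min_le_left _ _).trans (le_max_right _ _)
    · split_ifs
      · exact (min_le_right _ _).trans (le_max_left _ _)
      · exact min_le_right _ _
    · have hp := (hs0 i hi).trans h1.1
      rw [M.levelSum_eq hp]
      exact mul_neg_of_pos_of_neg (mul_pos hp (M.phi₁_pos hp)) (sub_neg.2 (lt_min h2 h3))
  · rw [Finset.card_univ, Fintype.card_fin]
    intro i hi
    have hp := (ht0 i hi).trans (htτ i hi)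
    rw [M.levelSum_eq hp]
    refine mul_pos (mul_pos hp (M.phi₁_pos hp)) (sub_pos.2 ?_)
    split_ifs with h
    · exact max_lt (hτ i h).2.1 (hτ i h).2.2
    · exact (hτn i (le_antisymm hi (not_lt.1 h))).2

end

/-! ### The force along a line -/

/-- The derivative of the energy density `ξ'' N + 1 / N`, cut off at `N = η`. -/
def force {n : ℕ} (p : Fin n → ℕ) (lam : Fin n → ℝ) (η t N : ℝ) : ℝ :=
  phi p lam t - 1 / (max N η) ^ 2

section
variable {n : ℕ} {p : Fin n → ℕ} {lam : Fin n → ℝ} {η : ℝ}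

theorem continuous_force (hη : 0 < η) : Continuous (Function.uncurry (force p lam η)) := by
  have : ∀ z : ℝ × ℝ, (max z.2 η) ^ 2 ≠ 0 := fun z =>
    (pow_pos (hη.trans_le (le_max_right _ _)) 2).ne'
  unfold Function.uncurry force
  exact (continuous_phi.comp continuous_fst).sub
    (continuous_const.div (by fun_prop) this)

theorem force_mono (hη : 0 < η) (t : ℝ) : Monotone (force p lam η t) := by
  intro M N hMN
  have h : 0 < max M η := hη.trans_le (le_max_right _ _)
  have h2 : max M η ≤ max N η := max_le_max_right _ hMN
  unfold force
  gcongr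

theorem force_of_le {t N : ℝ} (h : η ≤ N) : force p lam η t N = phi p lam t - 1 / N ^ 2 := by
  rw [force, max_eq_left h]

theorem force_nonpos_iff (hη : 0 < η) {t N : ℝ} (h : η ≤ N) :
    force p lam η t N ≤ 0 ↔ phi p lam t * N ^ 2 ≤ 1 := by
  have : 0 < N ^ 2 := pow_pos (hη.trans_le h) 2
  rw [force_of_le h, sub_nonpos, le_div_iff₀ this]

theorem continuous_force_affine (hη : 0 < η) (A m : ℝ) :
    Continuous fun t => force p lam η t (A - m * t) :=
  (continuous_force hη).comp (by fun_prop : Continuous fun t : ℝ => (t, A - m * t))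

/-- `∫ 1 / ℓ²` for a positive affine function `ℓ`. -/
theorem integral_inv_sq_affine {x x' A m : ℝ} (hx : x ≤ x') (hpos : ∀ t ∈ Icc x x', 0 < A - m * t) :
    ∫ t in x..x', 1 / (A - m * t) ^ 2 = (x' - x) / ((A - m * x) * (A - m * x')) := by
  have h1 := hpos x ⟨le_rfl, hx⟩
  have hd : ∀ t ∈ uIcc x x', HasDerivAt (fun t => (t - x) / ((A - m * x) * (A - m * t)))
      (1 / (A - m * t) ^ 2) t := by
    intro t ht
    rw [uIcc_of_le hx] at ht
    have h2 := hpos t ht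
    have e : HasDerivAt (fun t => (A - m * x) * (A - m * t)) ((A - m * x) * -m) t := by
      have := (((hasDerivAt_id t).const_mul m).const_sub A).const_mul (A - m * x)
      simpa using this
    refine (((hasDerivAt_id t).sub_const x).div e (mul_pos h1 h2).ne').congr_deriv ?_
    have := h1.ne'
    have := h2.ne'
    simp only [id]
    field_simp
    ring
  have hc : ContinuousOn (fun t => 1 / (A - m * t) ^ 2) (uIcc x x') := by
    rw [uIcc_of_le hx]
    exact continuousOn_const.div (by fun_prop) fun t ht => (pow_pos (hpos t ht) 2).ne'
  rw [intervalIntegral.integral_eq_sub_of_hasDerivAt hd hc.intervalIntegrable]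
  simp

theorem integral_phi (x x' : ℝ) : ∫ t in x..x', phi p lam t =
    deriv (mixture p lam) x' - deriv (mixture p lam) x :=
  intervalIntegral.integral_eq_sub_of_hasDerivAt (fun t _ => hasDerivAt_deriv_mixture t)
    (continuous_phi.intervalIntegrable _ _)

theorem integral_force_affine (hη : 0 < η) {x x' A m : ℝ} (hx : x ≤ x')
    (hpos : ∀ t ∈ Icc x x', η ≤ A - m * t) :
    ∫ t in x..x', force p lam η t (A - m * t) = deriv (mixture p lam) x' - deriv (mixture p lam) x -
      (x' - x) / ((A - m * x) * (A - m * x')) := by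
  have h0 : ∀ t ∈ Icc x x', 0 < A - m * t := fun t ht => hη.trans_le (hpos t ht)
  rw [← integral_inv_sq_affine hx h0, ← integral_phi, ← intervalIntegral.integral_sub
    (continuous_phi.intervalIntegrable _ _)]
  · exact intervalIntegral.integral_congr fun t ht => force_of_le (hpos t (uIcc_of_le hx ▸ ht))
  · refine ContinuousOn.intervalIntegrable ?_
    rw [uIcc_of_le hx]
    exact continuousOn_const.div (by fun_prop) fun t ht => (pow_pos (h0 t ht) 2).ne'

theorem seg_eq_affine {x x' : ℝ} (hx : x < x') (a b t : ℝ) :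
    seg x x' a b t = (a + steep x x' a b * x) - steep x x' a b * t := by
  rw [seg_eq_left hx]; ring

theorem integral_force_seg (hη : 0 < η) {x x' a b : ℝ} (hx : x < x') (ha : η ≤ a) (hb : η ≤ b) :
    ∫ t in x..x', force p lam η t (seg x x' a b t) =
      deriv (mixture p lam) x' - deriv (mixture p lam) x - (x' - x) / (a * b) := by
  have h := integral_force_affine (p := p) (lam := lam) hη (A := a + steep x x' a b * x)
    (m := steep x x' a b) hx.le
    (fun t ht => by rw [← seg_eq_affine hx]; exact le_seg hx ha hb ht)
  rw [← seg_eq_affine hx, ← seg_eq_affine hx, seg_left hx, seg_right hx] at h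
  rw [← h]
  simp_rw [← seg_eq_affine hx]

/-- Zero total force fixes the product of the end values and nothing else; this is the origin of the
one-parameter family of polygons through given nodes. -/
theorem integral_force_seg_eq_zero_iff (hη : 0 < η) {x x' a b : ℝ} (hx : x < x') (ha : η ≤ a)
    (hb : η ≤ b) : ∫ t in x..x', force p lam η t (seg x x' a b t) = 0 ↔
      a * b * (deriv (mixture p lam) x' - deriv (mixture p lam) x) = x' - x := by
  have : a * b ≠ 0 := (mul_pos (hη.trans_le ha) (hη.trans_le hb)).ne'
  rw [integral_force_seg hη hx ha hb, sub_eq_zero, eq_div_iff this, mul_comm]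

variable (M : IsMixture p lam)
include M

/-- `ξ'' ℓ²` is not constantly `1` for affine `ℓ`. -/
theorem IsMixture.exists_phi_mul_sq_ne_one {x x' : ℝ} (hx : x < x') (A m : ℝ) :
    ∃ t ∈ Icc x x', phi p lam t * (A - m * t) ^ 2 ≠ 1 := by
  by_contra hcon
  push Not at hcon
  set P : Polynomial ℝ := ∑ j, Polynomial.C (lam j * p j * (p j - 1 : ℕ)) *
    Polynomial.X ^ (p j - 1 - 1) with hP
  have hev : ∀ t, P.eval t = phi p lam t := fun t => by
    simp [hP, phi, powerSum, Polynomial.eval_finsetSum]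
  set R : Polynomial ℝ := P * (Polynomial.C A - Polynomial.C m * Polynomial.X) ^ 2 - 1 with hR
  have hRev : ∀ t, R.eval t = phi p lam t * (A - m * t) ^ 2 - 1 := fun t => by simp [hR, hev]
  have hz : R = 0 := Polynomial.eq_zero_of_infinite_isRoot R
    ((Icc_infinite hx).mono fun t ht => by
      rw [Set.mem_ofPred_eq, Polynomial.IsRoot, hRev, hcon t ht, sub_self])
  have := hRev 0
  rw [hz, M.phi_zero] at this
  simp at this

theorem IsMixture.exists_force_ne_zero (hη : 0 < η) {x x' A m : ℝ} (hx : x < x')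
    (hpos : ∀ t ∈ Icc x x', η ≤ A - m * t) :
    ∃ t ∈ Icc x x', force p lam η t (A - m * t) ≠ 0 := by
  obtain ⟨t, ht, hne⟩ := M.exists_phi_mul_sq_ne_one hx A m
  refine ⟨t, ht, fun h => hne ?_⟩
  have : 0 < (A - m * t) ^ 2 := pow_pos (hη.trans_le (hpos t ht)) 2
  rw [force_of_le (hpos t ht), sub_eq_zero, eq_div_iff this.ne'] at h
  exact h

/-- If the total force along a line is nonnegative, then the force is positive somewhere. -/
theorem IsMixture.exists_force_pos (hη : 0 < η) {x x' A m : ℝ} (hx : x < x')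
    (hpos : ∀ t ∈ Icc x x', η ≤ A - m * t)
    (h0 : 0 ≤ ∫ t in x..x', force p lam η t (A - m * t)) :
    ∃ t ∈ Icc x x', 0 < force p lam η t (A - m * t) := by
  by_contra hcon
  push Not at hcon
  obtain ⟨t, ht, hne⟩ := M.exists_force_ne_zero hη hx hpos
  have hc := continuous_force_affine (p := p) (lam := lam) hη A m
  have := intervalIntegral.integral_pos (f := fun t => -force p lam η t (A - m * t)) hx
    hc.neg.continuousOn (fun t ht => by simpa using hcon t ⟨ht.1.le, ht.2⟩)
    ⟨t, ht, by simpa using lt_of_le_of_ne (hcon t ht) hne⟩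
  rw [intervalIntegral.integral_neg] at this
  linarith

theorem IsMixture.force_nonpos_iff_le_psi (hη : 0 < η) {t N : ℝ} (ht : 0 < t) (h : η ≤ N) :
    force p lam η t N ≤ 0 ↔ N ≤ psi p lam t := by
  have hN : 0 < N := hη.trans_le h
  have h1 := M.phi_mul_psi_sq ht
  have h2 := M.phi_pos ht
  have h3 := M.psi_pos ht
  rw [force_nonpos_iff hη h, ← h1, mul_le_mul_iff_right₀ h2, pow_le_pow_iff_left₀ hN.le h3.le two_ne_zero]

/-- Where a line rises above `ψ`, `-2ψ'` exceeds twice its steepness. -/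
theorem IsMixture.exists_kap_gt (hη : 0 < η) {z d A m : ℝ} (hz0 : 0 ≤ z) (hzd : z < d)
    (hpos : ∀ t ∈ Icc z d, η ≤ A - m * t) (hz : force p lam η z (A - m * z) ≤ 0)
    (hd : 0 < force p lam η d (A - m * d)) : ∃ u ∈ Ioo z d, 2 * m < kap p lam u := by
  have main : ∀ z, 0 < z → z < d → (∀ t ∈ Icc z d, η ≤ A - m * t) →
      force p lam η z (A - m * z) ≤ 0 → ∃ u ∈ Ioo z d, 2 * m < kap p lam u := by
    intro z hz0 hzd hpos hz
    have hder : ∀ t, 0 < t → HasDerivAt (fun t => psi p lam t - (A - m * t))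
        (-kap p lam t / 2 + m) t := fun t ht => by
      have := (M.hasDerivAt_psi ht).sub (((hasDerivAt_id t).const_mul m).const_sub A)
      exact this.congr_deriv (by simp)
    obtain ⟨u, hu, hu'⟩ := exists_hasDerivAt_eq_slope _ _ hzd
      (fun t ht => (hder t (hz0.trans_le ht.1)).continuousAt.continuousWithinAt)
      fun t ht => hder t (hz0.trans ht.1)
    refine ⟨u, hu, ?_⟩
    have h1 := (M.force_nonpos_iff_le_psi hη hz0 (hpos z ⟨le_rfl, hzd.le⟩)).1 hz
    have h2 : psi p lam d < A - m * d := by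
      by_contra h
      exact absurd ((M.force_nonpos_iff_le_psi hη (hz0.trans hzd) (hpos d ⟨hzd.le, le_rfl⟩)).2
        (not_lt.1 h)) (not_le.2 hd)
    have : (psi p lam d - (A - m * d) - (psi p lam z - (A - m * z))) / (d - z) < 0 :=
      div_neg_of_neg_of_pos (by linarith) (by linarith)
    linarith
  -- `ξ''(0) = 0`, so `ψ` is of no use at `0`; but the force is strictly negative there, hence also
  -- slightly to the right, where the argument can start.
  rcases hz0.eq_or_lt with rfl | hz0
  · have hneg : force p lam η 0 (A - m * 0) < 0 := by
      have : 0 < max (A - m * 0) η := hη.trans_le (le_max_right _ _)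
      rw [force, M.phi_zero, zero_sub, neg_lt_zero]
      positivity
    have hev : ∀ᶠ t in 𝓝[>] (0 : ℝ), force p lam η t (A - m * t) < 0 :=
      ((continuous_force_affine hη A m).tendsto 0).mono_left nhdsWithin_le_nhds |>.eventually
        (gt_mem_nhds hneg)
    obtain ⟨z', h1, h2⟩ := (hev.and (Ioo_mem_nhdsGT hzd)).exists
    obtain ⟨u, hu, hu'⟩ := main z' h2.1 h2.2 (fun t ht => hpos t ⟨h2.1.le.trans ht.1, ht.2⟩) h1.le
    exact ⟨u, ⟨h2.1.trans hu.1, hu.2⟩, hu'⟩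
  · exact main z hz0 hzd hpos hz

theorem IsMixture.exists_kap_lt (hη : 0 < η) {z d A m : ℝ} (hd0 : 0 < d) (hdz : d < z)
    (hpos : ∀ t ∈ Icc d z, η ≤ A - m * t) (hz : force p lam η z (A - m * z) ≤ 0)
    (hd : 0 < force p lam η d (A - m * d)) : ∃ u ∈ Ioo d z, kap p lam u < 2 * m := by
  have hder : ∀ t, 0 < t → HasDerivAt (fun t => psi p lam t - (A - m * t))
      (-kap p lam t / 2 + m) t := fun t ht => by
    have := (M.hasDerivAt_psi ht).sub (((hasDerivAt_id t).const_mul m).const_sub A)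
    exact this.congr_deriv (by simp)
  obtain ⟨u, hu, hu'⟩ := exists_hasDerivAt_eq_slope _ _ hdz
    (fun t ht => (hder t (hd0.trans_le ht.1)).continuousAt.continuousWithinAt)
    fun t ht => hder t (hd0.trans ht.1)
  refine ⟨u, hu, ?_⟩
  have h1 := (M.force_nonpos_iff_le_psi hη (hd0.trans hdz) (hpos z ⟨hdz.le, le_rfl⟩)).1 hz
  have h2 : psi p lam d < A - m * d := by
    by_contra h
    exact absurd ((M.force_nonpos_iff_le_psi hη hd0 (hpos d ⟨le_rfl, hdz.le⟩)).2
      (not_lt.1 h)) (not_le.2 hd)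
  have : 0 < (psi p lam z - (A - m * z) - (psi p lam d - (A - m * d))) / (z - d) :=
    div_pos (by linarith) (by linarith)
  linarith

end

/-- If a line of the box lies above two lines with the same product of end values, then so does
its product of end values. -/
theorem mul_le_mul_of_seg_le {x x' l u l' u' a b t : ℝ} (hx : x < x') (hl : 0 < l) (hl' : 0 < l')
    (ha : a ∈ Icc l u) (hb : b ∈ Icc l' u') (heq : l * u' = u * l') (ht : t ∈ Icc x x')
    (h1 : seg x x' l u' t ≤ seg x x' a b t) (h2 : seg x x' u l' t ≤ seg x x' a b t) :
    l * u' ≤ a * b := by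
  have hL : 0 < x' - x := sub_pos.2 hx
  unfold seg at h1 h2
  rw [div_le_div_iff_of_pos_right hL] at h1 h2
  have hw := sub_nonneg.2 ht.2
  have hw' := sub_nonneg.2 ht.1
  rcases hw.eq_or_lt with h0 | hw
  · have hbu : u' ≤ b := by
      have : 0 < t - x := by linarith
      rw [← h0] at h1
      nlinarith
    exact mul_le_mul ha.1 hbu (by nlinarith [hb.1, hb.2]) (by linarith [ha.1])
  rcases hw'.eq_or_lt with h0 | hw'
  · have hau : u ≤ a := by
      have : 0 < x' - t := by linarith
      rw [← h0] at h2
      nlinarith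
    rw [heq]
    exact mul_le_mul hau hb.1 hl'.le (by linarith [ha.1])
  -- Multiplying the two comparisons eliminates `t`. The outcome is that `(a, b)` lies on or above
  -- the chord joining `(l, u')` and `(u, l')`, two points of one hyperbola. Inside the rectangle
  -- the chord is above the hyperbola.
  have h3 : (u' - b) * (t - x) ≤ (a - l) * (x' - t) := by linarith
  have h4 : (u - a) * (x' - t) ≤ (b - l') * (t - x) := by linarith
  have h5 : (u' - b) * (u - a) ≤ (a - l) * (b - l') := by
    have := mul_le_mul h3 h4 (mul_nonneg (by linarith [ha.2]) hw.le)
      (mul_nonneg (by linarith [ha.1]) hw.le)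
    have hp := mul_pos hw hw'
    nlinarith
  rcases (ha.1.trans ha.2).eq_or_lt with h0 | hlu
  · have : u' = l' := by
      rw [← h0] at heq; exact mul_left_cancel₀ hl.ne' heq
    rw [this]
    exact mul_le_mul ha.1 hb.1 hl'.le (by linarith [ha.1])
  · have h6 : 0 ≤ (u - l) * (a * l' + b * l - l' * (u + l)) := by
      have e : (u - l) * (a * l' + b * l - l' * (u + l)) =
          l * (a * (u' - l') + b * (u - l) - (u * u' - l * l')) := by
        linear_combination (-a + u) * heq
      rw [e]
      exact mul_nonneg hl.le (by linarith)
    have h7 := nonneg_of_mul_nonneg_right h6 (sub_pos.2 hlu)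
    nlinarith [mul_nonneg (sub_nonneg.2 ha.1) (sub_nonneg.2 hb.1)]

section
variable {n : ℕ} {p : Fin n → ℕ} {lam : Fin n → ℝ} {η : ℝ}

theorem IsMixture.exists_force_seg_pos (M : IsMixture p lam) (hη : 0 < η) {x x' a b : ℝ}
    (hx : x < x') (ha : η ≤ a) (hb : η ≤ b)
    (h0 : 0 ≤ ∫ t in x..x', force p lam η t (seg x x' a b t)) :
    ∃ t ∈ Icc x x', 0 < force p lam η t (seg x x' a b t) := by
  simp_rw [seg_eq_affine hx] at h0 ⊢
  exact M.exists_force_pos hη hx (fun t ht => by rw [← seg_eq_affine hx]; exact le_seg hx ha hb ht)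
    h0

theorem IsMixture.exists_kap_gt_seg (M : IsMixture p lam) (hη : 0 < η) {x x' a b z d : ℝ}
    (hx : x < x') (ha : η ≤ a) (hb : η ≤ b) (hz0 : 0 ≤ z) (hxz : x ≤ z) (hzd : z < d) (hd' : d ≤ x')
    (hz : force p lam η z (seg x x' a b z) ≤ 0) (hd : 0 < force p lam η d (seg x x' a b d)) :
    ∃ u ∈ Ioo z d, 2 * steep x x' a b < kap p lam u := by
  rw [seg_eq_affine hx] at hz hd
  exact M.exists_kap_gt hη hz0 hzd (fun t ht => by
    rw [← seg_eq_affine hx]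
    exact le_seg hx ha hb ⟨hxz.trans ht.1, ht.2.trans hd'⟩) hz hd

theorem IsMixture.exists_kap_lt_seg (M : IsMixture p lam) (hη : 0 < η) {x x' a b z d : ℝ}
    (hx : x < x') (ha : η ≤ a) (hb : η ≤ b) (hd0 : 0 < d) (hxd : x ≤ d) (hdz : d < z) (hz' : z ≤ x')
    (hz : force p lam η z (seg x x' a b z) ≤ 0) (hd : 0 < force p lam η d (seg x x' a b d)) :
    ∃ u ∈ Ioo d z, kap p lam u < 2 * steep x x' a b := by
  rw [seg_eq_affine hx] at hz hd
  exact M.exists_kap_lt hη hd0 hdz (fun t ht => by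
    rw [← seg_eq_affine hx]
    exact le_seg hx ha hb ⟨hxd.trans ht.1, ht.2.trans hz'⟩) hz hd

theorem force_end_nonpos (hη : 0 < η) {x N U : ℝ} (hx : 0 ≤ phi p lam x) (hN : η ≤ N)
    (hNU : N ≤ U) (h : phi p lam x * U ^ 2 ≤ 1) : force p lam η x N ≤ 0 := by
  rw [force_nonpos_iff hη hN]
  refine le_trans ?_ h
  gcongr
  exact hη.le.trans hN

/-- A strict dip of a line between two nodes where it is below `ψ`. -/
theorem IsMixture.exists_kap_pair (M : IsMixture p lam) (hη : 0 < η) {x x' a b d : ℝ}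
    (hx0 : 0 ≤ x) (hx : x < x') (ha : η ≤ a) (hb : η ≤ b) (h1 : force p lam η x a ≤ 0)
    (h2 : force p lam η x' b ≤ 0) (hdI : d ∈ Icc x x')
    (hd : 0 < force p lam η d (seg x x' a b d)) :
    ∃ u v, x < u ∧ u < v ∧ v < x' ∧ kap p lam v < 2 * steep x x' a b ∧
      2 * steep x x' a b < kap p lam u := by
  have e1 : force p lam η x (seg x x' a b x) ≤ 0 := by rwa [seg_left hx]
  have e2 : force p lam η x' (seg x x' a b x') ≤ 0 := by rwa [seg_right hx]
  have hxd : x < d := lt_of_le_of_ne hdI.1 fun h => by rw [← h] at hd; linarith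
  have hdx : d < x' := lt_of_le_of_ne hdI.2 fun h => by rw [h] at hd; linarith
  obtain ⟨u, hu, hu'⟩ := M.exists_kap_gt_seg hη hx ha hb hx0 le_rfl hxd hdI.2 e1 hd
  obtain ⟨v, hv, hv'⟩ := M.exists_kap_lt_seg hη hx ha hb (hx0.trans_lt hxd) hdI.1 hdx le_rfl e2 hd
  exact ⟨u, v, hu.1, hu.2.trans hv.1, hv.2, hv', hu'⟩

end

/-! ### The single dip property, and the box as a trap -/

section
variable {k : ℕ} {p : Fin (k + 1) → ℕ} {lam : Fin (k + 1) → ℝ} {η : ℝ} {X lo up : ℕ → ℝ}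

/-- A line of the box dips below `ψ` at most once. -/
theorem IsMixture.ordConnected_force_pos (M : IsMixture p lam) (hη : 0 < η) (hX0 : 0 ≤ X 0)
    (hX : ∀ j ≤ k, X j < X (j + 1)) (hle : ∀ l, lo l ≤ up l) (hlo : ∀ l, η ≤ lo l)
    (hnode : ∀ l ≤ k + 1, phi p lam (X l) * up l ^ 2 ≤ 1)
    (bal₁ : ∀ j ≤ k, ∫ t in X j..X (j + 1),
      force p lam η t (seg (X j) (X (j + 1)) (lo j) (up (j + 1)) t) = 0)
    (bal₂ : ∀ j ≤ k, ∫ t in X j..X (j + 1),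
      force p lam η t (seg (X j) (X (j + 1)) (up j) (lo (j + 1)) t) = 0)
    (conc : ∀ j < k, steep (X j) (X (j + 1)) (up j) (lo (j + 1)) ≤
      steep (X (j + 1)) (X (j + 2)) (lo (j + 1)) (up (j + 2)))
    {j : ℕ} (hj : j ≤ k) {a b : ℝ} (ha : a ∈ Icc (lo j) (up j))
    (hb : b ∈ Icc (lo (j + 1)) (up (j + 1))) :
    OrdConnected {t | t ∈ Icc (X j) (X (j + 1)) ∧
      0 < force p lam η t (seg (X j) (X (j + 1)) a b t)} := by
  have hXn : ∀ l ≤ k + 1, 0 ≤ X l := by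
    intro l
    induction l with
    | zero => intro _; exact hX0
    | succ l ih => intro hl; exact (ih (by omega)).trans (hX l (by omega)).le
  have hφ : ∀ l ≤ k + 1, 0 ≤ phi p lam (X l) := fun l hl => M.phi_nonneg (hXn l hl)
  have hend : ∀ l ≤ k + 1, ∀ N, η ≤ N → N ≤ up l → force p lam η (X l) N ≤ 0 := fun l hl N h1 h2 =>
    force_end_nonpos hη (hφ l hl) h1 h2 (hnode l hl)
  have hup : ∀ l, η ≤ up l := fun l => (hlo l).trans (hle l)
  have haη := (hlo j).trans ha.1
  have hbη := (hlo (j + 1)).trans hb.1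
  constructor
  intro t₁ ht₁ t₃ ht₃ t₂ ht₂
  have ht₂I : t₂ ∈ Icc (X j) (X (j + 1)) := ⟨ht₁.1.1.trans ht₂.1, ht₂.2.trans ht₃.1.2⟩
  refine ⟨ht₂I, ?_⟩
  by_contra hneg
  rw [not_lt] at hneg
  have h12 : t₁ < t₂ := lt_of_le_of_ne ht₂.1 fun h => by
    rw [← h] at hneg; exact absurd ht₁.2 (not_lt.2 hneg)
  have h23 : t₂ < t₃ := lt_of_le_of_ne ht₂.2 fun h => by
    rw [h] at hneg; exact absurd ht₃.2 (not_lt.2 hneg)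
  have hL := hX j hj
  have e1 : force p lam η (X j) (seg (X j) (X (j + 1)) a b (X j)) ≤ 0 := by
    rw [seg_left hL]; exact hend j (by omega) a haη ha.2
  have e2 : force p lam η (X (j + 1)) (seg (X j) (X (j + 1)) a b (X (j + 1))) ≤ 0 := by
    rw [seg_right hL]; exact hend (j + 1) (by omega) b hbη hb.2
  have hX1 : X j < t₁ := lt_of_le_of_ne ht₁.1.1 fun h => by
    have := ht₁.2; rw [← h] at this; exact absurd this (not_lt.2 e1)
  have h3X : t₃ < X (j + 1) := lt_of_le_of_ne ht₃.1.2 fun h => by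
    have := ht₃.2; rw [h] at this; exact absurd this (not_lt.2 e2)
  have hj0 := hXn j (by omega)
  obtain ⟨u, hu, hu'⟩ := M.exists_kap_gt_seg hη hL haη hbη hj0 le_rfl hX1 ht₁.1.2 e1 ht₁.2
  obtain ⟨v, hv, hv'⟩ := M.exists_kap_lt_seg hη hL haη hbη (hj0.trans_lt hX1) hX1.le h12 ht₂I.2
    hneg ht₁.2
  obtain ⟨u', hu₁, hu₁'⟩ := M.exists_kap_gt_seg hη hL haη hbη (hj0.trans ht₂I.1) ht₂I.1 h23
    ht₃.1.2 hneg ht₃.2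
  obtain ⟨v', hv₁, hv₁'⟩ := M.exists_kap_lt_seg hη hL haη hbη (hj0.trans_lt (hX1.trans (h12.trans h23)))
    ht₃.1.1 h3X le_rfl e2 ht₃.2
  -- To the left of cell `j` the lines from `up` to `lo` are used and to its right those from `lo`
  -- to `up`, so that `conc` keeps the slopes increasing. Each is balanced, hence exceeds `ψ`
  -- somewhere and gives a fall of `kap` through twice its slope. Two excursions in cell `j` make `k
  -- + 2` falls.
  set s : ℕ → ℝ := fun i => if i < j then steep (X i) (X (i + 1)) (up i) (lo (i + 1)) else
    if i = j then steep (X i) (X (i + 1)) a b else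
      steep (X i) (X (i + 1)) (lo i) (up (i + 1)) with hs
  have hsj : s j = steep (X j) (X (j + 1)) a b := by simp [hs]
  have s1 : ∀ i ≤ k, steep (X i) (X (i + 1)) (lo i) (up (i + 1)) ≤
      steep (X i) (X (i + 1)) (up i) (lo (i + 1)) := fun i hi =>
    div_le_div_of_nonneg_right (by linarith [hle i, hle (i + 1)]) (sub_nonneg.2 (hX i hi).le)
  have s2 : steep (X j) (X (j + 1)) (lo j) (up (j + 1)) ≤ steep (X j) (X (j + 1)) a b :=
    div_le_div_of_nonneg_right (by linarith [ha.1, hb.2]) (sub_nonneg.2 hL.le)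
  have s3 : steep (X j) (X (j + 1)) a b ≤ steep (X j) (X (j + 1)) (up j) (lo (j + 1)) :=
    div_le_div_of_nonneg_right (by linarith [ha.2, hb.1]) (sub_nonneg.2 hL.le)
  have smono : ∀ i < k, s i ≤ s (i + 1) := by
    intro i hi
    have hc := conc i hi
    rcases lt_trichotomy i j with h | h | h
    · rcases Nat.lt_or_ge (i + 1) j with h' | h'
      · simp only [hs, if_pos h, if_pos h']
        exact hc.trans (s1 (i + 1) hi)
      · have : i + 1 = j := le_antisymm h h'
        subst this
        simp only [hs, if_pos h, lt_irrefl, if_false, if_true]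
        exact hc.trans s2
    · subst h
      simp only [hs, lt_irrefl, if_false, if_true, if_neg (Nat.not_lt.2 (Nat.le_succ i)),
        if_neg (Nat.succ_ne_self i)]
      exact s3.trans hc
    · simp only [hs, if_neg (Nat.not_lt.2 h.le), if_neg h.ne',
        if_neg (Nat.not_lt.2 (h.le.trans (Nat.le_succ i))), if_neg (h.trans (Nat.lt_succ_self i)).ne']
      exact (s1 i hi.le).trans hc
  have pairs : ∀ i, ∃ u v, i ≤ k → i ≠ j → X i < u ∧ u < v ∧ v < X (i + 1) ∧
      kap p lam v < 2 * s i ∧ 2 * s i < kap p lam u := by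
    intro i
    by_cases hi : i ≤ k ∧ i ≠ j
    · obtain ⟨hi, hij⟩ := hi
      have hi0 := hXn i (by omega)
      rcases lt_or_gt_of_ne hij with h | h
      · obtain ⟨d, hd, hd'⟩ := M.exists_force_seg_pos hη (hX i hi) (hup i) (hlo (i + 1)) (bal₂ i hi).ge
        obtain ⟨u, v, huv⟩ := M.exists_kap_pair hη hi0 (hX i hi) (hup i) (hlo (i + 1))
          (hend i (by omega) _ (hup i) le_rfl) (hend (i + 1) (by omega) _ (hlo _) (hle _)) hd hd'
        refine ⟨u, v, fun _ _ => ?_⟩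
        simpa only [hs, if_pos h] using huv
      · obtain ⟨d, hd, hd'⟩ := M.exists_force_seg_pos hη (hX i hi) (hlo i) (hup (i + 1)) (bal₁ i hi).ge
        obtain ⟨u, v, huv⟩ := M.exists_kap_pair hη hi0 (hX i hi) (hlo i) (hup (i + 1))
          (hend i (by omega) _ (hlo i) (hle i)) (hend (i + 1) (by omega) _ (hup _) le_rfl) hd hd'
        refine ⟨u, v, fun _ _ => ?_⟩
        simpa only [hs, if_neg (Nat.not_lt.2 h.le), if_neg h.ne'] using huv
    · exact ⟨0, 0, fun h1 h2 => absurd ⟨h1, h2⟩ hi⟩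
  choose uu vv huv using pairs
  -- cell of the `i`-th zigzag
  set cell : ℕ → ℕ := fun i => if i ≤ j then i else i - 1 with hcell
  set U : ℕ → ℝ := fun i => if i = j then u else if i = j + 1 then u' else uu (cell i) with hU
  set V : ℕ → ℝ := fun i => if i = j then v else if i = j + 1 then v' else vv (cell i) with hV
  have hUV : ∀ i ≤ k + 1, X (cell i) < U i ∧ U i < V i ∧ V i < X (cell i + 1) ∧
      kap p lam (V i) < 2 * s (cell i) ∧ 2 * s (cell i) < kap p lam (U i) := by
    intro i hi
    rcases eq_or_ne i j with rfl | h1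
    · have : cell i = i := by simp [hcell]
      simp only [hU, hV, if_true, this, hsj]
      exact ⟨hu.1, hu.2.trans hv.1, hv.2.trans (h23.trans h3X), hv', hu'⟩
    rcases eq_or_ne i (j + 1) with rfl | h2
    · have : cell (j + 1) = j := by simp [hcell]
      simp only [hU, hV, if_neg h1, if_true, this, hsj]
      exact ⟨hX1.trans (h12.trans hu₁.1), hu₁.2.trans hv₁.1, hv₁.2, hv₁', hu₁'⟩
    · simp only [hU, hV, if_neg h1, if_neg h2]
      have hc1 : cell i ≤ k := by simp only [hcell]; split_ifs <;> omega
      have hc2 : cell i ≠ j := by simp only [hcell]; split_ifs <;> omega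
      exact huv (cell i) hc1 hc2
  refine M.not_zigzag U V ?_ (fun i hi => ?_) fun i hi => ?_
  · exact hX0.trans_lt (by simpa [hcell] using (hUV 0 (Nat.zero_le _)).1)
  · obtain ⟨-, h1, -, h2, h3⟩ := hUV i hi
    exact ⟨h1, h2.trans h3⟩
  · obtain ⟨-, -, a3, a4, a5⟩ := hUV i hi.le
    obtain ⟨b1, -, -, b4, b5⟩ := hUV (i + 1) hi
    rcases eq_or_ne i j with rfl | h1
    · have e : cell (i + 1) = i := by simp [hcell]
      have e' : cell i = i := by simp [hcell]
      have e3 : V i = v := by simp [hV]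
      have e4 : U (i + 1) = u' := by simp [hU]
      rw [e3, e4]
      rw [hsj] at *
      exact ⟨hv.2.trans hu₁.1, hv'.trans hu₁'⟩
    · have e : cell (i + 1) = cell i + 1 := by simp only [hcell]; split_ifs <;> omega
      have e' : cell i < k := by simp only [hcell]; split_ifs <;> omega
      rw [e] at b1 b5
      exact ⟨a3.trans b1, a4.trans_le ((mul_le_mul_of_nonneg_left (smono _ e') two_pos.le).trans
        b5.le)⟩

/-- The conditions under which the box is a trap for the mixture. -/
theorem IsMixture.isTrap (M : IsMixture p lam) (hη : 0 < η) (hX0 : 0 ≤ X 0)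
    (hX : ∀ j ≤ k, X j < X (j + 1)) (hle : ∀ l, lo l ≤ up l) (hlo : ∀ l, η ≤ lo l)
    (hnode : ∀ l ≤ k + 1, phi p lam (X l) * up l ^ 2 ≤ 1)
    (bal₁ : ∀ j ≤ k, ∫ t in X j..X (j + 1),
      force p lam η t (seg (X j) (X (j + 1)) (lo j) (up (j + 1)) t) = 0)
    (bal₂ : ∀ j ≤ k, ∫ t in X j..X (j + 1),
      force p lam η t (seg (X j) (X (j + 1)) (up j) (lo (j + 1)) t) = 0)
    (mom₁ : ∀ j ≤ k, ∫ t in X j..X (j + 1),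
      force p lam η t (seg (X j) (X (j + 1)) (lo j) (up (j + 1)) t) * (X (j + 1) - t) ≤ 0)
    (mom₂ : ∀ j ≤ k, 0 ≤ ∫ t in X j..X (j + 1),
      force p lam η t (seg (X j) (X (j + 1)) (up j) (lo (j + 1)) t) * (X (j + 1) - t))
    (conc : ∀ j < k, steep (X j) (X (j + 1)) (up j) (lo (j + 1)) ≤
      steep (X (j + 1)) (X (j + 2)) (lo (j + 1)) (up (j + 2))) :
    IsTrap k (force p lam η) X lo up where
  cont := continuous_force hη
  mono := force_mono hη
  lt := hX
  le := hle
  bal₁ := bal₁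
  bal₂ := bal₂
  mom₁ := mom₁
  mom₂ := mom₂
  conc := conc
  dip j hj a ha b hb := M.ordConnected_force_pos hη hX0 hX hle hlo hnode bal₁ bal₂ conc hj ha hb
  pos j hj a ha b hb t₀ ht₀ h1 h2 := by
    have hup : ∀ l, η ≤ up l := fun l => (hlo l).trans (hle l)
    have hL := hX j hj
    -- Both reference lines are balanced, so their products of end values agree. A line above both
    -- at one point has at least this product, hence nonnegative total force.
    have b1 := (integral_force_seg_eq_zero_iff hη hL (hlo j) (hup (j + 1))).1 (bal₁ j hj)
    have b2 := (integral_force_seg_eq_zero_iff hη hL (hup j) (hlo (j + 1))).1 (bal₂ j hj)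
    have hD : deriv (mixture p lam) (X (j + 1)) - deriv (mixture p lam) (X j) ≠ 0 := by
      intro h
      rw [h, mul_zero] at b1
      linarith
    have heq := mul_right_cancel₀ hD (b1.trans b2.symm)
    have haη := (hlo j).trans ha.1
    have hbη := (hlo (j + 1)).trans hb.1
    have hmul := mul_le_mul_of_seg_le hL (hη.trans_le (hlo j)) (hη.trans_le (hlo (j + 1))) ha hb heq
      ht₀ h1 h2
    refine M.exists_force_seg_pos hη hL haη hbη ?_
    rw [integral_force_seg hη hL haη hbη, ← (integral_force_seg hη hL (hlo j) (hup (j + 1))).symm.trans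
      (bal₁ j hj)]
    have hc : 0 < lo j * up (j + 1) := mul_pos (hη.trans_le (hlo j)) (hη.trans_le (hup (j + 1)))
    have := div_le_div_of_nonneg_left (sub_pos.2 hL).le hc hmul
    linarith

end

/-! ### The functions defining `𝓗` in terms of end values of lines -/

/-- The reciprocal of the slope of a chord of `ξ'`. -/
def invSlope (ξ : ℝ → ℝ) (a b : ℝ) : ℝ := (b - a) / (deriv ξ b - deriv ξ a)

theorem invSlope_comm (ξ : ℝ → ℝ) (a b : ℝ) : invSlope ξ a b = invSlope ξ b a := by
  rw [invSlope, invSlope, ← neg_div_neg_eq, neg_sub, neg_sub]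

theorem r₁_eq (ξ : ℝ → ℝ) (x y z : ℝ) : r₁ ξ x y z = invSlope ξ x z / invSlope ξ y z := by
  rw [r₁, invSlope, invSlope, div_div_div_eq, mul_comm (z - x), mul_comm (z - y)]

theorem r₂_eq (ξ : ℝ → ℝ) (x y : ℝ) : r₂ ξ x y = deriv (deriv ξ) y * invSlope ξ x y := by
  rw [r₂, invSlope, mul_div_assoc]

/-- `(x_l - x_{l-1}) / (ξ'(x_l) - ξ'(x_{l-1}))`. -/
def cellInv (ξ : ℝ → ℝ) (x : ℕ → ℝ) (l : ℕ) : ℝ := invSlope ξ (x (l - 1)) (x l)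

theorem rr_eq (ξ : ℝ → ℝ) (x : ℕ → ℝ) (l : ℕ) :
    rr ξ x l = cellInv ξ x l / cellInv ξ x (l + 1) := by
  rw [rr, r₁_eq, cellInv, cellInv, Nat.add_sub_cancel, invSlope_comm ξ (x (l + 1))]

/-- Squares of end values, from the right: `E 0 = c n` and `E d * E (d + 1) = c (n - d) ^ 2`. -/
def endSq (c : ℕ → ℝ) (n : ℕ) : ℕ → ℝ
  | 0 => c n
  | d + 1 => c (n - d) ^ 2 / endSq c n d

theorem endSq_pos {c : ℕ → ℝ} {n : ℕ} (hc : ∀ l, 1 ≤ l → l ≤ n → 0 < c l) (hn : 1 ≤ n) :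
    ∀ d ≤ n, 0 < endSq c n d := by
  intro d
  induction d with
  | zero => intro _; exact hc n hn le_rfl
  | succ d ih =>
    intro hd
    exact div_pos (pow_pos (hc _ (by omega) (by omega)) 2) (ih (by omega))

/-- The products in the definitions of `𝓕` and `𝓐`. -/
def rrProd (ξ : ℝ → ℝ) (s : ℕ) (x : ℕ → ℝ) (m : ℕ) : ℝ :=
  ∏ i ∈ Finset.Icc 1 m, rr ξ x (s + 1 - 2 * i) / rr ξ x (s - 2 * i)

section
variable {ξ : ℝ → ℝ} {n : ℕ} {x : ℕ → ℝ}

/-- Two steps of the recursion contribute quotients of `cellInv`, which regroup into one factor of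
the product of `𝐫`'s. This product multiplies the squares at even distance from the last node and
divides those at odd distance; hence the alternating exponents in `𝓕` and `𝓐`. -/
theorem endSq_eq (hc : ∀ l, 1 ≤ l → l ≤ n → 0 < cellInv ξ x l) (m : ℕ) (hm : 2 * m + 1 ≤ n) :
    0 < rrProd ξ n x m ∧
    endSq (cellInv ξ x) n (2 * m) = cellInv ξ x (n - 2 * m) * rrProd ξ n x m ∧
      endSq (cellInv ξ x) n (2 * m + 1) = cellInv ξ x (n - 2 * m) / rrProd ξ n x m := by
  have step : ∀ P : ℝ, 0 < P → ∀ m, 2 * m + 1 ≤ n →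
      endSq (cellInv ξ x) n (2 * m) = cellInv ξ x (n - 2 * m) * P →
      endSq (cellInv ξ x) n (2 * m + 1) = cellInv ξ x (n - 2 * m) / P := by
    intro P hP m hm h
    have := hc (n - 2 * m) (by omega) (by omega)
    rw [endSq, h]
    field_simp
  induction m with
  | zero =>
    have h0 : rrProd ξ n x 0 = 1 := by simp [rrProd]
    refine ⟨by rw [h0]; exact one_pos, by rw [h0]; simp [endSq], ?_⟩
    exact step _ (by rw [h0]; exact one_pos) 0 hm (by rw [h0]; simp [endSq])
  | succ m ih =>
    obtain ⟨i1, -, i3⟩ := ih (by omega)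
    have c1 := hc (n - 2 * m) (by omega) (by omega)
    have c2 := hc (n - 2 * m - 1) (by omega) (by omega)
    have c3 := hc (n - 2 * m - 2) (by omega) (by omega)
    have hprod : rrProd ξ n x (m + 1) = rrProd ξ n x m *
        (cellInv ξ x (n - 2 * m - 1) ^ 2 /
          (cellInv ξ x (n - 2 * m) * cellInv ξ x (n - 2 * m - 2))) := by
      rw [rrProd, Finset.prod_Icc_succ_top (by omega), ← rrProd, rr_eq, rr_eq,
        show n + 1 - 2 * (m + 1) = n - 2 * m - 1 by omega,
        show n - 2 * (m + 1) = n - 2 * m - 2 by omega,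
        show n - 2 * m - 1 + 1 = n - 2 * m by omega,
        show n - 2 * m - 2 + 1 = n - 2 * m - 1 by omega]
      field_simp
    have hpos : 0 < rrProd ξ n x (m + 1) := by rw [hprod]; positivity
    have h2 : endSq (cellInv ξ x) n (2 * (m + 1)) =
        cellInv ξ x (n - 2 * (m + 1)) * rrProd ξ n x (m + 1) := by
      rw [show 2 * (m + 1) = (2 * m + 1) + 1 by ring, endSq, i3, hprod,
        show n - (2 * m + 1) = n - 2 * m - 1 by omega,
        show n - (2 * m + 1 + 1) = n - 2 * m - 2 by omega]
      field_simp
    exact ⟨hpos, h2, step _ hpos (m + 1) hm h2⟩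

theorem prod_zpow_even (s : ℕ) {d : ℕ} (hd : Even d) (m : ℕ) :
    ∏ i ∈ Finset.Icc 1 m, (rr ξ x (s + 1 - 2 * i) / rr ξ x (s - 2 * i)) ^ ((-1 : ℤ) ^ d) =
      rrProd ξ s x m := by
  simp [rrProd, hd.neg_one_pow]

theorem prod_zpow_odd (s : ℕ) {d : ℕ} (hd : Odd d) (m : ℕ) :
    ∏ i ∈ Finset.Icc 1 m, (rr ξ x (s + 1 - 2 * i) / rr ξ x (s - 2 * i)) ^ ((-1 : ℤ) ^ d) =
      (rrProd ξ s x m)⁻¹ := by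
  simp only [rrProd, hd.neg_one_pow, zpow_neg, zpow_one, Finset.prod_inv_distrib]

theorem prod_zpow_swap (s d m : ℕ) :
    ∏ i ∈ Finset.Icc 1 m, (rr ξ x (s - 2 * i) / rr ξ x (s + 1 - 2 * i)) ^ ((-1 : ℤ) ^ d) =
      (∏ i ∈ Finset.Icc 1 m, (rr ξ x (s + 1 - 2 * i) / rr ξ x (s - 2 * i)) ^ ((-1 : ℤ) ^ d))⁻¹ := by
  rw [← Finset.prod_inv_distrib]
  refine Finset.prod_congr rfl fun i _ => ?_
  rw [← inv_zpow, inv_div]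

/-- `𝓕_l` is `ξ''(x_l)` times the squared value at the node of the polygon with parameter `1`;
comparing it with `w` or `1/w` compares polygon and `ψ`. -/
theorem calF_eq (hc : ∀ l, 1 ≤ l → l ≤ n → 0 < cellInv ξ x l) {l : ℕ} (hl : 1 ≤ l) (hln : l ≤ n) :
    calF ξ n x l = deriv (deriv ξ) (x l) * endSq (cellInv ξ x) n (n - l) := by
  rw [calF, if_neg (by rintro ⟨h, -⟩; omega)]
  rcases Nat.even_or_odd (n - l) with h | h
  · obtain ⟨m, hm⟩ := id h
    rw [prod_zpow_even n h, if_pos h, show (n - l) / 2 = m by omega, r₂_eq,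
      show n - l = 2 * m by omega, (endSq_eq hc m (by omega)).2.1,
      show n - 2 * m = l by omega, cellInv, mul_assoc]
  · obtain ⟨m, hm⟩ := id h
    rw [prod_zpow_odd n h, if_neg (Nat.not_even_iff_odd.2 h), show (n - l) / 2 = m by omega, r₂_eq,
      show n - l = 2 * m + 1 by omega, (endSq_eq hc m (by omega)).2.2,
      show n - 2 * m = l + 1 by omega, cellInv, Nat.add_sub_cancel, invSlope_comm, div_eq_mul_inv,
      mul_assoc]

theorem calF_zero (h0 : deriv (deriv ξ) (x 0) = 0) : calF ξ n x 0 = 0 := by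
  rw [calF]
  split_ifs <;> simp [r₂_eq, h0]

/-- `𝓐_l` is the least squared value at the node for which the two adjacent balanced lines form a
concave angle, divided by the squared value for parameter `1`. -/
theorem calA_eq (hc : ∀ l, 1 ≤ l → l ≤ n → 0 < cellInv ξ x l) {l : ℕ} (hl : 1 ≤ l) (hln : l < n) :
    calA ξ n x l = cellInv ξ x l * cellInv ξ x (l + 1) /
      (invSlope ξ (x (l - 1)) (x (l + 1)) * endSq (cellInv ξ x) n (n - l)) := by
  have c1 := hc l hl hln.le
  have c2 := hc (l + 1) (by omega) hln
  rw [calA, prod_zpow_swap]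
  rcases Nat.even_or_odd (n - l) with h | h
  · obtain ⟨m, hm⟩ := id h
    obtain ⟨hP, e1, -⟩ := endSq_eq hc m (by omega)
    rw [prod_zpow_even n h, if_pos h, if_pos h, show (n - l) / 2 = m by omega, r₁_eq,
      show n - l = 2 * m by omega, e1, show n - 2 * m = l by omega, ← div_eq_mul_inv,
      show invSlope ξ (x l) (x (l + 1)) = cellInv ξ x (l + 1) by rw [cellInv, Nat.add_sub_cancel]]
    rcases eq_or_ne (invSlope ξ (x (l - 1)) (x (l + 1))) 0 with h0 | h0
    · simp [h0]
    · field_simp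
  · obtain ⟨m, hm⟩ := id h
    obtain ⟨hP, -, e1⟩ := endSq_eq hc m (by omega)
    have h' := Nat.not_even_iff_odd.2 h
    rw [prod_zpow_odd n h, if_neg h', if_neg h', show (n - l) / 2 = m by omega, r₁_eq,
      show n - l = 2 * m + 1 by omega, e1, show n - 2 * m = l + 1 by omega, inv_inv,
      invSlope_comm ξ (x l), invSlope_comm ξ (x (l + 1)),
      show invSlope ξ (x (l - 1)) (x l) = cellInv ξ x l from rfl]
    rcases eq_or_ne (invSlope ξ (x (l - 1)) (x (l + 1))) 0 with h0 | h0
    · simp [h0]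
    · field_simp

theorem finite_maxSet (P Q : ℕ → Prop) (f g : ℕ → ℝ) :
    ({v | ∃ l, l ≤ n ∧ P l ∧ v = f l} ∪ {v | ∃ l, 1 ≤ l ∧ l < n ∧ Q l ∧ v = g l}).Finite := by
  refine Finite.union ?_ ?_
  · refine ((Finset.range (n + 1)).image f).finite_toSet.subset ?_
    rintro v ⟨l, hl, -, rfl⟩
    simp only [Finset.coe_image, mem_image, Finset.coe_range, mem_Iio]
    exact ⟨l, by omega, rfl⟩
  · refine ((Finset.range (n + 1)).image g).finite_toSet.subset ?_
    rintro v ⟨l, -, hl, -, rfl⟩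
    simp only [Finset.coe_image, mem_image, Finset.coe_range, mem_Iio]
    exact ⟨l, by omega, rfl⟩

theorem calF_le_calZ {l : ℕ} (hl : l ≤ n) (h : Odd (n - l)) : calF ξ n x l ≤ calZ ξ n x :=
  le_csSup (finite_maxSet (fun l => Odd (n - l)) (fun l => Even (n - l)) _ _).bddAbove
    (Or.inl ⟨l, hl, h, rfl⟩)

theorem calA_le_calZ {l : ℕ} (hl : 1 ≤ l) (hln : l < n) (h : Even (n - l)) :
    calA ξ n x l ≤ calZ ξ n x :=
  le_csSup (finite_maxSet (fun l => Odd (n - l)) (fun l => Even (n - l)) _ _).bddAbove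
    (Or.inr ⟨l, hl, hln, h, rfl⟩)

theorem calF_le_calY {l : ℕ} (hl : l ≤ n) (h : Even (n - l)) : calF ξ n x l ≤ calY ξ n x :=
  le_csSup (finite_maxSet (fun l => Even (n - l)) (fun l => Odd (n - l)) _ _).bddAbove
    (Or.inl ⟨l, hl, h, rfl⟩)

theorem calA_le_calY {l : ℕ} (hl : 1 ≤ l) (hln : l < n) (h : Odd (n - l)) :
    calA ξ n x l ≤ calY ξ n x :=
  le_csSup (finite_maxSet (fun l => Even (n - l)) (fun l => Odd (n - l)) _ _).bddAbove
    (Or.inr ⟨l, hl, hln, h, rfl⟩)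

theorem calZ_le (hn : 1 ≤ n) {w : ℝ} (hF : ∀ l ≤ n, Odd (n - l) → calF ξ n x l ≤ w)
    (hA : ∀ l, 1 ≤ l → l < n → Even (n - l) → calA ξ n x l ≤ w) : calZ ξ n x ≤ w := by
  refine csSup_le ⟨_, Or.inl ⟨n - 1, by omega, ?_, rfl⟩⟩ ?_
  · rw [show n - (n - 1) = 1 by omega]; exact odd_one
  · rintro v (⟨l, h1, h2, rfl⟩ | ⟨l, h1, h2, h3, rfl⟩)
    · exact hF l h1 h2
    · exact hA l h1 h2 h3

theorem calY_le {w : ℝ} (hF : ∀ l ≤ n, Even (n - l) → calF ξ n x l ≤ w)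
    (hA : ∀ l, 1 ≤ l → l < n → Odd (n - l) → calA ξ n x l ≤ w) : calY ξ n x ≤ w := by
  refine csSup_le ⟨_, Or.inl ⟨n, le_rfl, by simp, rfl⟩⟩ ?_
  rintro v (⟨l, h1, h2, rfl⟩ | ⟨l, h1, h2, h3, rfl⟩)
  · exact hF l h1 h2
  · exact hA l h1 h2 h3

end

/-! ### `h` as a moment of the force along a line -/

theorem intervalIntegrable_mul {f g : ℝ → ℝ} (hf : Continuous f) (hg : Continuous g) (a b : ℝ) :
    IntervalIntegrable (fun t => f t * g t) volume a b := (hf.mul hg).intervalIntegrable _ _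

section
variable {n : ℕ} {p : Fin n → ℕ} {lam : Fin n → ℝ} {η : ℝ}

theorem integral_phi_mul_sub (x y : ℝ) : ∫ t in x..y, phi p lam t * (y - t) =
    mixture p lam y - mixture p lam x - deriv (mixture p lam) x * (y - x) := by
  have hd : ∀ t ∈ uIcc x y, HasDerivAt (fun t => deriv (mixture p lam) t * (y - t) + mixture p lam t)
      (phi p lam t * (y - t)) t := fun t _ =>
    (((hasDerivAt_deriv_mixture t).mul ((hasDerivAt_id t).const_sub y)).add
      (hasDerivAt_mixture t)).congr_deriv (by simp)
  rw [intervalIntegral.integral_eq_sub_of_hasDerivAt hd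
    ((continuous_phi.mul (by fun_prop)).intervalIntegrable _ _)]
  ring

/-- For `a ≠ b` the primitive is a logarithm plus a reciprocal of the affine function, whence the
shape of `hCoeff`; its value `-1/2` at `1` is the constant line. -/
theorem integral_sub_div_seg_sq {x y a b : ℝ} (hxy : x < y) (ha : 0 < a) (hb : 0 < b) :
    ∫ t in x..y, 1 / seg x y a b t ^ 2 * (y - t) = -((y - x) ^ 2 / (a * b) * hCoeff (a / b)) := by
  have hL := (sub_pos.2 hxy).ne'
  have hpos : ∀ t ∈ Icc x y, 0 < seg x y a b t := fun t ht =>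
    (lt_min ha hb).trans_le (le_seg hxy (min_le_left _ _) (min_le_right _ _) ht)
  rcases eq_or_ne a b with rfl | hab
  · have e : ∀ t, seg x y a a t = a := fun t => by rw [seg_eq_left hxy, steep]; simp
    simp_rw [e]
    have hd : ∀ t ∈ uIcc x y, HasDerivAt (fun t => -(1 / a ^ 2 * (y - t) ^ 2 / 2))
        (1 / a ^ 2 * (y - t)) t := fun t _ => by
      refine (((((hasDerivAt_id t).const_sub y).pow 2).const_mul (1 / a ^ 2)).div_const 2).neg.congr_deriv ?_
      simp only [id]; push_cast; ring
    rw [intervalIntegral.integral_eq_sub_of_hasDerivAt hd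
      ((by fun_prop : Continuous fun t : ℝ => 1 / a ^ 2 * (y - t)).intervalIntegrable _ _),
      div_self ha.ne', hCoeff, if_pos rfl]
    field_simp
    ring
  · set m := steep x y a b with hm
    have hm0 : m ≠ 0 := div_ne_zero (sub_ne_zero.2 hab) hL
    have hd : ∀ t ∈ uIcc x y, HasDerivAt
        (fun t => -((Real.log (b - m * (t - y)) + b / (b - m * (t - y))) / m ^ 2))
        (1 / seg x y a b t ^ 2 * (y - t)) t := by
      intro t ht
      rw [uIcc_of_le hxy.le] at ht
      have hp := hpos t ht
      rw [seg_eq_right hxy, ← hm] at hp ⊢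
      have hlin : HasDerivAt (fun t => b - m * (t - y)) (-m) t := by
        simpa using (((hasDerivAt_id t).sub_const y).const_mul m).const_sub b
      refine (((hlin.log hp.ne').add ((hasDerivAt_const t b).div hlin hp.ne')).div_const
        (m ^ 2)).neg.congr_deriv ?_
      have := hp.ne'
      field_simp
      ring
    have hc : ContinuousOn (fun t => 1 / seg x y a b t ^ 2 * (y - t)) (uIcc x y) := by
      rw [uIcc_of_le hxy.le]
      exact (continuousOn_const.div ((continuous_seg a b).pow 2).continuousOn
        fun t ht => (pow_pos (hpos t ht) 2).ne').mul (by fun_prop)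
    rw [intervalIntegral.integral_eq_sub_of_hasDerivAt hd hc.intervalIntegrable]
    have e1 : b - m * (x - y) = a := by rw [hm, steep]; field_simp; ring
    have e2 : b - m * (y - y) = b := by ring
    have hz : a / b ≠ 1 := fun h => hab ((div_eq_one_iff_eq hb.ne').1 h)
    have h3 : a - b ≠ 0 := sub_ne_zero.2 hab
    have h4 : a / b - 1 ≠ 0 := sub_ne_zero.2 hz
    have e3 : a / b - 1 = (a - b) / b := by field_simp
    rw [e1, e2, hCoeff, if_neg hz, Real.log_div ha.ne' hb.ne', hm, steep, e3]
    field_simp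
    ring

/-- The balance `hab` replaces `(y - x)²/(a b)` by `(ξ'(y) - ξ'(x))(y - x)`, so that the first
moment depends on the end values only through their quotient. -/
theorem h_eq_integral (hη : 0 < η) {x y a b : ℝ} (hxy : x < y) (ha : η ≤ a) (hb : η ≤ b)
    (hab : a * b * (deriv (mixture p lam) y - deriv (mixture p lam) x) = y - x) :
    h (mixture p lam) x y (a / b) = ∫ t in x..y, force p lam η t (seg x y a b t) * (y - t) := by
  have ha0 := hη.trans_le ha
  have hb0 := hη.trans_le hb
  have hge : ∀ t ∈ Icc x y, η ≤ seg x y a b t := fun t ht => le_seg hxy ha hb ht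
  have e : ∫ t in x..y, force p lam η t (seg x y a b t) * (y - t) =
      (∫ t in x..y, phi p lam t * (y - t)) - ∫ t in x..y, 1 / seg x y a b t ^ 2 * (y - t) := by
    rw [← intervalIntegral.integral_sub (intervalIntegrable_mul continuous_phi
      (continuous_sub_left y) _ _)]
    · refine intervalIntegral.integral_congr fun t ht => ?_
      rw [uIcc_of_le hxy.le] at ht
      simp only [force_of_le (hge t ht)]
      ring
    · refine ContinuousOn.intervalIntegrable ?_
      rw [uIcc_of_le hxy.le]
      exact (continuousOn_const.div ((continuous_seg a b).pow 2).continuousOn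
        fun t ht => (pow_pos (hη.trans_le (hge t ht)) 2).ne').mul (by fun_prop)
  rw [e, integral_phi_mul_sub, integral_sub_div_seg_sq hxy ha0 hb0, h, sub_neg_eq_add]
  congr 2
  have := ha0.ne'
  have := hb0.ne'
  rw [eq_div_iff (by positivity)]
  linear_combination (y - x) * hab

/-- Tilting a line at fixed total force: the difference of the two forces has the sign of `ts - t`,
where `ts` is the crossing of the lines. Since this difference has zero integral, the weight `y - t`
may be replaced by `ts - t`. -/
theorem integral_force_mul_sub_lt (hη : 0 < η) {x y a b a' b' : ℝ} (hxy : x < y)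
    (ha : η ≤ a) (haa : a < a') (hbb : b' < b)
    (heq : ∫ t in x..y, force p lam η t (seg x y a b t) =
      ∫ t in x..y, force p lam η t (seg x y a' b' t)) :
    ∫ t in x..y, force p lam η t (seg x y a b t) * (y - t) <
      ∫ t in x..y, force p lam η t (seg x y a' b' t) * (y - t) := by
  have hL := sub_pos.2 hxy
  have hc : ∀ a b, Continuous fun t => force p lam η t (seg x y a b t) := fun a b =>
    (continuous_force hη).comp (continuous_id.prodMk (continuous_seg a b))
  set D : ℝ → ℝ := fun t => force p lam η t (seg x y a' b' t) - force p lam η t (seg x y a b t) with hD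
  have hDc : Continuous D := (hc a' b').sub (hc a b)
  have hs : 0 < (a' - a) + (b - b') := by linarith
  set ts := ((a' - a) * y + (b - b') * x) / ((a' - a) + (b - b')) with hts
  have key : ∀ t, seg x y a' b' t - seg x y a b t =
      ((a' - a) + (b - b')) * (ts - t) / (y - x) := by
    intro t
    rw [seg, seg, hts]
    field_simp
    ring
  have hxts : x < ts := by
    rw [hts, lt_div_iff₀ hs]
    nlinarith [mul_pos (sub_pos.2 haa) hL]
  have hle : ∀ t, 0 ≤ D t * (ts - t) := by
    intro t
    rcases le_total t ts with h | h
    · have : seg x y a b t ≤ seg x y a' b' t := by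
        have := key t
        have h2 : 0 ≤ ((a' - a) + (b - b')) * (ts - t) / (y - x) :=
          div_nonneg (mul_nonneg hs.le (sub_nonneg.2 h)) hL.le
        linarith
      exact mul_nonneg (sub_nonneg.2 (force_mono hη t this)) (sub_nonneg.2 h)
    · have : seg x y a' b' t ≤ seg x y a b t := by
        have := key t
        have h2 : ((a' - a) + (b - b')) * (ts - t) / (y - x) ≤ 0 :=
          div_nonpos_of_nonpos_of_nonneg (mul_nonpos_of_nonneg_of_nonpos hs.le (sub_nonpos.2 h)) hL.le
        linarith
      exact mul_nonneg_of_nonpos_of_nonpos (sub_nonpos.2 (force_mono hη t this)) (sub_nonpos.2 h)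
  have hx0 : 0 < D x * (ts - x) := by
    refine mul_pos ?_ (sub_pos.2 hxts)
    simp only [hD, seg_left hxy]
    rw [force_of_le ha, force_of_le (ha.trans haa.le), sub_sub_sub_cancel_left, sub_pos]
    have := hη.trans_le ha
    gcongr
  have hint := intervalIntegral.integral_pos (f := fun t => D t * (ts - t)) hxy
    (hDc.mul (continuous_sub_left ts)).continuousOn
    (fun t _ => hle t) ⟨x, left_mem_Icc.2 hxy.le, hx0⟩
  have hD0 : ∫ t in x..y, D t = 0 := by
    rw [hD, intervalIntegral.integral_sub ((hc _ _).intervalIntegrable _ _)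
      ((hc _ _).intervalIntegrable _ _), heq, sub_self]
  have e1 : ∫ t in x..y, D t * (y - t) = (∫ t in x..y, D t * (ts - t)) + (y - ts) * ∫ t in x..y, D t := by
    rw [← intervalIntegral.integral_const_mul, ← intervalIntegral.integral_add
      (intervalIntegrable_mul hDc (continuous_sub_left ts) _ _)
      (intervalIntegrable_mul continuous_const hDc _ _)]
    congr 1; ext t; ring
  have e2 : ∫ t in x..y, D t * (y - t) =
      (∫ t in x..y, force p lam η t (seg x y a' b' t) * (y - t)) -
        ∫ t in x..y, force p lam η t (seg x y a b t) * (y - t) := by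
    rw [← intervalIntegral.integral_sub
      (intervalIntegrable_mul (hc a' b') (continuous_sub_left y) _ _)
      (intervalIntegrable_mul (hc a b) (continuous_sub_left y) _ _)]
    congr 1; ext t; simp only [hD]; ring
  rw [hD0, mul_zero, add_zero] at e1
  linarith

theorem IsMixture.deriv_lt (M : IsMixture p lam) {x y : ℝ} (hx : 0 ≤ x) (hxy : x < y) :
    deriv (mixture p lam) x < deriv (mixture p lam) y := by
  obtain ⟨z, hz, hz'⟩ := exists_hasDerivAt_eq_slope (deriv (mixture p lam)) (phi p lam) hxy
    continuous_deriv_mixture.continuousOn fun t _ => hasDerivAt_deriv_mixture t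
  have := M.phi_pos (hx.trans_lt hz.1)
  rw [hz'] at this
  have := (div_pos_iff_of_pos_right (sub_pos.2 hxy)).1 this
  linarith

theorem IsMixture.invSlope_pos (M : IsMixture p lam) {x y : ℝ} (hx : 0 ≤ x) (hxy : x < y) :
    0 < invSlope (mixture p lam) x y :=
  div_pos (sub_pos.2 hxy) (sub_pos.2 (M.deriv_lt hx hxy))

/-- The balanced line with quotient `z` has end values `√(c z)` and `√(c / z)`; increasing `z` tilts
it, which increases the first moment. -/
theorem IsMixture.h_strictMono (M : IsMixture p lam) {x y z z' : ℝ} (hx : 0 ≤ x) (hxy : x < y)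
    (hz : 0 < z) (hzz : z < z') : h (mixture p lam) x y z < h (mixture p lam) x y z' := by
  set c := invSlope (mixture p lam) x y with hc
  have hc0 : 0 < c := M.invSlope_pos hx hxy
  have hz' := hz.trans hzz
  have hD := sub_pos.2 (M.deriv_lt hx hxy)
  have hprod : ∀ z, 0 < z → √(c * z) * √(c / z) = c := by
    intro z hz
    rw [← Real.sqrt_mul (by positivity), show c * z * (c / z) = c * c by field_simp,
      Real.sqrt_mul_self hc0.le]
  have hquot : ∀ z, 0 < z → √(c * z) / √(c / z) = z := by
    intro z hz
    rw [← Real.sqrt_div (by positivity), show c * z / (c / z) = z * z by field_simp,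
      Real.sqrt_mul_self hz.le]
  have hbal : ∀ z, 0 < z → √(c * z) * √(c / z) *
      (deriv (mixture p lam) y - deriv (mixture p lam) x) = y - x := by
    intro z hz
    rw [hprod z hz, hc, invSlope, div_mul_cancel₀ _ hD.ne']
  have p1 : 0 < √(c * z) := Real.sqrt_pos.2 (by positivity)
  have p2 : 0 < √(c / z) := Real.sqrt_pos.2 (by positivity)
  have p4 : 0 < √(c / z') := Real.sqrt_pos.2 (by positivity)
  have l1 : √(c * z) < √(c * z') := Real.sqrt_lt_sqrt (by positivity) (by gcongr)
  have l2 : √(c / z') < √(c / z) := Real.sqrt_lt_sqrt (by positivity) (by gcongr)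
  set η := min √(c * z) √(c / z') with hη
  have hη0 : 0 < η := lt_min p1 p4
  have h1 : η ≤ √(c * z) := min_le_left _ _
  have h2 : η ≤ √(c / z') := min_le_right _ _
  rw [← hquot z hz, ← hquot z' hz', h_eq_integral hη0 hxy h1 (h2.trans l2.le) (hbal z hz),
    h_eq_integral hη0 hxy (h1.trans l1.le) h2 (hbal z' hz')]
  refine integral_force_mul_sub_lt hη0 hxy h1 l1 l2 ?_
  rw [(integral_force_seg_eq_zero_iff hη0 hxy h1 (h2.trans l2.le)).2 (hbal z hz),
    (integral_force_seg_eq_zero_iff hη0 hxy (h1.trans l1.le) h2).2 (hbal z' hz')]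

theorem IsMixture.h_mono (M : IsMixture p lam) {x y z z' : ℝ} (hx : 0 ≤ x) (hxy : x < y)
    (hz : 0 < z) (hzz : z ≤ z') : h (mixture p lam) x y z ≤ h (mixture p lam) x y z' := by
  rcases hzz.eq_or_lt with rfl | h
  · exact le_rfl
  · exact (M.h_strictMono hx hxy hz h).le

end

/-! ### The one-parameter family of polygons through the nodes -/

/-- End values of the chain with parameter `w`, at distance `d` from the last node. -/
def endVal (c : ℕ → ℝ) (n : ℕ) (w : ℝ) (d : ℕ) : ℝ :=
  if Even d then √(endSq c n d / w) else √(endSq c n d * w)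

section endVal
variable {c : ℕ → ℝ} {n : ℕ} {w : ℝ}

theorem endVal_pos (hc : ∀ l, 1 ≤ l → l ≤ n → 0 < c l) (hn : 1 ≤ n) (hw : 0 < w) {d : ℕ}
    (hd : d ≤ n) : 0 < endVal c n w d := by
  have := endSq_pos hc hn d hd
  unfold endVal
  split_ifs <;> positivity

theorem endVal_sq_even (hc : ∀ l, 1 ≤ l → l ≤ n → 0 < c l) (hn : 1 ≤ n) (hw : 0 < w) {d : ℕ}
    (hd : d ≤ n) (h : Even d) : endVal c n w d ^ 2 = endSq c n d / w := by
  have := endSq_pos hc hn d hd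
  rw [endVal, if_pos h, Real.sq_sqrt (by positivity)]

theorem endVal_sq_odd (hc : ∀ l, 1 ≤ l → l ≤ n → 0 < c l) (hn : 1 ≤ n) (hw : 0 < w) {d : ℕ}
    (hd : d ≤ n) (h : ¬Even d) : endVal c n w d ^ 2 = endSq c n d * w := by
  have := endSq_pos hc hn d hd
  rw [endVal, if_neg h, Real.sq_sqrt (by positivity)]

theorem endVal_mul_endVal (hc : ∀ l, 1 ≤ l → l ≤ n → 0 < c l) (hn : 1 ≤ n) (hw : 0 < w) {d : ℕ}
    (hd : d < n) : endVal c n w (d + 1) * endVal c n w d = c (n - d) := by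
  have h1 := endVal_pos hc hn hw hd.le
  have h2 := endVal_pos hc hn hw (d := d + 1) hd
  have hE := endSq_pos hc hn d hd.le
  have hcp := hc (n - d) (by omega) (by omega)
  refine (pow_left_inj₀ (mul_pos h2 h1).le hcp.le two_ne_zero).1 ?_
  rw [mul_pow]
  by_cases h : Even d
  · rw [endVal_sq_even hc hn hw hd.le h, endVal_sq_odd hc hn hw hd (by simpa [Nat.even_add_one] using h),
      endSq]
    field_simp
  · rw [endVal_sq_odd hc hn hw hd.le h, endVal_sq_even hc hn hw hd (by simpa [Nat.even_add_one] using h),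
      endSq]
    field_simp

/-- A larger parameter lowers the values at even distance from the last node and raises those at odd
distance, because the products over the cells are fixed. -/
theorem endVal_le (hc : ∀ l, 1 ≤ l → l ≤ n → 0 < c l) (hn : 1 ≤ n) {w' : ℝ} (hw : 0 < w)
    (hww : w ≤ w') {d : ℕ} (hd : d ≤ n) :
    (Even d → endVal c n w' d ≤ endVal c n w d) ∧ (¬Even d → endVal c n w d ≤ endVal c n w' d) := by
  have hE := endSq_pos hc hn d hd
  constructor
  · intro h
    rw [endVal, endVal, if_pos h, if_pos h]
    exact Real.sqrt_le_sqrt (by gcongr)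
  · intro h
    rw [endVal, endVal, if_neg h, if_neg h]
    exact Real.sqrt_le_sqrt (by gcongr)

end endVal

section
variable {n : ℕ} {p : Fin n → ℕ} {lam : Fin n → ℝ} {x : ℕ → ℝ} {w : ℝ}

theorem nonneg_of_nodes (hx0 : x 0 = 0) (hx : ∀ l, 1 ≤ l → l ≤ n → x (l - 1) < x l) :
    ∀ l ≤ n, 0 ≤ x l := by
  intro l
  induction l with
  | zero => intro _; exact hx0.ge
  | succ l ih => intro hl; exact (ih (by omega)).trans (hx (l + 1) (by omega) hl).le

theorem IsMixture.cellInv_pos (M : IsMixture p lam) (hx0 : x 0 = 0)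
    (hx : ∀ l, 1 ≤ l → l ≤ n → x (l - 1) < x l) :
    ∀ l, 1 ≤ l → l ≤ n → 0 < cellInv (mixture p lam) x l := fun l h1 h2 =>
  M.invSlope_pos (nonneg_of_nodes hx0 hx (l - 1) (by omega)) (hx l h1 h2)

/-- The value of the chain with parameter `w` at node `l`. -/
def nodeVal (ξ : ℝ → ℝ) (n : ℕ) (x : ℕ → ℝ) (w : ℝ) (l : ℕ) : ℝ :=
  endVal (cellInv ξ x) n w (n - l)

theorem IsMixture.nodeVal_pos (M : IsMixture p lam) (hn : 1 ≤ n) (hx0 : x 0 = 0)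
    (hx : ∀ l, 1 ≤ l → l ≤ n → x (l - 1) < x l) (hw : 0 < w) (l : ℕ) :
    0 < nodeVal (mixture p lam) n x w l :=
  endVal_pos (M.cellInv_pos hx0 hx) hn hw (Nat.sub_le _ _)

theorem IsMixture.nodeVal_mul (M : IsMixture p lam) (hn : 1 ≤ n) (hx0 : x 0 = 0)
    (hx : ∀ l, 1 ≤ l → l ≤ n → x (l - 1) < x l) (hw : 0 < w) {l : ℕ} (h1 : 1 ≤ l) (h2 : l ≤ n) :
    nodeVal (mixture p lam) n x w (l - 1) * nodeVal (mixture p lam) n x w l =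
      cellInv (mixture p lam) x l := by
  have := endVal_mul_endVal (M.cellInv_pos hx0 hx) hn hw (d := n - l) (by omega)
  rw [show n - l + 1 = n - (l - 1) by omega, show n - (n - l) = l by omega] at this
  exact this

/-- The third arguments of `h` in the definition of `𝓗` are quotients of end values. -/
theorem IsMixture.kappa_arg (M : IsMixture p lam) (hn : 1 ≤ n) (hx0 : x 0 = 0)
    (hx : ∀ l, 1 ≤ l → l ≤ n → x (l - 1) < x l) (hw : 0 < w) {l : ℕ} (h1 : 1 ≤ l) (h2 : l ≤ n) :
    w ^ ((-1 : ℤ) ^ (n - l)) * (calF (mixture p lam) n x l)⁻¹ * r₂ (mixture p lam) (x (l - 1)) (x l) =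
      nodeVal (mixture p lam) n x w (l - 1) / nodeVal (mixture p lam) n x w l := by
  have hc := M.cellInv_pos hx0 hx
  have hp := M.nodeVal_pos hn hx0 hx hw l
  have hE := endSq_pos hc hn (n - l) (Nat.sub_le _ _)
  have hphi : 0 < phi p lam (x l) :=
    M.phi_pos ((nonneg_of_nodes hx0 hx (l - 1) (by omega)).trans_lt (hx l h1 h2))
  rw [calF_eq hc h1 h2, r₂_eq, deriv_deriv_mixture, eq_div_iff hp.ne', mul_comm]
  have e := M.nodeVal_mul hn hx0 hx hw h1 h2
  rw [← cellInv, ← e]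
  have hsq : nodeVal (mixture p lam) n x w l ^ 2 * w ^ ((-1 : ℤ) ^ (n - l)) =
      endSq (cellInv (mixture p lam) x) n (n - l) := by
    by_cases h : Even (n - l)
    · rw [nodeVal, endVal_sq_even hc hn hw (Nat.sub_le _ _) h, h.neg_one_pow, zpow_one]
      field_simp
    · rw [nodeVal, endVal_sq_odd hc hn hw (Nat.sub_le _ _) h, (Nat.not_even_iff_odd.1 h).neg_one_pow,
        zpow_neg, zpow_one]
      field_simp
  rw [← hsq]
  have : w ^ ((-1 : ℤ) ^ (n - l)) ≠ 0 := (zpow_pos hw _).ne'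
  field_simp

/-- The bounds on `𝓕_l` say that the chain is below `ψ` at the node `l`. -/
theorem IsMixture.node_iff (M : IsMixture p lam) (hn : 1 ≤ n) (hx0 : x 0 = 0)
    (hx : ∀ l, 1 ≤ l → l ≤ n → x (l - 1) < x l) (hw : 0 < w) {l : ℕ} (h1 : 1 ≤ l) (h2 : l ≤ n) :
    phi p lam (x l) * nodeVal (mixture p lam) n x w l ^ 2 ≤ 1 ↔
      if Even (n - l) then calF (mixture p lam) n x l ≤ w else calF (mixture p lam) n x l * w ≤ 1 := by
  have hc := M.cellInv_pos hx0 hx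
  rw [calF_eq hc h1 h2, deriv_deriv_mixture]
  split_ifs with h
  · rw [nodeVal, endVal_sq_even hc hn hw (Nat.sub_le _ _) h, ← mul_div_assoc, div_le_one hw]
  · rw [nodeVal, endVal_sq_odd hc hn hw (Nat.sub_le _ _) h, ← mul_assoc]

/-- The bounds on `𝓐_l` say that the chain is concave at the node `l`. -/
theorem IsMixture.conc_iff (M : IsMixture p lam) (hn : 1 ≤ n) (hx0 : x 0 = 0)
    (hx : ∀ l, 1 ≤ l → l ≤ n → x (l - 1) < x l) (hw : 0 < w) {l : ℕ} (h1 : 1 ≤ l) (h2 : l < n) :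
    steep (x (l - 1)) (x l) (nodeVal (mixture p lam) n x w (l - 1)) (nodeVal (mixture p lam) n x w l) ≤
      steep (x l) (x (l + 1)) (nodeVal (mixture p lam) n x w l)
        (nodeVal (mixture p lam) n x w (l + 1)) ↔
      if Even (n - l) then calA (mixture p lam) n x l * w ≤ 1 else calA (mixture p lam) n x l ≤ w := by
  have hc := M.cellInv_pos hx0 hx
  have c1 := hc l h1 h2.le
  have c2 := hc (l + 1) (by omega) h2
  have hE := endSq_pos hc hn (n - l) (Nat.sub_le _ _)
  have hxl := hx l h1 h2.le
  have hxl' : x l < x (l + 1) := hx (l + 1) (by omega) h2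
  have hnn := nonneg_of_nodes hx0 hx (l - 1) (by omega)
  have hC := M.invSlope_pos hnn (hxl.trans hxl')
  have ha := M.nodeVal_pos hn hx0 hx hw l
  have e1 := M.nodeVal_mul hn hx0 hx hw h1 h2.le
  have e2 := M.nodeVal_mul hn hx0 hx hw (l := l + 1) (by omega) h2
  rw [Nat.add_sub_cancel] at e2
  set a := nodeVal (mixture p lam) n x w l with hadef
  have hD1 := sub_pos.2 (M.deriv_lt hnn hxl)
  have hD2 := sub_pos.2 (M.deriv_lt (hnn.trans hxl.le) hxl')
  have hL1 := sub_pos.2 hxl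
  have hL2 := sub_pos.2 hxl'
  have key : steep (x (l - 1)) (x l) (nodeVal (mixture p lam) n x w (l - 1)) a ≤
      steep (x l) (x (l + 1)) a (nodeVal (mixture p lam) n x w (l + 1)) ↔
      cellInv (mixture p lam) x l * cellInv (mixture p lam) x (l + 1) ≤
        invSlope (mixture p lam) (x (l - 1)) (x (l + 1)) * a ^ 2 := by
    rw [show nodeVal (mixture p lam) n x w (l - 1) = cellInv (mixture p lam) x l / a by
        rw [← e1]; field_simp,
      show nodeVal (mixture p lam) n x w (l + 1) = cellInv (mixture p lam) x (l + 1) / a by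
        rw [← e2]; field_simp]
    unfold steep cellInv invSlope
    rw [Nat.add_sub_cancel]
    set D1 := deriv (mixture p lam) (x l) - deriv (mixture p lam) (x (l - 1)) with hD1'
    set D2 := deriv (mixture p lam) (x (l + 1)) - deriv (mixture p lam) (x l) with hD2'
    set L1 := x l - x (l - 1) with hL1'
    set L2 := x (l + 1) - x l with hL2'
    rw [show x (l + 1) - x (l - 1) = L1 + L2 by rw [hL1', hL2']; ring,
      show deriv (mixture p lam) (x (l + 1)) - deriv (mixture p lam) (x (l - 1)) = D1 + D2 by
        rw [hD1', hD2']; ring]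
    have f1 : (a - L2 / D2 / a) / L2 - (L1 / D1 / a - a) / L1 =
        (D1 + D2) / (a * L1 * L2) * ((L1 + L2) / (D1 + D2) * a ^ 2 - L1 / D1 * (L2 / D2)) := by
      field_simp
      ring
    rw [← sub_nonneg, f1, mul_nonneg_iff_of_pos_left (by positivity), sub_nonneg]
  rw [key, calA_eq hc h1 h2]
  split_ifs with h
  · rw [hadef, nodeVal, endVal_sq_even hc hn hw (Nat.sub_le _ _) h, div_mul_eq_mul_div,
      div_le_one (by positivity), ← mul_div_assoc, le_div_iff₀ hw]
  · rw [hadef, nodeVal, endVal_sq_odd hc hn hw (Nat.sub_le _ _) h, div_le_iff₀ (by positivity)]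
    constructor <;> intro h <;> linarith

theorem IsMixture.calZ_pos (M : IsMixture p lam) (hn : 2 ≤ n) (hx0 : x 0 = 0)
    (hx : ∀ l, 1 ≤ l → l ≤ n → x (l - 1) < x l) : 0 < calZ (mixture p lam) n x := by
  have hc := M.cellInv_pos hx0 hx
  refine lt_of_lt_of_le ?_ (calF_le_calZ (l := n - 1) (by omega) ?_)
  · rw [calF_eq hc (by omega) (by omega), deriv_deriv_mixture]
    refine mul_pos (M.phi_pos ?_) (endSq_pos hc (by omega) _ (Nat.sub_le _ _))
    exact (nonneg_of_nodes hx0 hx (n - 1 - 1) (by omega)).trans_lt (hx (n - 1) (by omega) (by omega))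
  · rw [show n - (n - 1) = 1 by omega]; exact odd_one

theorem IsMixture.calY_pos (M : IsMixture p lam) (hn : 1 ≤ n) (hx0 : x 0 = 0)
    (hx : ∀ l, 1 ≤ l → l ≤ n → x (l - 1) < x l) : 0 < calY (mixture p lam) n x := by
  have hc := M.cellInv_pos hx0 hx
  refine lt_of_lt_of_le ?_ (calF_le_calY (l := n) le_rfl (by simp))
  rw [calF_eq hc hn le_rfl, deriv_deriv_mixture]
  refine mul_pos (M.phi_pos ?_) (endSq_pos hc hn _ (Nat.sub_le _ _))
  exact (nonneg_of_nodes hx0 hx (n - 1) (by omega)).trans_lt (hx n hn le_rfl)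

/-- The parameters between `𝓨` and `1/𝓩` are those for which the chain is below `ψ` and concave at
the nodes. -/
theorem IsMixture.mem_Icc_iff (M : IsMixture p lam) (hn : 2 ≤ n) (hx0 : x 0 = 0)
    (hx : ∀ l, 1 ≤ l → l ≤ n → x (l - 1) < x l) (hw : 0 < w) :
    w ∈ Icc (calY (mixture p lam) n x) (calZ (mixture p lam) n x)⁻¹ ↔
      (∀ l, 1 ≤ l → l ≤ n → phi p lam (x l) * nodeVal (mixture p lam) n x w l ^ 2 ≤ 1) ∧
      ∀ l, 1 ≤ l → l < n →
        steep (x (l - 1)) (x l) (nodeVal (mixture p lam) n x w (l - 1))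
          (nodeVal (mixture p lam) n x w l) ≤
        steep (x l) (x (l + 1)) (nodeVal (mixture p lam) n x w l)
          (nodeVal (mixture p lam) n x w (l + 1)) := by
  have hZ := M.calZ_pos hn hx0 hx
  have h1n : 1 ≤ n := by omega
  -- As `ξ''(0) = 0`, the index `0` puts no constraint on the parameter.
  have hF0 : calF (mixture p lam) n x 0 = 0 :=
    calF_zero (by rw [deriv_deriv_mixture, hx0, M.phi_zero])
  rw [mem_Icc, le_inv_comm₀ hw hZ]
  constructor
  · rintro ⟨hY, hZw⟩
    refine ⟨fun l h1 h2 => (M.node_iff h1n hx0 hx hw h1 h2).2 ?_,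
      fun l h1 h2 => (M.conc_iff h1n hx0 hx hw h1 h2).2 ?_⟩
    · split_ifs with h
      · exact (calF_le_calY h2 h).trans hY
      · have := (calF_le_calZ h2 (Nat.not_even_iff_odd.1 h)).trans hZw
        rwa [inv_eq_one_div, le_div_iff₀ hw] at this
    · split_ifs with h
      · have := (calA_le_calZ h1 h2 h).trans hZw
        rwa [inv_eq_one_div, le_div_iff₀ hw] at this
      · exact (calA_le_calY h1 h2 (Nat.not_even_iff_odd.1 h)).trans hY
  · rintro ⟨hF, hA⟩
    have hF' := fun l h1 h2 => (M.node_iff h1n hx0 hx hw (l := l) h1 h2).1 (hF l h1 h2)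
    have hA' := fun l h1 h2 => (M.conc_iff h1n hx0 hx hw (l := l) h1 h2).1 (hA l h1 h2)
    constructor
    · refine calY_le (fun l h2 h => ?_) fun l h1 h2 h => ?_
      · rcases l.eq_zero_or_pos with rfl | h1
        · rw [hF0]; exact hw.le
        · simpa [h] using hF' l h1 h2
      · simpa [Nat.not_even_iff_odd.2 h] using hA' l h1 h2
    · refine calZ_le h1n (fun l h2 h => ?_) fun l h1 h2 h => ?_
      · rcases l.eq_zero_or_pos with rfl | h1
        · rw [hF0]; exact (inv_pos.2 hw).le
        · have := hF' l h1 h2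
          rw [if_neg (Nat.not_even_iff_odd.2 h)] at this
          rwa [inv_eq_one_div, le_div_iff₀ hw]
      · have := hA' l h1 h2
        rw [if_pos h] at this
        rwa [inv_eq_one_div, le_div_iff₀ hw]

/-- Rewritten with `1/𝓩` in place of `𝓩`, both inequalities concern one expression, evaluated at the
two ends of the parameter interval. -/
theorem kappa_iff_signs (ξ : ℝ → ℝ) (s : ℕ) (x : ℕ → ℝ) : Kappa ξ s x ↔
    (∀ l, 1 ≤ l → l ≤ s → x (l - 1) < x l) ∧ ∀ l, 1 ≤ l → l ≤ s →
    0 ≤ (-1 : ℝ) ^ (s - l) * h ξ (x (l - 1)) (x l)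
      ((calZ ξ s x)⁻¹ ^ ((-1 : ℤ) ^ (s - l)) * (calF ξ s x l)⁻¹ * r₂ ξ (x (l - 1)) (x l)) ∧
    (-1 : ℝ) ^ (s - l) * h ξ (x (l - 1)) (x l)
      (calY ξ s x ^ ((-1 : ℤ) ^ (s - l)) * (calF ξ s x l)⁻¹ * r₂ ξ (x (l - 1)) (x l)) ≤ 0 := by
  have e : ∀ l, calZ ξ s x ^ ((-1 : ℤ) ^ (s - l + 1)) = (calZ ξ s x)⁻¹ ^ ((-1 : ℤ) ^ (s - l)) := by
    intro l
    rw [pow_succ, mul_neg_one, zpow_neg, inv_zpow]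
  simp only [Kappa, e]

end

/-! ### From `𝓗` to an exact chain -/

section
variable {n : ℕ} {p : Fin n → ℕ} {lam : Fin n → ℝ} {x : ℕ → ℝ} {w η : ℝ}

theorem IsMixture.nodeVal_mul_mul (M : IsMixture p lam) (hn : 1 ≤ n) (hx0 : x 0 = 0)
    (hx : ∀ l, 1 ≤ l → l ≤ n → x (l - 1) < x l) (hw : 0 < w) {j : ℕ} (hj : j < n) :
    nodeVal (mixture p lam) n x w j * nodeVal (mixture p lam) n x w (j + 1) *
      (deriv (mixture p lam) (x (j + 1)) - deriv (mixture p lam) (x j)) = x (j + 1) - x j := by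
  have e := M.nodeVal_mul hn hx0 hx hw (l := j + 1) (by omega) hj
  have hlt : x j < x (j + 1) := hx (j + 1) (by omega) hj
  have hD := sub_pos.2 (M.deriv_lt (nonneg_of_nodes hx0 hx j hj.le) hlt)
  rw [Nat.add_sub_cancel] at e
  rw [e, cellInv, invSlope, Nat.add_sub_cancel, div_mul_cancel₀ _ hD.ne']

theorem IsMixture.integral_force_nodeVal (M : IsMixture p lam) (hn : 1 ≤ n) (hx0 : x 0 = 0)
    (hx : ∀ l, 1 ≤ l → l ≤ n → x (l - 1) < x l) (hw : 0 < w) (hη : 0 < η)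
    (hle : ∀ l, η ≤ nodeVal (mixture p lam) n x w l) {j : ℕ} (hj : j < n) :
    ∫ t in x j..x (j + 1), force p lam η t (seg (x j) (x (j + 1)) (nodeVal (mixture p lam) n x w j)
      (nodeVal (mixture p lam) n x w (j + 1)) t) = 0 :=
  (integral_force_seg_eq_zero_iff hη (hx (j + 1) (by omega) hj) (hle _) (hle _)).2
    (M.nodeVal_mul_mul hn hx0 hx hw hj)

theorem IsMixture.integral_force_nodeVal_mul (M : IsMixture p lam) (hn : 1 ≤ n) (hx0 : x 0 = 0)
    (hx : ∀ l, 1 ≤ l → l ≤ n → x (l - 1) < x l) (hw : 0 < w) (hη : 0 < η)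
    (hle : ∀ l, η ≤ nodeVal (mixture p lam) n x w l) {j : ℕ} (hj : j < n) :
    ∫ t in x j..x (j + 1), force p lam η t (seg (x j) (x (j + 1)) (nodeVal (mixture p lam) n x w j)
      (nodeVal (mixture p lam) n x w (j + 1)) t) * (x (j + 1) - t) =
    h (mixture p lam) (x j) (x (j + 1)) (w ^ ((-1 : ℤ) ^ (n - (j + 1))) *
      (calF (mixture p lam) n x (j + 1))⁻¹ * r₂ (mixture p lam) (x j) (x (j + 1))) := by
  have e := M.kappa_arg hn hx0 hx hw (l := j + 1) (by omega) hj
  rw [Nat.add_sub_cancel] at e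
  have hlt : x j < x (j + 1) := hx (j + 1) (by omega) hj
  rw [e, h_eq_integral hη hlt (hle _) (hle _) (M.nodeVal_mul_mul hn hx0 hx hw hj)]

theorem IsMixture.exists_le_nodeVal (M : IsMixture p lam) (hn : 1 ≤ n) (hx0 : x 0 = 0)
    (hx : ∀ l, 1 ≤ l → l ≤ n → x (l - 1) < x l) (hw : 0 < w) :
    ∃ η > 0, ∀ l, η ≤ nodeVal (mixture p lam) n x w l := by
  obtain ⟨d, hmem, hd⟩ := Finset.exists_min_image (Finset.range (n + 1))
    (fun d => endVal (cellInv (mixture p lam) x) n w d) ⟨0, by simp⟩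
  refine ⟨endVal (cellInv (mixture p lam) x) n w (min d n),
    endVal_pos (M.cellInv_pos hx0 hx) hn hw (min_le_right _ _), fun l => ?_⟩
  have hdn : d ≤ n := by have := Finset.mem_range.1 hmem; omega
  rw [min_eq_left hdn]
  exact hd (n - l) (Finset.mem_range.2 (by omega))

/-- On the last cell the signs in the definition of `𝓗` force `𝓨 ≤ 1 / 𝓩`. -/
theorem IsMixture.calY_le_inv_calZ (M : IsMixture p lam) (hn : 2 ≤ n) (hx0 : x 0 = 0)
    (K : Kappa (mixture p lam) n x) : calY (mixture p lam) n x ≤ (calZ (mixture p lam) n x)⁻¹ := by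
  obtain ⟨hx, hs⟩ := (kappa_iff_signs _ _ _).1 K
  have h1n : 1 ≤ n := by omega
  have hW := inv_pos.2 (M.calZ_pos hn hx0 hx)
  have hY := M.calY_pos h1n hx0 hx
  obtain ⟨h1, h2⟩ := hs n h1n le_rfl
  have hc : 0 < (calF (mixture p lam) n x n)⁻¹ * r₂ (mixture p lam) (x (n - 1)) (x n) := by
    have := M.kappa_arg h1n hx0 hx one_pos h1n le_rfl
    rw [one_zpow, one_mul] at this
    rw [this]
    exact div_pos (M.nodeVal_pos h1n hx0 hx one_pos _) (M.nodeVal_pos h1n hx0 hx one_pos _)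
  simp only [Nat.sub_self, pow_zero, zpow_one, one_mul, mul_assoc] at h1 h2
  by_contra hlt
  rw [not_le] at hlt
  have := M.h_strictMono (nonneg_of_nodes hx0 hx (n - 1) (by omega)) (hx n h1n le_rfl)
    (mul_pos hW hc) (mul_lt_mul_of_pos_right hlt hc)
  linarith

end

section
variable {k : ℕ} {p : Fin (k + 1) → ℕ} {lam : Fin (k + 1) → ℝ} {x : ℕ → ℝ}

/-- The two extreme polygons span the box. Their balance, concavity and position below `ψ` come from
the choice of the parameters, the signs of their moments from `𝓗`, and the trap then yields the
chain. -/
theorem IsMixture.exists_exactChain (M : IsMixture p lam) (hk : 1 ≤ k) (hx0 : x 0 = 0)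
    (K : Kappa (mixture p lam) (k + 1) x) :
    ∃ η > 0, ∃ c ℓ m : ℕ → ℝ, IsExactChain k (force p lam η) c ℓ m ∧ c 0 = 0 ∧
      c (k + 1) = x (k + 1) ∧ ∀ j ≤ k, ∀ t ∈ Icc (c j) (c (j + 1)), η ≤ ℓ j - m j * t := by
  have hYW := M.calY_le_inv_calZ (by omega) hx0 K
  obtain ⟨hx, hs⟩ := (kappa_iff_signs _ _ _).1 K
  have h1 : 1 ≤ k + 1 := by omega
  have h2 : 2 ≤ k + 1 := by omega
  have hY := M.calY_pos h1 hx0 hx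
  have hc := M.cellInv_pos hx0 hx
  set Y := calY (mixture p lam) (k + 1) x
  set W := (calZ (mixture p lam) (k + 1) x)⁻¹
  have hW : 0 < W := hY.trans_le hYW
  obtain ⟨nY, cY⟩ := (M.mem_Icc_iff h2 hx0 hx hY).1 ⟨le_rfl, hYW⟩
  obtain ⟨nW, cW⟩ := (M.mem_Icc_iff h2 hx0 hx hW).1 ⟨hYW, le_rfl⟩
  obtain ⟨η₁, hη₁, hle₁⟩ := M.exists_le_nodeVal h1 hx0 hx hY
  obtain ⟨η₂, hη₂, hle₂⟩ := M.exists_le_nodeVal h1 hx0 hx hW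
  set η := min η₁ η₂
  have hη : 0 < η := lt_min hη₁ hη₂
  have gY : ∀ l, η ≤ nodeVal (mixture p lam) (k + 1) x Y l := fun l =>
    (min_le_left _ _).trans (hle₁ l)
  have gW : ∀ l, η ≤ nodeVal (mixture p lam) (k + 1) x W l := fun l =>
    (min_le_right _ _).trans (hle₂ l)
  have bY := fun j hj => M.integral_force_nodeVal h1 hx0 hx hY hη gY (j := j) hj
  have bW := fun j hj => M.integral_force_nodeVal h1 hx0 hx hW hη gW (j := j) hj
  have mY := fun j hj => M.integral_force_nodeVal_mul h1 hx0 hx hY hη gY (j := j) hj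
  have mW := fun j hj => M.integral_force_nodeVal_mul h1 hx0 hx hW hη gW (j := j) hj
  have par : ∀ j ≤ k, (Even (k + 1 - j) ↔ ¬Even (k + 1 - (j + 1))) := by
    intro j hj
    rw [show k + 1 - j = (k + 1 - (j + 1)) + 1 by omega, Nat.even_add_one]
  set NY := nodeVal (mixture p lam) (k + 1) x Y with hNY
  set NW := nodeVal (mixture p lam) (k + 1) x W with hNW
  -- The order of the two polygons alternates from node to node. Hence a line from `lo` to `up`, or
  -- from `up` to `lo`, over one cell belongs to a single polygon, and the parity of `k + 1 - (j +
  -- 1)` tells to which.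
  have key := M.isTrap (X := x) (lo := fun l => if Even (k + 1 - l) then NW l else NY l)
    (up := fun l => if Even (k + 1 - l) then NY l else NW l) hη hx0.ge
    (fun j hj => hx (j + 1) (by omega) (by omega))
    (fun l => by
      have := endVal_le hc h1 hY hYW (d := k + 1 - l) (Nat.sub_le _ _)
      split_ifs with h
      · exact this.1 h
      · exact this.2 h)
    (fun l => by split_ifs; exacts [gW l, gY l])
    (fun l hl => by
      rcases l.eq_zero_or_pos with rfl | hl1
      · rw [hx0, M.phi_zero, zero_mul]; exact zero_le_one
      · split_ifs
        · exact nY l hl1 hl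
        · exact nW l hl1 hl)
    (fun j hj => by
      by_cases h : Even (k + 1 - (j + 1))
      · have h' := mt (par j hj).1 (not_not.2 h)
        simp only [h, h', if_true, if_false]; exact bY j (by omega)
      · have h' := (par j hj).2 h
        simp only [h, h', if_true, if_false]; exact bW j (by omega))
    (fun j hj => by
      by_cases h : Even (k + 1 - (j + 1))
      · have h' := mt (par j hj).1 (not_not.2 h)
        simp only [h, h', if_true, if_false]; exact bW j (by omega)
      · have h' := (par j hj).2 h
        simp only [h, h', if_true, if_false]; exact bY j (by omega))
    (fun j hj => by
      have hsj := hs (j + 1) (by omega) (by omega)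
      rw [Nat.add_sub_cancel] at hsj
      by_cases h : Even (k + 1 - (j + 1))
      · have h' := mt (par j hj).1 (not_not.2 h)
        simp only [h, h', if_true, if_false]
        rw [mY j (by omega)]
        rw [h.neg_one_pow, one_mul, one_mul] at hsj
        exact hsj.2
      · have h' := (par j hj).2 h
        simp only [h, h', if_true, if_false]
        rw [mW j (by omega)]
        have := hsj.1
        rw [(Nat.not_even_iff_odd.1 h).neg_one_pow] at this
        linarith)
    (fun j hj => by
      have hsj := hs (j + 1) (by omega) (by omega)
      rw [Nat.add_sub_cancel] at hsj
      by_cases h : Even (k + 1 - (j + 1))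
      · have h' := mt (par j hj).1 (not_not.2 h)
        simp only [h, h', if_true, if_false]
        rw [mW j (by omega)]
        rw [h.neg_one_pow, one_mul, one_mul] at hsj
        exact hsj.1
      · have h' := (par j hj).2 h
        simp only [h, h', if_true, if_false]
        rw [mY j (by omega)]
        have := hsj.2
        rw [(Nat.not_even_iff_odd.1 h).neg_one_pow] at this
        linarith)
    (fun j hj => by
      have p1 := par j (by omega)
      have p2 := par (j + 1) (by omega)
      by_cases h : Even (k + 1 - (j + 1))
      · have h' := mt p1.1 (not_not.2 h)
        have h'' : ¬Even (k + 1 - (j + 2)) := p2.1 h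
        simp only [h, h', h'', if_true, if_false]
        exact cW (j + 1) (by omega) (by omega)
      · have h' := p1.2 h
        have h'' : Even (k + 1 - (j + 2)) := not_not.1 (mt p2.2 h)
        simp only [h, h', h'', if_true, if_false]
        exact cY (j + 1) (by omega) (by omega))
  obtain ⟨c, ℓ, m, hC, h0, hlast, hge⟩ := key.exists_exactChain
    (fun l => by split_ifs; exacts [gW l, gY l])
  exact ⟨η, hη, c, ℓ, m, hC, h0.trans hx0, hlast, hge⟩

end

/-! ### The functional in terms of the tail of the measure -/

/-- Admissible densities, extended by `0` and integrable. -/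
structure IsDensity (γ : ℝ → ℝ) (Δ : ℝ) : Prop where
  nonneg : ∀ x ∈ Ico (0 : ℝ) 1, 0 ≤ γ x
  cont : ∀ x ∈ Ico (0 : ℝ) 1, ContinuousWithinAt γ (Ici x) x
  mono : MonotoneOn γ (Ico 0 1)
  pos : 0 < Δ
  zero : ∀ x ∉ Ico (0 : ℝ) 1, γ x = 0
  integrable : Integrable γ

/-- The measure with density `γ` and mass `Δ` at `1`. -/
def parisi (γ : ℝ → ℝ) (Δ : ℝ) : Measure ℝ :=
  (volume.restrict (Ico (0 : ℝ) 1)).withDensity (fun x => ENNReal.ofReal (γ x)) +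
    ENNReal.ofReal Δ • Measure.dirac (1 : ℝ)

/-- `ν((t, 1])`. -/
def tail (γ : ℝ → ℝ) (Δ t : ℝ) : ℝ := Δ + ∫ s in t..1, γ s

theorem IsDensity.mem_classK {γ : ℝ → ℝ} {Δ : ℝ} (D : IsDensity γ Δ) : parisi γ Δ ∈ classK :=
  ⟨γ, Δ, D.nonneg, D.cont, D.mono, D.pos, rfl⟩

section
variable {γ : ℝ → ℝ} {Δ : ℝ}

theorem IsDensity.nonneg' (D : IsDensity γ Δ) (x : ℝ) : 0 ≤ γ x := by
  by_cases h : x ∈ Ico (0 : ℝ) 1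
  · exact D.nonneg x h
  · exact (D.zero x h).ge

theorem IsDensity.parisi_eq (D : IsDensity γ Δ) :
    parisi γ Δ = volume.withDensity (fun x => ENNReal.ofReal (γ x)) +
      ENNReal.ofReal Δ • Measure.dirac (1 : ℝ) := by
  rw [parisi, ← withDensity_indicator measurableSet_Ico]
  congr 2
  refine indicator_eq_self.2 fun x hx => ?_
  by_contra h
  exact hx (by simp [D.zero x h])

theorem IsDensity.intervalIntegrable (D : IsDensity γ Δ) (a b : ℝ) :
    IntervalIntegrable γ volume a b := D.integrable.intervalIntegrable

theorem IsDensity.continuous_tail (D : IsDensity γ Δ) : Continuous (tail γ Δ) := by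
  have e : tail γ Δ = fun t => Δ - ∫ s in (1 : ℝ)..t, γ s := by
    funext t
    rw [tail, intervalIntegral.integral_symm, sub_eq_add_neg]
  rw [e]
  exact continuous_const.sub (intervalIntegral.continuous_primitive D.intervalIntegrable 1)

theorem IsDensity.tail_sub (D : IsDensity γ Δ) (s t : ℝ) :
    tail γ Δ s - tail γ Δ t = ∫ r in s..t, γ r := by
  rw [tail, tail, ← intervalIntegral.integral_add_adjacent_intervals (D.intervalIntegrable s t)
    (D.intervalIntegrable t 1)]
  ring

theorem tail_one : tail γ Δ 1 = Δ := by simp [tail]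

theorem IsDensity.tail_anti (D : IsDensity γ Δ) : Antitone (tail γ Δ) := by
  intro s t hst
  have := D.tail_sub s t
  have h := intervalIntegral.integral_nonneg (μ := volume) hst fun r _ => D.nonneg' r
  linarith

theorem IsDensity.le_tail (D : IsDensity γ Δ) {t : ℝ} (ht : t ≤ 1) : Δ ≤ tail γ Δ t := by
  have := D.tail_anti ht
  rwa [tail_one] at this

theorem IsDensity.hasDerivWithinAt_tail (D : IsDensity γ Δ) {x : ℝ} (hx : x ∈ Ico (0 : ℝ) 1) :
    HasDerivWithinAt (tail γ Δ) (-γ x) (Ici x) x :=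
  (intervalIntegral.integral_hasDerivWithinAt_left (s := Ici x) (t := Ioi x)
    (D.intervalIntegrable x 1) D.integrable.aestronglyMeasurable.stronglyMeasurableAtFilter
    ((D.cont x hx).mono Ioi_subset_Ici_self)).const_add Δ

theorem IsDensity.concaveOn_tail (D : IsDensity γ Δ) : ConcaveOn ℝ (Icc 0 1) (tail γ Δ) := by
  refine concaveOn_of_slope_anti_adjacent (convex_Icc 0 1) fun {x y z} hx hz hxy hyz => ?_
  have hy : y ∈ Ico (0 : ℝ) 1 := ⟨hx.1.trans hxy.le, hyz.trans_le hz.2⟩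
  have h1 : ∫ r in x..y, γ r ≤ ∫ _ in x..y, γ y :=
    intervalIntegral.integral_mono_on hxy.le (D.intervalIntegrable _ _)
      intervalIntegrable_const fun r hr => D.mono ⟨hx.1.trans hr.1, hr.2.trans_lt hy.2⟩ hy hr.2
  have h2 : ∫ _ in y..z, γ y ≤ ∫ r in y..z, γ r :=
    intervalIntegral.integral_mono_on_of_le_Ioo hyz.le intervalIntegrable_const
      (D.intervalIntegrable _ _) fun r hr => D.mono hy ⟨hy.1.trans hr.1.le, hr.2.trans_le hz.2⟩ hr.1.le
  rw [intervalIntegral.integral_const, smul_eq_mul, ← D.tail_sub] at h1 h2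
  have p1 := sub_pos.2 hxy
  have p2 := sub_pos.2 hyz
  trans -γ y
  · rw [div_le_iff₀ p2]; linarith
  · rw [le_div_iff₀ p1]; linarith

theorem IsDensity.parisi_Ioc (D : IsDensity γ Δ) {t : ℝ} (ht : t ∈ Ico (0 : ℝ) 1) :
    parisi γ Δ (Ioc t 1) = ENNReal.ofReal (tail γ Δ t) := by
  rw [D.parisi_eq, Measure.add_apply, withDensity_apply _ measurableSet_Ioc, Measure.smul_apply,
    Measure.dirac_apply' _ measurableSet_Ioc, indicator_of_mem (right_mem_Ioc.2 ht.2),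
    ← ofReal_integral_eq_lintegral_ofReal D.integrable.integrableOn
      (Eventually.of_forall D.nonneg'), tail, intervalIntegral.integral_of_le ht.2.le,
    add_comm Δ, ENNReal.ofReal_add (integral_nonneg D.nonneg') D.pos.le]
  simp

theorem IsDensity.parisi_real_Ioc (D : IsDensity γ Δ) {t : ℝ} (ht : t ∈ Ico (0 : ℝ) 1) :
    (parisi γ Δ).real (Ioc t 1) = tail γ Δ t := by
  rw [Measure.real, D.parisi_Ioc ht, ENNReal.toReal_ofReal (D.pos.le.trans (D.le_tail ht.2.le))]

end

section
variable {n : ℕ} {p : Fin n → ℕ} {lam : Fin n → ℝ} {γ : ℝ → ℝ} {Δ : ℝ}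

theorem IsMixture.deriv_nonneg (M : IsMixture p lam) {t : ℝ} (ht : 0 ≤ t) :
    0 ≤ deriv (mixture p lam) t := by
  rw [← M.deriv_mixture_zero]
  rcases ht.eq_or_lt with rfl | h
  · exact le_rfl
  · exact (M.deriv_lt le_rfl h).le

/-- Integration by parts with `ξ'(0) = 0`; the right derivative of the tail suffices, so `γ` may
jump. -/
theorem IsDensity.integral_deriv_mul (M : IsMixture p lam) (D : IsDensity γ Δ) :
    (∫ t in (0 : ℝ)..1, γ t * deriv (mixture p lam) t) + Δ * deriv (mixture p lam) 1 =
      ∫ t in (0 : ℝ)..1, phi p lam t * tail γ Δ t := by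
  have h := intervalIntegral.integral_mul_deriv_eq_deriv_mul_of_hasDeriv_right (a := 0) (b := 1)
    (u := tail γ Δ) (v := deriv (mixture p lam)) (u' := fun t => -γ t) (v' := phi p lam)
    D.continuous_tail.continuousOn continuous_deriv_mixture.continuousOn
    (fun x hx => by
      rw [min_eq_left zero_le_one, max_eq_right zero_le_one] at hx
      exact (D.hasDerivWithinAt_tail ⟨hx.1.le, hx.2⟩).mono Ioi_subset_Ici_self)
    (fun x _ => (hasDerivAt_deriv_mixture x).hasDerivWithinAt)
    (D.intervalIntegrable 0 1).neg (continuous_phi.intervalIntegrable _ _)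
  rw [tail_one, M.deriv_mixture_zero] at h
  simp only [neg_mul, intervalIntegral.integral_neg] at h
  rw [show (∫ t in (0 : ℝ)..1, phi p lam t * tail γ Δ t) =
    ∫ t in (0 : ℝ)..1, tail γ Δ t * phi p lam t by simp_rw [mul_comm], h]
  ring

/-- The energy of a tail. -/
def energy (p : Fin n → ℕ) (lam : Fin n → ℝ) (N : ℝ → ℝ) : ℝ :=
  ∫ t in (0 : ℝ)..1, (phi p lam t * N t + 1 / N t)

/-- For an integrable density both integrals in `𝒬` are finite, and comparing values of `𝒬` becomes
comparing real energies of tails. -/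
theorem IsDensity.crisantiSommers_eq (M : IsMixture p lam) (D : IsDensity γ Δ) :
    crisantiSommers (mixture p lam) (parisi γ Δ) =
      (1 / 2) * ENNReal.ofReal (energy p lam (tail γ Δ)) := by
  have hξ : Continuous (deriv (mixture p lam)) := continuous_deriv_mixture
  have hpos : ∀ t ≤ (1 : ℝ), 0 < tail γ Δ t := fun t ht => D.pos.trans_le (D.le_tail ht)
  have hinv : ContinuousOn (fun t => 1 / tail γ Δ t) (Icc 0 1) :=
    continuousOn_const.div D.continuous_tail.continuousOn fun t ht => (hpos t ht.2).ne'
  have hmeas : Measurable fun x => ENNReal.ofReal (deriv (mixture p lam) x) :=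
    ENNReal.measurable_ofReal.comp hξ.measurable
  have hgm : AEMeasurable (fun x => ENNReal.ofReal (γ x)) :=
    ENNReal.measurable_ofReal.comp_aemeasurable D.integrable.aemeasurable
  have i1 : ∫⁻ x in Icc (0 : ℝ) 1, ENNReal.ofReal (deriv (mixture p lam) x) ∂(parisi γ Δ) =
      ENNReal.ofReal (∫ t in (0 : ℝ)..1, phi p lam t * tail γ Δ t) := by
    rw [D.parisi_eq, Measure.restrict_add, lintegral_add_measure,
      setLIntegral_withDensity_eq_lintegral_mul₀ hgm hmeas.aemeasurable measurableSet_Icc,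
      Measure.restrict_smul, lintegral_smul_measure, setLIntegral_dirac,
      if_pos (by simp), ← D.integral_deriv_mul M,
      intervalIntegral.integral_of_le zero_le_one, ← integral_Icc_eq_integral_Ioc]
    have hn : ∀ᵐ t ∂(volume.restrict (Icc (0 : ℝ) 1)), 0 ≤ γ t * deriv (mixture p lam) t := by
      filter_upwards [ae_restrict_mem measurableSet_Icc] with t ht
      exact mul_nonneg (D.nonneg' t) (M.deriv_nonneg ht.1)
    rw [ENNReal.ofReal_add (integral_nonneg_of_ae hn) (mul_nonneg D.pos.le (M.deriv_nonneg zero_le_one)),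
      ofReal_integral_eq_lintegral_ofReal _ hn, ENNReal.ofReal_mul D.pos.le, smul_eq_mul]
    · congr 1
      refine lintegral_congr fun t => ?_
      rw [Pi.mul_apply, ENNReal.ofReal_mul (D.nonneg' t)]
    · have := (D.intervalIntegrable 0 1).mul_continuousOn hξ.continuousOn
      rwa [intervalIntegrable_iff_integrableOn_Icc_of_le zero_le_one] at this
  have i2 : ∫⁻ x in Icc (0 : ℝ) 1, (parisi γ Δ (Ioc x 1))⁻¹ =
      ENNReal.ofReal (∫ t in (0 : ℝ)..1, 1 / tail γ Δ t) := by
    have hn : ∀ᵐ t ∂(volume.restrict (Ico (0 : ℝ) 1)), 0 ≤ 1 / tail γ Δ t := by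
      filter_upwards [ae_restrict_mem measurableSet_Ico] with t ht
      exact (one_div_pos.2 (hpos t ht.2.le)).le
    rw [intervalIntegral.integral_of_le zero_le_one, ← integral_Icc_eq_integral_Ioc,
      integral_Icc_eq_integral_Ico, setLIntegral_congr Ico_ae_eq_Icc.symm,
      ofReal_integral_eq_lintegral_ofReal (hinv.integrableOn_Icc.mono_set Ico_subset_Icc_self) hn]
    refine setLIntegral_congr_fun measurableSet_Ico fun t ht => ?_
    rw [D.parisi_Ioc ht, one_div, ENNReal.ofReal_inv_of_pos (hpos t ht.2.le)]
  rw [crisantiSommers, i1, i2, ← ENNReal.ofReal_add, energy, intervalIntegral.integral_add]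
  · exact (continuous_phi.mul D.continuous_tail).intervalIntegrable _ _
  · exact (hinv.mono (by rw [uIcc_of_le zero_le_one])).intervalIntegrable
  · exact intervalIntegral.integral_nonneg zero_le_one fun t ht =>
      mul_nonneg (M.phi_nonneg ht.1) (hpos t ht.2).le
  · exact intervalIntegral.integral_nonneg zero_le_one fun t ht => (one_div_pos.2 (hpos t ht.2)).le

theorem isDensity_zero : IsDensity (fun _ => 0) 1 where
  nonneg _ _ := le_rfl
  cont _ _ := continuousWithinAt_const
  mono _ _ _ _ _ := le_rfl
  pos := one_pos
  zero _ _ := rfl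
  integrable := integrable_zero _ _ _

/-- The Parisi measure has an integrable density. -/
theorem IsParisiMeasure.exists_density (M : IsMixture p lam) {ν : Measure ℝ}
    (hν : IsParisiMeasure (mixture p lam) ν) : ∃ γ Δ, IsDensity γ Δ ∧ ν = parisi γ Δ := by
  obtain ⟨⟨γ, Δ, h1, h2, h3, h4, rfl⟩, hmin⟩ := hν
  have hfin : crisantiSommers (mixture p lam) (parisi γ Δ) ≠ ⊤ := by
    refine ne_top_of_le_ne_top ?_ (hmin _ isDensity_zero.mem_classK)
    rw [isDensity_zero.crisantiSommers_eq M]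
    finiteness
  have hgm : AEMeasurable γ (volume.restrict (Ico 0 1)) :=
    aemeasurable_restrict_of_monotoneOn measurableSet_Ico h3
  have hgo : AEMeasurable (fun x => ENNReal.ofReal (γ x)) (volume.restrict (Ico 0 1)) :=
    ENNReal.measurable_ofReal.comp_aemeasurable hgm
  have hle : volume.restrict (Ico (1 / 2 : ℝ) 1) ≤ volume.restrict (Ico 0 1) :=
    Measure.restrict_mono (Ico_subset_Ico_left (by norm_num)) le_rfl
  have hmeas : Measurable fun x => ENNReal.ofReal (deriv (mixture p lam) x) :=
    ENNReal.measurable_ofReal.comp continuous_deriv_mixture.measurable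
  have hI : ∫⁻ x in Icc (0 : ℝ) 1, ENNReal.ofReal (deriv (mixture p lam) x) ∂(parisi γ Δ) ≠ ⊤ := by
    intro h
    refine hfin ?_
    rw [crisantiSommers, h, top_add]
    exact ENNReal.mul_top (by simp)
  have hsub : ∫⁻ x in Ico (1 / 2 : ℝ) 1, ENNReal.ofReal (γ x) * ENNReal.ofReal (deriv (mixture p lam) x)
      ≠ ⊤ := by
    refine ne_top_of_le_ne_top hI ?_
    rw [parisi, Measure.restrict_add, lintegral_add_measure]
    refine le_trans ?_ le_self_add
    rw [setLIntegral_withDensity_eq_lintegral_mul₀ hgo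
      hmeas.aemeasurable measurableSet_Icc, Measure.restrict_restrict measurableSet_Icc]
    refine lintegral_mono_set fun x hx => ⟨⟨?_, hx.2.le⟩, ?_, hx.2⟩ <;> linarith [hx.1]
  -- On `[1/2, 1)` the weight `ξ'` is at least `ξ'(1/2) > 0`, so finiteness of the linear term of
  -- `𝒬` bounds the mass there; on `[0, 1/2]` monotonicity of `γ` is enough.
  have hd : 0 < deriv (mixture p lam) (1 / 2) := by
    rw [← M.deriv_mixture_zero]; exact M.deriv_lt le_rfl (by norm_num)
  have hsub' : ∫⁻ x in Ico (1 / 2 : ℝ) 1, ENNReal.ofReal (γ x) ≠ ⊤ := by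
    intro htop
    refine hsub (top_le_iff.1 ?_)
    calc ⊤ = (∫⁻ x in Ico (1 / 2 : ℝ) 1, ENNReal.ofReal (γ x)) *
          ENNReal.ofReal (deriv (mixture p lam) (1 / 2)) := by
          rw [htop, ENNReal.top_mul (by simpa using hd)]
      _ = ∫⁻ x in Ico (1 / 2 : ℝ) 1, ENNReal.ofReal (γ x) *
          ENNReal.ofReal (deriv (mixture p lam) (1 / 2)) := by
          rw [lintegral_mul_const'' _ (hgo.mono_measure hle)]
      _ ≤ _ := by
          refine setLIntegral_mono_ae' measurableSet_Ico (Eventually.of_forall fun x hx => ?_)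
          gcongr
          rcases hx.1.eq_or_lt with h | h
          · rw [h]
          · exact (M.deriv_lt (by norm_num) h).le
  have hint1 : IntegrableOn γ (Ico (1 / 2) 1) := by
    refine ⟨(hgm.mono_measure hle).aestronglyMeasurable, ?_⟩
    rw [hasFiniteIntegral_iff_ofReal]
    · exact hsub'.lt_top
    · filter_upwards [ae_restrict_mem measurableSet_Ico] with x hx
      exact h1 x ⟨by linarith [hx.1], hx.2⟩
  have hint2 : IntegrableOn γ (Icc 0 (1 / 2)) :=
    (h3.mono fun x hx => ⟨hx.1, by linarith [hx.2]⟩).integrableOn_isCompact isCompact_Icc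
  have hint : IntegrableOn γ (Ico 0 1) :=
    (hint2.union hint1).mono_set fun x hx => by
      rcases le_total x (1 / 2) with h | h
      · exact Or.inl ⟨hx.1, h⟩
      · exact Or.inr ⟨h, hx.2⟩
  have hin : ∀ x ∈ Ico (0 : ℝ) 1, (Ico (0 : ℝ) 1).indicator γ x = γ x := fun x hx =>
    indicator_of_mem hx γ
  refine ⟨(Ico 0 1).indicator γ, Δ, ⟨fun x hx => ?_, fun x hx => ?_, ?_, h4, fun x hx => ?_, ?_⟩, ?_⟩
  · rw [hin x hx]; exact h1 x hx
  · refine (h2 x hx).congr_of_eventuallyEq ?_ (hin x hx)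
    filter_upwards [Ico_mem_nhdsGE hx.2] with y hy
    exact hin y ⟨hx.1.trans hy.1, hy.2⟩
  · exact h3.congr fun x hx => (hin x hx).symm
  · exact indicator_of_notMem hx γ
  · exact (integrable_indicator_iff measurableSet_Ico).2 hint
  · rw [parisi]
    congr 1
    refine withDensity_congr_ae ?_
    filter_upwards [ae_restrict_mem measurableSet_Ico] with x hx
    rw [hin x hx]

/-- Minimality in terms of tails. -/
theorem IsDensity.energy_le (M : IsMixture p lam) (D : IsDensity γ Δ)
    (hν : IsParisiMeasure (mixture p lam) (parisi γ Δ)) {γ' : ℝ → ℝ} {Δ' : ℝ}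
    (D' : IsDensity γ' Δ') : energy p lam (tail γ Δ) ≤ energy p lam (tail γ' Δ') := by
  have h := hν.2 _ D'.mem_classK
  rw [D.crisantiSommers_eq M, D'.crisantiSommers_eq M,
    ENNReal.mul_le_mul_iff_right (by simp) (by finiteness)] at h
  refine (ENNReal.ofReal_le_ofReal_iff ?_).1 h
  exact intervalIntegral.integral_nonneg zero_le_one fun t ht => by
    have := D'.pos.trans_le (D'.le_tail ht.2)
    have := M.phi_nonneg ht.1
    positivity

end

/-! ### The variational inequality along an exact chain -/

/-- If `q` is orthogonal to affine functions and positive on an order convex set only, then its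
integral against a concave function is nonnegative. -/
theorem integral_mul_nonneg_of_concaveOn {q κ : ℝ → ℝ} {x x' : ℝ} (hx : x < x') (hq : Continuous q)
    (hκ : Continuous κ) (hκc : ConcaveOn ℝ (Icc x x') κ)
    (dip : OrdConnected {t | t ∈ Icc x x' ∧ 0 < q t})
    (bal : ∀ r s : ℝ, ∫ t in x..x', q t * (r + s * t) = 0) :
    0 ≤ ∫ t in x..x', q t * κ t := by
  have sub : ∀ r s : ℝ, ∫ t in x..x', q t * κ t = ∫ t in x..x', q t * (κ t - (r + s * t)) := by
    intro r s
    simp_rw [mul_sub]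
    have ha : Continuous fun t => r + s * t := by fun_prop
    rw [intervalIntegral.integral_sub (intervalIntegrable_mul hq hκ _ _)
      (intervalIntegrable_mul hq ha _ _), bal, sub_zero]
  -- Balance allows any affine function to be subtracted from `κ`. Minus its chord over `[d₁, d₂]`,
  -- a concave function has the same signs `-, +, -` as `q`. If `d₁ = d₂`, then `q ≤ 0` off one
  -- point and an upper bound of `κ` is subtracted instead.
  obtain ⟨d₁, d₂, h1, h2, h3, n1, p1, n2, -⟩ := exists_sign_pattern hx.le dip
  rcases h2.eq_or_lt with rfl | h12
  · obtain ⟨B, hB⟩ := isCompact_Icc.bddAbove_image (f := κ) (K := Icc x x') hκ.continuousOn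
    rw [sub B 0]
    refine intervalIntegral.integral_nonneg_of_ae_restrict hx.le ?_
    have hne : ∀ᵐ t ∂(volume.restrict (Icc x x')), t ≠ d₁ :=
      ae_restrict_of_ae (measure_eq_zero_iff_ae_notMem.1 (measure_singleton d₁))
    filter_upwards [ae_restrict_mem measurableSet_Icc, hne] with t ht htd
    have hb := hB (mem_image_of_mem κ ht)
    refine mul_nonneg_of_nonpos_of_nonpos ?_ (by linarith)
    rcases lt_or_gt_of_ne htd with h | h
    · exact n1 t ⟨ht.1, h⟩
    · exact n2 t ⟨h, ht.2⟩
  · have m1 : d₁ ∈ Icc x x' := ⟨h1, h2.trans h3⟩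
    have m2 : d₂ ∈ Icc x x' := ⟨h1.trans h2, h3⟩
    set σ := (κ d₂ - κ d₁) / (d₂ - d₁) with hσ
    have hL := sub_pos.2 h12
    have hσ' : κ d₂ = κ d₁ + σ * (d₂ - d₁) := by
      rw [hσ, div_mul_cancel₀ _ hL.ne']; ring
    rw [sub (κ d₁ - σ * d₁) σ]
    refine intervalIntegral.integral_nonneg hx.le fun t ht => ?_
    rcases lt_trichotomy t d₁ with h | rfl | h
    · refine mul_nonneg_of_nonpos_of_nonpos (n1 t ⟨ht.1, h⟩) ?_
      have := hκc.slope_anti_adjacent ht m2 h h12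
      rw [← hσ, le_div_iff₀ (sub_pos.2 h)] at this
      linarith
    · have : κ t - (κ t - σ * t + σ * t) = 0 := by ring
      rw [this, mul_zero]
    rcases lt_trichotomy t d₂ with h' | rfl | h'
    · refine mul_nonneg (p1 t ⟨h, h'⟩) ?_
      have := hκc.slope_anti_adjacent m1 m2 h h'
      rw [div_le_div_iff₀ (sub_pos.2 h') (sub_pos.2 h), hσ'] at this
      have h5 : (σ * (t - d₁)) * (d₂ - d₁) ≤ (κ t - κ d₁) * (d₂ - d₁) := by linarith
      have := le_of_mul_le_mul_right h5 hL
      linarith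
    · have : κ t - (κ d₁ - σ * d₁ + σ * t) = 0 := by rw [hσ']; ring
      rw [this, mul_zero]
    · refine mul_nonneg_of_nonpos_of_nonpos (n2 t ⟨h', ht.2⟩) ?_
      have := hκc.slope_anti_adjacent m1 ht h12 h'
      rw [← hσ, div_le_iff₀ (sub_pos.2 h')] at this
      linarith

section
variable {n : ℕ} {p : Fin n → ℕ} {lam : Fin n → ℝ}

/-- The derivative of the energy density along `N`. -/
def drift (p : Fin n → ℕ) (lam : Fin n → ℝ) (N : ℝ → ℝ) (t : ℝ) : ℝ := phi p lam t - 1 / N t ^ 2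

theorem continuousOn_drift {N : ℝ → ℝ} {s : Set ℝ} (hN : ContinuousOn N s)
    (hpos : ∀ t ∈ s, 0 < N t) : ContinuousOn (drift p lam N) s :=
  continuous_phi.continuousOn.sub (continuousOn_const.div (hN.pow 2) fun t ht =>
    (pow_pos (hpos t ht) 2).ne')

/-- The expansion is exact: `1/N' - 1/N = -(N' - N)/N² + (N' - N)²/(N' N²)`. The quadratic remainder
gives uniqueness of the minimizer and controls first variations. -/
theorem energy_sub_energy {N N' : ℝ → ℝ} (hN : Continuous N) (hN' : Continuous N')
    (hpos : ∀ t ∈ Icc (0 : ℝ) 1, 0 < N t) (hpos' : ∀ t ∈ Icc (0 : ℝ) 1, 0 < N' t) :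
    energy p lam N' - energy p lam N = (∫ t in (0 : ℝ)..1, drift p lam N t * (N' t - N t)) +
      ∫ t in (0 : ℝ)..1, (N' t - N t) ^ 2 / (N' t * N t ^ 2) := by
  have hd := continuousOn_drift (p := p) (lam := lam) hN.continuousOn hpos
  have hi : ∀ {f : ℝ → ℝ}, ContinuousOn f (Icc 0 1) → IntervalIntegrable f volume 0 1 := fun h =>
    (by rwa [uIcc_of_le zero_le_one] : ContinuousOn _ (uIcc (0 : ℝ) 1)).intervalIntegrable
  have he : ∀ {N : ℝ → ℝ}, Continuous N → (∀ t ∈ Icc (0 : ℝ) 1, 0 < N t) →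
      ContinuousOn (fun t => phi p lam t * N t + 1 / N t) (Icc 0 1) := fun hN hpos =>
    (continuous_phi.mul hN).continuousOn.add (continuousOn_const.div hN.continuousOn
      fun t ht => (hpos t ht).ne')
  rw [energy, energy, ← intervalIntegral.integral_sub (hi (he hN' hpos')) (hi (he hN hpos)),
    ← intervalIntegral.integral_add]
  · refine intervalIntegral.integral_congr fun t ht => ?_
    rw [uIcc_of_le zero_le_one] at ht
    have h1 := hpos t ht
    have h2 := hpos' t ht
    simp only [drift]
    field_simp
    ring
  · exact hi (hd.mul (hN'.sub hN).continuousOn)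
  · exact hi (((hN'.sub hN).pow 2).continuousOn.div (hN'.mul (hN.pow 2)).continuousOn fun t ht =>
      (mul_pos (hpos' t ht) (pow_pos (hpos t ht) 2)).ne')

/-- A chain satisfying the variational inequality has the only tail of least energy. -/
theorem eq_of_energy_le {N N' : ℝ → ℝ} (hN : Continuous N) (hN' : Continuous N')
    (hpos : ∀ t ∈ Icc (0 : ℝ) 1, 0 < N t) (hpos' : ∀ t ∈ Icc (0 : ℝ) 1, 0 < N' t)
    (hle : energy p lam N' ≤ energy p lam N)
    (hvi : 0 ≤ ∫ t in (0 : ℝ)..1, drift p lam N t * (N' t - N t)) :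
    ∀ t ∈ Icc (0 : ℝ) 1, N' t = N t := by
  have h := energy_sub_energy (p := p) (lam := lam) hN hN' hpos hpos'
  by_contra! hcon
  obtain ⟨t, ht, hne⟩ := hcon
  have hc : ContinuousOn (fun t => (N' t - N t) ^ 2 / (N' t * N t ^ 2)) (Icc 0 1) :=
    ((hN'.sub hN).pow 2).continuousOn.div (hN'.mul (hN.pow 2)).continuousOn fun t ht =>
      (mul_pos (hpos' t ht) (pow_pos (hpos t ht) 2)).ne'
  have := intervalIntegral.integral_pos zero_lt_one hc (fun s hs => by
    have h1 := hpos s ⟨hs.1.le, hs.2⟩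
    have h2 := hpos' s ⟨hs.1.le, hs.2⟩
    positivity) ⟨t, ht, div_pos (sq_pos_of_ne_zero (sub_ne_zero.2 hne)) (mul_pos (hpos' t ht) (pow_pos (hpos t ht) 2))⟩
  linarith

end

/-! ### Step densities -/

/-- The nodes `0 = c 0 < ⋯ < c (k + 1) = 1`. -/
structure IsPartition (k : ℕ) (c : ℕ → ℝ) : Prop where
  zero : c 0 = 0
  last : c (k + 1) = 1
  lt : ∀ j ≤ k, c j < c (j + 1)

/-- `γ` is equal to `m j` on `[c j, c (j + 1))`, and vanishes off `[0, 1)`. -/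
structure IsStep (k : ℕ) (c m : ℕ → ℝ) (γ : ℝ → ℝ) : Prop where
  eq : ∀ j ≤ k, ∀ t ∈ Ico (c j) (c (j + 1)), γ t = m j
  zero : ∀ t ∉ Ico (0 : ℝ) 1, γ t = 0

section
variable {k : ℕ} {c m : ℕ → ℝ} {γ : ℝ → ℝ} {Δ : ℝ}

theorem IsPartition.lt_of_lt (P : IsPartition k c) {i j : ℕ} (hij : i < j) (hj : j ≤ k + 1) :
    c i < c j := by
  induction j with
  | zero => omega
  | succ j ih =>
    rcases Nat.lt_succ_iff_lt_or_eq.1 hij with h | rfl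
    · exact (ih h (by omega)).trans (P.lt j (by omega))
    · exact P.lt i (by omega)

theorem IsPartition.le_of_le (P : IsPartition k c) {i j : ℕ} (hij : i ≤ j) (hj : j ≤ k + 1) :
    c i ≤ c j := by
  rcases hij.eq_or_lt with rfl | h
  · exact le_rfl
  · exact (P.lt_of_lt h hj).le

theorem IsPartition.mem_Icc (P : IsPartition k c) {j : ℕ} (hj : j ≤ k + 1) : c j ∈ Icc (0 : ℝ) 1 :=
  ⟨P.zero ▸ P.le_of_le (Nat.zero_le j) hj, P.last ▸ P.le_of_le hj le_rfl⟩

theorem IsPartition.mem_Ico (P : IsPartition k c) {j : ℕ} (hj : j ≤ k) {t : ℝ}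
    (ht : t ∈ Ico (c j) (c (j + 1))) : t ∈ Ico (0 : ℝ) 1 :=
  ⟨(P.mem_Icc (by omega)).1.trans ht.1, ht.2.trans_le (P.mem_Icc (by omega)).2⟩

theorem IsPartition.exists_cell (P : IsPartition k c) {t : ℝ} (ht : t ∈ Ico (0 : ℝ) 1) :
    ∃ j ≤ k, t ∈ Ico (c j) (c (j + 1)) := by
  by_contra! hcon
  have : ∀ j ≤ k + 1, c j ≤ t := by
    intro j
    induction j with
    | zero => intro _; rw [P.zero]; exact ht.1
    | succ j ih =>
      intro hj
      by_contra h
      exact hcon j (by omega) ⟨ih (by omega), not_le.1 h⟩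
  have h1 := this (k + 1) le_rfl
  rw [P.last] at h1
  exact absurd ht.2 (not_lt.2 h1)

theorem IsPartition.cell_le (P : IsPartition k c) {i j : ℕ} (hi : i ≤ k) {s t : ℝ}
    (hs : s ∈ Ico (c i) (c (i + 1))) (ht : t ∈ Ico (c j) (c (j + 1))) (hst : s ≤ t) : i ≤ j := by
  by_contra h
  have := P.le_of_le (i := j + 1) (j := i) (by omega) (by omega)
  linarith [hs.1, ht.2]

theorem IsPartition.sum_integral (P : IsPartition k c) {f : ℝ → ℝ}
    (hf : IntervalIntegrable f volume 0 1) :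
    ∑ j ∈ Finset.range (k + 1), ∫ t in c j..c (j + 1), f t = ∫ t in (0 : ℝ)..1, f t := by
  rw [intervalIntegral.sum_integral_adjacent_intervals (fun j hj => hf.mono_set ?_), P.zero, P.last]
  rw [uIcc_of_le (P.lt j (by omega)).le, uIcc_of_le zero_le_one]
  exact Icc_subset_Icc (P.mem_Icc (by omega)).1 (P.mem_Icc (by omega)).2

theorem le_of_steps_le (hm : ∀ j < k, m j ≤ m (j + 1)) {i j : ℕ} (hij : i ≤ j) (hj : j ≤ k) :
    m i ≤ m j := by
  induction j with
  | zero => rw [Nat.le_zero.1 hij]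
  | succ j ih =>
    rcases Nat.le_succ_iff.1 hij with h | rfl
    · exact (ih h (by omega)).trans (hm j (by omega))
    · exact le_rfl

theorem IsPartition.exists_isStep (P : IsPartition k c) (m : ℕ → ℝ) : ∃ γ, IsStep k c m γ := by
  classical
  have h : ∀ t, ∃ y, (∀ j ≤ k, t ∈ Ico (c j) (c (j + 1)) → y = m j) ∧
      (t ∉ Ico (0 : ℝ) 1 → y = 0) := by
    intro t
    by_cases ht : t ∈ Ico (0 : ℝ) 1
    · obtain ⟨i, hi, hti⟩ := P.exists_cell ht
      refine ⟨m i, fun j hj htj => ?_, fun h => absurd ht h⟩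
      rw [le_antisymm (P.cell_le hi hti htj le_rfl) (P.cell_le hj htj hti le_rfl)]
    · exact ⟨0, fun j hj htj => absurd (P.mem_Ico hj htj) ht, fun _ => rfl⟩
  choose γ h1 h2 using h
  exact ⟨γ, fun j hj t ht => h1 t j hj ht, h2⟩

theorem IsStep.isDensity (S : IsStep k c m γ) (P : IsPartition k c) (hm : ∀ j < k, m j ≤ m (j + 1))
    (h0 : 0 ≤ m 0) (hΔ : 0 < Δ) : IsDensity γ Δ := by
  have hmono : MonotoneOn γ (Ico 0 1) := by
    intro s hs t ht hst
    obtain ⟨i, hi, hsi⟩ := P.exists_cell hs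
    obtain ⟨j, hj, htj⟩ := P.exists_cell ht
    rw [S.eq i hi s hsi, S.eq j hj t htj]
    exact le_of_steps_le hm (P.cell_le hi hsi htj hst) hj
  have hnn : ∀ x ∈ Ico (0 : ℝ) 1, 0 ≤ γ x := by
    intro x hx
    obtain ⟨i, hi, hxi⟩ := P.exists_cell hx
    rw [S.eq i hi x hxi]
    exact h0.trans (le_of_steps_le hm (Nat.zero_le i) hi)
  refine ⟨hnn, fun x hx => ?_, hmono, hΔ, S.zero, ?_⟩
  · obtain ⟨i, hi, hxi⟩ := P.exists_cell hx
    refine (continuousWithinAt_const (b := m i)).congr_of_eventuallyEq ?_ (S.eq i hi x hxi)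
    filter_upwards [Ico_mem_nhdsGE hxi.2] with y hy
    exact S.eq i hi y ⟨hxi.1.trans hy.1, hy.2⟩
  · have hint : IntegrableOn γ (Ico 0 1) := by
      refine Integrable.of_bound
        (aemeasurable_restrict_of_monotoneOn measurableSet_Ico hmono).aestronglyMeasurable (m k) ?_
      filter_upwards [ae_restrict_mem measurableSet_Ico] with x hx
      obtain ⟨i, hi, hxi⟩ := P.exists_cell hx
      rw [Real.norm_of_nonneg (hnn x hx), S.eq i hi x hxi]
      exact le_of_steps_le hm hi le_rfl
    refine (integrableOn_iff_integrable_of_support_subset fun x hx => ?_).1 hint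
    by_contra h
    exact hx (S.zero x h)

theorem IsStep.tail_sub_tail (S : IsStep k c m γ) (D : IsDensity γ Δ) {j : ℕ} (hj : j ≤ k) {s t : ℝ}
    (hs : c j ≤ s) (hst : s ≤ t) (ht : t ≤ c (j + 1)) : tail γ Δ s - tail γ Δ t = m j * (t - s) := by
  rw [D.tail_sub, intervalIntegral.integral_congr_Ioo_of_le (g := fun _ => m j) hst fun r hr =>
    S.eq j hj r ⟨hs.trans hr.1.le, hr.2.trans_le ht⟩, intervalIntegral.integral_const, smul_eq_mul]
  ring

/-- The tail of a step density is the polygon with slopes `-m j`. -/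
theorem IsStep.tail_eq (S : IsStep k c m γ) (P : IsPartition k c) (D : IsDensity γ Δ) {ℓ : ℕ → ℝ}
    (meet : ∀ j < k, ℓ j - m j * c (j + 1) = ℓ (j + 1) - m (j + 1) * c (j + 1))
    (hΔ : ℓ k - m k * 1 = Δ) {j : ℕ} (hj : j ≤ k) :
    ∀ t ∈ Icc (c j) (c (j + 1)), tail γ Δ t = ℓ j - m j * t := by
  have step : ∀ j ≤ k, tail γ Δ (c (j + 1)) = ℓ j - m j * c (j + 1) →
      ∀ t ∈ Icc (c j) (c (j + 1)), tail γ Δ t = ℓ j - m j * t := by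
    intro j hj h t ht
    have := S.tail_sub_tail D hj ht.1 ht.2 le_rfl
    rw [h] at this
    linarith
  have all : ∀ d ≤ k, tail γ Δ (c (k - d + 1)) = ℓ (k - d) - m (k - d) * c (k - d + 1) := by
    intro d
    induction d with
    | zero => intro _; rw [Nat.sub_zero, P.last, hΔ, tail_one]
    | succ d ih =>
      intro hd
      have e : k - (d + 1) + 1 = k - d := by omega
      have h1 := meet (k - (d + 1)) (by omega)
      rw [e] at h1 ⊢
      rw [h1]
      exact step (k - d) (by omega) (ih (by omega)) _ ⟨le_rfl, (P.lt _ (by omega)).le⟩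
  refine step j hj ?_
  have := all (k - j) (by omega)
  rwa [show k - (k - j) = j by omega] at this

end

/-! ### The obstacle function and the minimality of exact chains -/

theorem integral_primitive_eq {q : ℝ → ℝ} (hq : Continuous q) (u v : ℝ) :
    ∫ t in u..v, (∫ r in (0 : ℝ)..t, q r) =
      (v - u) * (∫ r in (0 : ℝ)..u, q r) + ∫ t in u..v, q t * (v - t) := by
  have h := intervalIntegral.integral_mul_deriv_eq_deriv_mul (a := u) (b := v)
    (u := fun t => ∫ r in (0 : ℝ)..t, q r) (v := fun t => t - v) (u' := q) (v' := fun _ => 1)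
    (fun t _ => hq.integral_hasStrictDerivAt 0 t |>.hasDerivAt)
    (fun t _ => (hasDerivAt_id t).sub_const v) (hq.intervalIntegrable _ _)
    intervalIntegrable_const
  simp only [mul_one, sub_self, mul_zero, zero_sub] at h
  rw [h, show (fun t => q t * (t - v)) = fun t => -(q t * (v - t)) by funext t; ring,
    intervalIntegral.integral_neg]
  ring

section
variable {n : ℕ} {p : Fin n → ℕ} {lam : Fin n → ℝ} {γ : ℝ → ℝ} {Δ : ℝ}

theorem IsDensity.le_tail' (D : IsDensity γ Δ) (t : ℝ) : Δ ≤ tail γ Δ t := by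
  rcases le_total t 1 with h | h
  · exact D.le_tail h
  · have := D.tail_sub 1 t
    rw [tail_one, intervalIntegral.integral_congr (g := fun _ => 0)] at this
    · rw [intervalIntegral.integral_zero] at this; linarith
    · intro r hr
      rw [uIcc_of_le h] at hr
      exact D.zero r fun h' => absurd h'.2 (not_lt.2 hr.1)

theorem IsDensity.tail_pos (D : IsDensity γ Δ) (t : ℝ) : 0 < tail γ Δ t :=
  D.pos.trans_le (D.le_tail' t)

theorem IsDensity.continuous_drift (D : IsDensity γ Δ) : Continuous (drift p lam (tail γ Δ)) :=
  continuousOn_univ.1 (continuousOn_drift D.continuous_tail.continuousOn fun t _ => D.tail_pos t)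

theorem IsDensity.continuous_inv_sq (D : IsDensity γ Δ) : Continuous fun t => 1 / tail γ Δ t ^ 2 :=
  continuous_const.div (D.continuous_tail.pow 2) fun t => (pow_pos (D.tail_pos t) 2).ne'

/-- Since `ξ'(t) = ∫_0^t ξ''`, the integrand of `g` is the primitive of the force that vanishes at
`0`. -/
theorem IsDensity.obstacle_eq (M : IsMixture p lam) (D : IsDensity γ Δ) {u : ℝ}
    (hu : u ∈ Icc (0 : ℝ) 1) : obstacle (mixture p lam) (parisi γ Δ) u =
      ∫ t in u..1, (∫ r in (0 : ℝ)..t, drift p lam (tail γ Δ) r) := by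
  refine intervalIntegral.integral_congr fun t ht => ?_
  rw [uIcc_of_le hu.2] at ht
  have e : ∫ r in (0 : ℝ)..t, 1 / ((parisi γ Δ).real (Ioc r 1)) ^ 2 =
      ∫ r in (0 : ℝ)..t, 1 / tail γ Δ r ^ 2 :=
    intervalIntegral.integral_congr_Ioo_of_le (hu.1.trans ht.1) fun r hr => by
      simp only [D.parisi_real_Ioc ⟨hr.1.le, hr.2.trans_le ht.2⟩]
  simp only [e, drift]
  rw [intervalIntegral.integral_sub (continuous_phi.intervalIntegrable _ _)
    (D.continuous_inv_sq.intervalIntegrable _ _), integral_phi, M.deriv_mixture_zero, sub_zero]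

/-- The slope of a line exact on `[0, x']` is negative. -/
theorem IsMixture.steep_pos_of_bal (M : IsMixture p lam) {η : ℝ} (hη : 0 < η) {x' A m : ℝ}
    (hx : 0 < x') (hge : ∀ t ∈ Icc 0 x', η ≤ A - m * t)
    (bal : ∀ r s : ℝ, ∫ t in (0 : ℝ)..x', force p lam η t (A - m * t) * (r + s * t) = 0) : 0 < m := by
  by_contra hm
  rw [not_lt] at hm
  have hc := continuous_force_affine (p := p) (lam := lam) hη A m
  -- If `m ≤ 0`, the line and `ξ''` are both nondecreasing, and so is the force along the line.
  -- Having zero total, it vanishes at some `τ` and has the sign of `t - τ`; then its integral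
  -- against `t - τ` is positive, contrary to balance.
  have hmono : ∀ s t, 0 ≤ s → s ≤ t →
      force p lam η s (A - m * s) ≤ force p lam η t (A - m * t) := fun s t hs hst =>
    (force_mono hη s (by nlinarith : A - m * s ≤ A - m * t)).trans
      (sub_le_sub_right (M.phi_mono hs hst) _)
  have b0 := bal 1 0
  simp only [zero_mul, add_zero, mul_one] at b0
  obtain ⟨τ, hτ, hτ0⟩ := exists_hasDerivAt_eq_zero
    (f := fun t => ∫ r in (0 : ℝ)..t, force p lam η r (A - m * r)) hx
    (intervalIntegral.continuous_primitive (fun a b => hc.intervalIntegrable a b) 0).continuousOn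
    (by rw [b0, intervalIntegral.integral_same])
    (fun t _ => (hc.integral_hasStrictDerivAt 0 t).hasDerivAt)
  obtain ⟨t₀, ht₀, hne⟩ := M.exists_force_ne_zero hη hx hge
  have key : ∀ t ∈ Icc 0 x', 0 ≤ force p lam η t (A - m * t) * (-τ + 1 * t) := by
    intro t ht
    rcases le_total t τ with h | h
    · have := hmono t τ ht.1 h
      rw [hτ0] at this
      exact mul_nonneg_of_nonpos_of_nonpos this (by linarith)
    · have := hmono τ t hτ.1.le h
      rw [hτ0] at this
      exact mul_nonneg this (by linarith)
  have hne' : force p lam η t₀ (A - m * t₀) * (-τ + 1 * t₀) ≠ 0 := by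
    refine mul_ne_zero hne fun h => hne ?_
    rwa [show t₀ = τ by linarith]
  have hcc : Continuous fun t => force p lam η t (A - m * t) * (-τ + 1 * t) := hc.mul (by fun_prop)
  have := intervalIntegral.integral_pos hx hcc.continuousOn
    (fun t ht => key t ⟨ht.1.le, ht.2⟩) ⟨t₀, ht₀, lt_of_le_of_ne (key t₀ ht₀) hne'.symm⟩
  rw [bal] at this
  exact lt_irrefl _ this

end

section
variable {n k : ℕ} {p : Fin n → ℕ} {lam : Fin n → ℝ} {γ : ℝ → ℝ} {Δ η : ℝ} {c ℓ m : ℕ → ℝ}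

/-- The Parisi measure is the measure of any exact chain. -/
theorem IsExactChain.isStep (M : IsMixture p lam) (hη : 0 < η)
    (C : IsExactChain k (force p lam η) c ℓ m) (h0 : c 0 = 0) (h1 : c (k + 1) = 1)
    (hge : ∀ j ≤ k, ∀ t ∈ Icc (c j) (c (j + 1)), η ≤ ℓ j - m j * t)
    (D : IsDensity γ Δ) (hν : IsParisiMeasure (mixture p lam) (parisi γ Δ)) :
    0 < m 0 ∧ IsStep k c m γ ∧ ∀ j ≤ k, ∀ r s : ℝ,
      ∫ t in c j..c (j + 1), drift p lam (tail γ Δ) t * (r + s * t) = 0 := by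
  have P : IsPartition k c := ⟨h0, h1, C.lt⟩
  have hm0 : 0 < m 0 := by
    refine M.steep_pos_of_bal (x' := c 1) hη ?_ ?_ ?_ (A := ℓ 0)
    · exact h0 ▸ C.lt 0 (Nat.zero_le k)
    · intro t ht; exact hge 0 (Nat.zero_le k) t (by rwa [h0])
    · intro r s; have := C.bal 0 (Nat.zero_le k) r s; rwa [h0] at this
  have hΔ : 0 < ℓ k - m k * 1 := by
    have := hge k le_rfl (c (k + 1)) ⟨(C.lt k le_rfl).le, le_rfl⟩
    rw [h1] at this
    exact hη.trans_le this
  obtain ⟨γ', S⟩ := P.exists_isStep m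
  have D' : IsDensity γ' (ℓ k - m k * 1) := S.isDensity P C.steep_le hm0.le hΔ
  have hN := fun j (hj : j ≤ k) => S.tail_eq P D' C.meet rfl hj
  set N' := tail γ' (ℓ k - m k * 1) with hN'
  have hdc : Continuous (drift p lam N') := D'.continuous_drift
  have hcell : ∀ j ≤ k, ∀ κ : ℝ → ℝ, ∫ t in c j..c (j + 1), drift p lam N' t * κ t =
      ∫ t in c j..c (j + 1), force p lam η t (ℓ j - m j * t) * κ t := by
    intro j hj κ
    refine intervalIntegral.integral_congr fun t ht => ?_
    rw [uIcc_of_le (C.lt j hj).le] at ht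
    simp only [drift, hN j hj t ht, force_of_le (hge j hj t ht)]
  have hsplit : ∀ κ : ℝ → ℝ, Continuous κ → ∫ t in (0 : ℝ)..1, drift p lam N' t * κ t =
      ∑ j ∈ Finset.range (k + 1), ∫ t in c j..c (j + 1), drift p lam N' t * κ t := fun κ hκ =>
    (P.sum_integral (intervalIntegrable_mul hdc hκ 0 1)).symm
  -- The variational inequality splits in two: the chain's own tail is affine on each piece, so
  -- balance kills it, and any competing tail is concave, so the sign pattern makes its integral
  -- nonnegative.
  have hself : ∫ t in (0 : ℝ)..1, drift p lam N' t * N' t = 0 := by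
    rw [hsplit _ D'.continuous_tail]
    refine Finset.sum_eq_zero fun j hj => ?_
    have hj' : j ≤ k := Nat.lt_succ_iff.1 (Finset.mem_range.1 hj)
    rw [hcell j hj', ← C.bal j hj' (ℓ j) (-m j)]
    refine intervalIntegral.integral_congr fun t ht => ?_
    rw [uIcc_of_le (C.lt j hj').le] at ht
    rw [← hN', hN j hj' t ht]
    ring
  have hother : 0 ≤ ∫ t in (0 : ℝ)..1, drift p lam N' t * tail γ Δ t := by
    rw [hsplit _ D.continuous_tail]
    refine Finset.sum_nonneg fun j hj => ?_
    have hj' : j ≤ k := Nat.lt_succ_iff.1 (Finset.mem_range.1 hj)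
    rw [hcell j hj']
    exact integral_mul_nonneg_of_concaveOn (C.lt j hj') (continuous_force_affine hη _ _)
      D.continuous_tail (D.concaveOn_tail.subset (Icc_subset_Icc (P.mem_Icc (by omega)).1
        (P.mem_Icc (by omega)).2) (convex_Icc _ _)) (C.dip j hj') (C.bal j hj')
  have heq : ∀ t ∈ Icc (0 : ℝ) 1, tail γ Δ t = N' t := by
    refine eq_of_energy_le (p := p) (lam := lam) D'.continuous_tail D.continuous_tail
      (fun t _ => D'.tail_pos t) (fun t _ => D.tail_pos t) (D.energy_le M hν D') ?_
    simp_rw [mul_sub]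
    rw [intervalIntegral.integral_sub (intervalIntegrable_mul hdc D.continuous_tail _ _)
      (intervalIntegrable_mul hdc D'.continuous_tail _ _)]
    rw [hself, sub_zero]
    exact hother
  refine ⟨hm0, ⟨fun j hj t ht => ?_, D.zero⟩, fun j hj r s => ?_⟩
  -- The tails agree on `[0, 1]`, and right continuity of `γ` makes `-γ` the right derivative of its
  -- tail; so the densities agree at every point.
  · have ht' := P.mem_Ico hj ht
    have e1 := D.hasDerivWithinAt_tail ht'
    have e2 : HasDerivWithinAt (tail γ Δ) (-m j) (Ici t) t := by
      have h3 : HasDerivWithinAt (fun s => ℓ j - m j * s) (-m j) (Ici t) t := by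
        simpa using (((hasDerivAt_id t).const_mul (m j)).const_sub (ℓ j)).hasDerivWithinAt (s := Ici t)
      have h4 : ∀ s ∈ Ico t (c (j + 1)), tail γ Δ s = ℓ j - m j * s := fun s hs => by
        have hs' : s ∈ Ico (c j) (c (j + 1)) := ⟨ht.1.trans hs.1, hs.2⟩
        rw [heq s (Ico_subset_Icc_self (P.mem_Ico hj hs')), hN j hj s (Ico_subset_Icc_self hs')]
      refine h3.congr_of_eventuallyEq ?_ (h4 t ⟨le_rfl, ht.2⟩)
      filter_upwards [Ico_mem_nhdsGE ht.2] with s hs using h4 s hs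
    have := (uniqueDiffOn_Ici t t self_mem_Ici).eq_deriv _ e1 e2
    linarith
  · rw [← C.bal j hj r s, ← hcell j hj fun t => r + s * t]
    refine intervalIntegral.integral_congr fun t ht => ?_
    rw [uIcc_of_le (C.lt j hj).le] at ht
    simp only [drift, heq t ⟨(P.mem_Icc (by omega)).1.trans ht.1, ht.2.trans (P.mem_Icc (by omega)).2⟩]

/-- The obstacle vanishes at the nodes of an exact chain. -/
theorem IsDensity.obstacle_eq_zero (M : IsMixture p lam) (D : IsDensity γ Δ) (P : IsPartition k c)
    (bal : ∀ j ≤ k, ∀ r s : ℝ, ∫ t in c j..c (j + 1), drift p lam (tail γ Δ) t * (r + s * t) = 0)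
    {l : ℕ} (hl : l ≤ k + 1) : obstacle (mixture p lam) (parisi γ Δ) (c l) = 0 := by
  have hc : Continuous (drift p lam (tail γ Δ)) := D.continuous_drift
  have hii := fun a b => hc.intervalIntegrable (μ := volume) a b
  have hG : ∀ l ≤ k + 1, ∫ r in (0 : ℝ)..c l, drift p lam (tail γ Δ) r = 0 := by
    intro l
    induction l with
    | zero => intro _; rw [P.zero, intervalIntegral.integral_same]
    | succ l ih =>
      intro hl
      rw [← intervalIntegral.integral_add_adjacent_intervals (hii 0 (c l)) (hii _ _), ih (by omega),
        zero_add]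
      simpa using bal l (by omega) 1 0
  have hcell : ∀ l ≤ k, ∫ t in c l..c (l + 1), (∫ r in (0 : ℝ)..t, drift p lam (tail γ Δ) r) = 0 := by
    intro l hl
    rw [integral_primitive_eq hc, hG l (by omega), mul_zero, zero_add, ← bal l hl (c (l + 1)) (-1)]
    congr 1
    funext t
    ring
  have hprim := intervalIntegral.continuous_primitive hii 0
  have hii' := fun a b => hprim.intervalIntegrable (μ := volume) a b
  rw [D.obstacle_eq M (P.mem_Icc hl)]
  have : ∀ d ≤ k + 1, ∫ t in c (k + 1 - d)..1, (∫ r in (0 : ℝ)..t, drift p lam (tail γ Δ) r) = 0 := by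
    intro d
    induction d with
    | zero => intro _; rw [Nat.sub_zero, P.last, intervalIntegral.integral_same]
    | succ d ih =>
      intro hd
      have e : k + 1 - d = k + 1 - (d + 1) + 1 := by omega
      rw [← intervalIntegral.integral_add_adjacent_intervals (hii' _ (c (k + 1 - d))) (hii' _ _),
        ih (by omega), add_zero, e]
      exact hcell _ (by omega)
  have := this (k + 1 - l) (by omega)
  rwa [show k + 1 - (k + 1 - l) = l by omega] at this

end

/-! ### Step densities and replica symmetry breaking -/

section
variable {k : ℕ} {c m : ℕ → ℝ} {γ : ℝ → ℝ} {Δ : ℝ}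

theorem IsStep.sum_indicator (S : IsStep k c m γ) (P : IsPartition k c) (x : ℝ) :
    ∑ i : Fin (k + 1), (Ico (c i) (c (i + 1))).indicator (fun _ => ENNReal.ofReal (m i)) x =
      ENNReal.ofReal (γ x) := by
  by_cases hx : x ∈ Ico (0 : ℝ) 1
  · obtain ⟨j, hj, hxj⟩ := P.exists_cell hx
    rw [Finset.sum_eq_single (⟨j, Nat.lt_succ_iff.2 hj⟩ : Fin (k + 1)), indicator_of_mem hxj,
      S.eq j hj x hxj]
    · intro i _ hij
      refine indicator_of_notMem (fun h => hij ?_) _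
      have hi : (i : ℕ) ≤ k := Nat.lt_succ_iff.1 i.2
      exact Fin.ext (le_antisymm (P.cell_le hi h hxj le_rfl) (P.cell_le hj hxj h le_rfl))
    · intro h; exact absurd (Finset.mem_univ _) h
  · rw [S.zero x hx, ENNReal.ofReal_zero]
    refine Finset.sum_eq_zero fun i _ => indicator_of_notMem (fun h => hx ?_) _
    exact P.mem_Ico (Nat.lt_succ_iff.1 i.2) h

theorem lt_of_steps_lt (hm : ∀ j < k, m j < m (j + 1)) {i j : ℕ} (hij : i < j) (hj : j ≤ k) :
    m i < m j :=
  (hm i (by omega)).trans_le (le_of_steps_le (fun j hj => (hm j hj).le) hij hj)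

theorem IsStep.isRSBWithSupport (S : IsStep k c m γ) (P : IsPartition k c)
    (hm : ∀ j < k, m j < m (j + 1)) (h0 : 0 < m 0) (D : IsDensity γ Δ) :
    IsRSBWithSupport (k + 1) (parisi γ Δ) fun i => c i := by
  refine ⟨fun i j hij => P.lt_of_lt hij (by omega), fun _ => P.zero, P.last, fun i => m i, Δ,
    fun i j hij => lt_of_steps_lt hm hij (by omega), fun i => ?_, D.pos, ?_⟩
  · exact h0.trans_le (le_of_steps_le (fun j hj => (hm j hj).le) (Nat.zero_le _) (by omega))
  · rw [D.parisi_eq]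
    congr 2
    funext x
    exact (S.sum_indicator P x).symm

theorem IsRSBWithSupport.exists_step {ν : Measure ℝ} {q : Fin (k + 1 + 1) → ℝ}
    (h : IsRSBWithSupport (k + 1) ν q) : ∃ (m : ℕ → ℝ) (γ : ℝ → ℝ) (Δ : ℝ),
      IsPartition k (toSeq q) ∧ IsStep k (toSeq q) m γ ∧ (∀ j < k, m j < m (j + 1)) ∧ 0 < m 0 ∧
      IsDensity γ Δ ∧ ν = parisi γ Δ := by
  obtain ⟨hq, h0, h1, m, Δ, hm, hpos, hΔ, rfl⟩ := h
  have hts : ∀ (j : ℕ) (hj : j < k + 1 + 1), toSeq q j = q ⟨j, hj⟩ := fun j hj => dif_pos hj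
  have P : IsPartition k (toSeq q) := by
    refine ⟨?_, ?_, fun j hj => ?_⟩
    · rw [hts 0 (by omega)]; exact h0 (by omega)
    · rw [hts (k + 1) (by omega)]; exact h1
    · rw [hts j (by omega), hts (j + 1) (by omega)]
      exact hq (Fin.mk_lt_mk.2 (by omega))
  set m' : ℕ → ℝ := fun j => if hj : j < k + 1 then m ⟨j, hj⟩ else 0 with hm'
  have hmv : ∀ (j : ℕ) (hj : j < k + 1), m' j = m ⟨j, hj⟩ := fun j hj => dif_pos hj
  obtain ⟨γ, S⟩ := P.exists_isStep m'
  have hstrict : ∀ j < k, m' j < m' (j + 1) := fun j hj => by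
    rw [hmv j (by omega), hmv (j + 1) (by omega)]
    exact hm (Fin.mk_lt_mk.2 (by omega))
  have hm0 : 0 < m' 0 := by rw [hmv 0 (by omega)]; exact hpos _
  have D : IsDensity γ Δ := S.isDensity P (fun j hj => (hstrict j hj).le) hm0.le hΔ
  refine ⟨m', γ, Δ, P, S, hstrict, hm0, D, ?_⟩
  rw [D.parisi_eq]
  congr 2
  funext x
  rw [← S.sum_indicator P x]
  refine Finset.sum_congr rfl fun i _ => ?_
  rw [hts i (by omega), hts (i + 1) (by omega), hmv i i.2]
  rfl

/-- Removing a node where the density does not jump. -/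
theorem IsStep.remove_node (S : IsStep (k + 1) c m γ) (P : IsPartition (k + 1) c) {l : ℕ}
    (hl : l ≤ k) (heq : m l = m (l + 1)) :
    IsPartition k (fun i => if i ≤ l then c i else c (i + 1)) ∧
    IsStep k (fun i => if i ≤ l then c i else c (i + 1)) (fun i => if i ≤ l then m i else m (i + 1))
      γ := by
  refine ⟨⟨by simp [P.zero], ?_, fun j hj => ?_⟩, fun j hj t ht => ?_, S.zero⟩
  · simp only [if_neg (show ¬k + 1 ≤ l by omega), P.last]
  · rcases lt_trichotomy j l with h | rfl | h
    · simp only [if_pos h.le, if_pos (Nat.succ_le_of_lt h)]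
      exact P.lt j (by omega)
    · simp only [le_refl, if_true, if_neg (show ¬j + 1 ≤ j by omega)]
      exact P.lt_of_lt (by omega) (by omega)
    · simp only [if_neg (show ¬j ≤ l by omega), if_neg (show ¬j + 1 ≤ l by omega)]
      exact P.lt (j + 1) (by omega)
  · rcases lt_trichotomy j l with h | rfl | h
    · simp only [if_pos h.le, if_pos (Nat.succ_le_of_lt h)] at ht ⊢
      exact S.eq j (by omega) t ht
    · simp only [le_refl, if_true, if_neg (show ¬j + 1 ≤ j by omega)] at ht ⊢
      rcases lt_or_ge t (c (j + 1)) with h' | h'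
      · exact S.eq j (by omega) t ⟨ht.1, h'⟩
      · rw [heq]; exact S.eq (j + 1) (by omega) t ⟨h', ht.2⟩
    · simp only [if_neg (show ¬j ≤ l by omega), if_neg (show ¬j + 1 ≤ l by omega)] at ht ⊢
      exact S.eq (j + 1) (by omega) t ht

/-- A step density with nonstrict jumps has fewer proper nodes. -/
theorem IsStep.exists_strict (S : IsStep k c m γ) (P : IsPartition k c)
    (hm : ∀ j < k, m j ≤ m (j + 1)) (h0 : 0 < m 0) : ∃ k' ≤ k, ∃ c' m' : ℕ → ℝ,
      IsPartition k' c' ∧ IsStep k' c' m' γ ∧ (∀ j < k', m' j < m' (j + 1)) ∧ 0 < m' 0 ∧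
      (∀ i ≤ k' + 1, ∃ l ≤ k + 1, c' i = c l) ∧
      ((∃ l < k, m l = m (l + 1)) → k' < k ∧ ∃ l ≤ k + 1, ∀ i ≤ k' + 1, c' i ≠ c l) := by
  induction k generalizing c m with
  | zero => exact ⟨0, le_rfl, c, m, P, S, by simp, h0, fun i hi => ⟨i, hi, rfl⟩, by simp⟩
  | succ k ih =>
    by_cases hs : ∃ l < k + 1, m l = m (l + 1)
    · obtain ⟨l, hl, heq⟩ := hs
      have hl' : l ≤ k := Nat.lt_succ_iff.1 hl
      -- Node `l + 1` is dropped. The induction hypothesis only selects among the remaining nodes,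
      -- so this one stays absent.
      obtain ⟨P', S'⟩ := S.remove_node P hl' heq
      have hmem : ∀ i ≤ k + 1, ∃ r ≤ k + 1 + 1, r ≠ l + 1 ∧
          (if i ≤ l then c i else c (i + 1)) = c r := by
        intro i hi
        by_cases h : i ≤ l
        · exact ⟨i, by omega, by omega, if_pos h⟩
        · exact ⟨i + 1, by omega, by omega, if_neg h⟩
      obtain ⟨k', hk', c', m', P'', S'', hlt, hpos, hr, -⟩ := ih S' P' (fun j hj => by
        rcases lt_trichotomy j l with h | rfl | h
        · simp only [if_pos h.le, if_pos (Nat.succ_le_of_lt h)]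
          exact hm j (by omega)
        · simp only [le_refl, if_true, if_neg (show ¬j + 1 ≤ j by omega)]
          exact (hm j (by omega)).trans (hm (j + 1) (by omega))
        · simp only [if_neg (show ¬j ≤ l by omega), if_neg (show ¬j + 1 ≤ l by omega)]
          exact hm (j + 1) (by omega)) (by simpa using h0)
      refine ⟨k', by omega, c', m', P'', S'', hlt, hpos, fun i hi => ?_, fun _ =>
        ⟨by omega, l + 1, by omega, fun i hi h => ?_⟩⟩
      · obtain ⟨r, hr1, hr2⟩ := hr i hi
        obtain ⟨s, hs1, -, hs2⟩ := hmem r hr1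
        exact ⟨s, hs1, hr2.trans hs2⟩
      · obtain ⟨r, hr1, hr2⟩ := hr i hi
        obtain ⟨s, hs1, hs3, hs2⟩ := hmem r hr1
        have e : c s = c (l + 1) := hs2.symm.trans (hr2.symm.trans h)
        rcases lt_or_gt_of_ne hs3 with h' | h'
        · exact (P.lt_of_lt h' (by omega)).ne e
        · exact (P.lt_of_lt h' (by omega)).ne' e
    · refine ⟨k + 1, le_rfl, c, m, P, S, fun j hj => ?_, h0, fun i hi => ⟨i, hi, rfl⟩,
        fun h => absurd h hs⟩
      exact lt_of_le_of_ne (hm j hj) fun h => hs ⟨j, hj, h⟩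

end

section
variable {k : ℕ} {p : Fin (k + 1) → ℕ} {lam : Fin (k + 1) → ℝ} {ν : Measure ℝ}

/-- A nondegenerate Parisi measure is `n`-RSB if `𝓗^n` has a point between `0` and `1`. -/
theorem IsMixture.isRSB_of_kappa (M : IsMixture p lam) (hk : 1 ≤ k)
    (hν : IsParisiMeasure (mixture p lam) ν) (hnd : IsNondegenerate (k + 1) (mixture p lam) ν)
    {x : ℕ → ℝ} (hx0 : x 0 = 0) (hx1 : x (k + 1) = 1) (K : Kappa (mixture p lam) (k + 1) x) :
    IsRSB (k + 1) ν := by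
  obtain ⟨η, hη, c, ℓ, m, C, h0, h1, hge⟩ := M.exists_exactChain hk hx0 K
  obtain ⟨γ, Δ, D, rfl⟩ := hν.exists_density M
  rw [hx1] at h1
  have P : IsPartition k c := ⟨h0, h1, C.lt⟩
  obtain ⟨hm0, S, bal⟩ := C.isStep M hη h0 h1 hge D hν
  by_cases hs : ∃ l < k, m l = m (l + 1)
  · obtain ⟨k', hk', c', m', P', S', hlt, hpos, -, hstr⟩ := S.exists_strict P C.steep_le hm0
    obtain ⟨hk'', l, hl, hne⟩ := hstr hs
    -- The discarded node of the chain is off the support of a measure with fewer than `n` steps;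
    -- nondegeneracy makes `g` positive there, while balance makes it zero.
    have := hnd (k' + 1) (by omega) _ (S'.isRSBWithSupport P' hlt hpos D) (c l) (P.mem_Icc hl) (by
      rintro ⟨i, hi⟩
      exact hne i (by omega) hi)
    rw [D.obstacle_eq_zero M P bal hl] at this
    exact absurd this (lt_irrefl _)
  · refine ⟨_, S.isRSBWithSupport P (fun j hj => ?_) hm0 D⟩
    exact lt_of_le_of_ne (C.steep_le j hj) fun h => hs ⟨j, hj, h⟩

end

/-! ### First variations of the functional -/

section
variable {n k : ℕ} {p : Fin n → ℕ} {lam : Fin n → ℝ} {γ : ℝ → ℝ} {Δ : ℝ} {c m : ℕ → ℝ}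

/-- The energy increment along `κ` is `s` times the integral plus at most `s² B`. The bound `B`
comes from `N ≥ Δ`, and from the perturbed tail being at least `Δ / 2` for `s ≤ Δ / 2`. -/
theorem IsDensity.first_variation (M : IsMixture p lam) (D : IsDensity γ Δ)
    (hν : IsParisiMeasure (mixture p lam) (parisi γ Δ)) {κ : ℝ → ℝ}
    (hb : ∀ t ∈ Icc (0 : ℝ) 1, |κ t| ≤ 1) {s₀ : ℝ} (hs₀ : 0 < s₀)
    (hadm : ∀ s, 0 < s → s ≤ s₀ → ∃ γ' Δ', IsDensity γ' Δ' ∧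
      ∀ t ∈ Icc (0 : ℝ) 1, tail γ' Δ' t = tail γ Δ t + s * κ t) :
    0 ≤ ∫ t in (0 : ℝ)..1, drift p lam (tail γ Δ) t * κ t := by
  set I := ∫ t in (0 : ℝ)..1, drift p lam (tail γ Δ) t * κ t with hI
  have hΔ := D.pos
  set B := (Δ / 2 * Δ ^ 2)⁻¹ with hB
  have hB0 : 0 < B := by positivity
  have key : ∀ s, 0 < s → s ≤ s₀ → s ≤ Δ / 2 → 0 ≤ I + s * B := by
    intro s hs h1 h2
    obtain ⟨γ', Δ', D', hN⟩ := hadm s hs h1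
    have e := energy_sub_energy (p := p) (lam := lam) D.continuous_tail D'.continuous_tail
      (fun t _ => D.tail_pos t) fun t _ => D'.tail_pos t
    have e1 : ∫ t in (0 : ℝ)..1, drift p lam (tail γ Δ) t * (tail γ' Δ' t - tail γ Δ t) = s * I := by
      rw [hI, ← intervalIntegral.integral_const_mul]
      refine intervalIntegral.integral_congr fun t ht => ?_
      rw [uIcc_of_le zero_le_one] at ht
      rw [hN t ht]
      ring
    have e2 : ∫ t in (0 : ℝ)..1, (tail γ' Δ' t - tail γ Δ t) ^ 2 / (tail γ' Δ' t * tail γ Δ t ^ 2) ≤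
        s ^ 2 * B := by
      have hb2 : ∀ t ∈ Icc (0 : ℝ) 1,
          (tail γ' Δ' t - tail γ Δ t) ^ 2 / (tail γ' Δ' t * tail γ Δ t ^ 2) ≤ s ^ 2 * B := by
        intro t ht
        have g1 := D.le_tail' t
        have g2 := abs_le.1 (hb t ht)
        have g3 : Δ / 2 ≤ tail γ' Δ' t := by
          rw [hN t ht]
          nlinarith
        rw [hN t ht, add_sub_cancel_left, mul_pow, ← hN t ht, hB, ← div_eq_mul_inv]
        have g4 : κ t ^ 2 ≤ 1 := by nlinarith
        refine div_le_div₀ (by positivity) (by nlinarith [sq_nonneg s]) (by positivity) ?_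
        exact mul_le_mul g3 (pow_le_pow_left₀ hΔ.le g1 2) (by positivity) (D'.tail_pos t).le
      calc _ ≤ ∫ _ in (0 : ℝ)..1, s ^ 2 * B := by
            refine intervalIntegral.integral_mono_on zero_le_one ?_ intervalIntegrable_const hb2
            refine Continuous.intervalIntegrable ?_ _ _
            exact ((D'.continuous_tail.sub D.continuous_tail).pow 2).div
              (D'.continuous_tail.mul (D.continuous_tail.pow 2)) fun t =>
                (mul_pos (D'.tail_pos t) (pow_pos (D.tail_pos t) 2)).ne'
        _ = s ^ 2 * B := by simp
    have e3 := D.energy_le M hν D'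
    have : 0 ≤ s * (I + s * B) := by nlinarith
    exact nonneg_of_mul_nonneg_right this hs
  by_contra hneg
  rw [not_le] at hneg
  set s := min (min s₀ (Δ / 2)) (-I / (2 * B)) with hs
  have hsp : 0 < s := lt_min (lt_min hs₀ (by positivity)) (div_pos (by linarith) (by positivity))
  have h1 := key s hsp ((min_le_left _ _).trans (min_le_left _ _))
    ((min_le_left _ _).trans (min_le_right _ _))
  have h2 : s ≤ -I / (2 * B) := min_le_right _ _
  rw [le_div_iff₀ (by positivity)] at h2
  linarith

theorem IsDensity.const_mass (D : IsDensity γ Δ) {Δ' : ℝ} (h : 0 < Δ') : IsDensity γ Δ' :=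
  ⟨D.nonneg, D.cont, D.mono, h, D.zero, D.integrable⟩

/-- The mass at `1` can be moved both ways, which shifts the tail by a constant. -/
theorem IsDensity.integral_drift (M : IsMixture p lam) (D : IsDensity γ Δ)
    (hν : IsParisiMeasure (mixture p lam) (parisi γ Δ)) :
    ∫ t in (0 : ℝ)..1, drift p lam (tail γ Δ) t = 0 := by
  have h1 := D.first_variation M hν (κ := fun _ => 1) (by simp) one_pos
    fun s hs _ => ⟨γ, Δ + s, D.const_mass (by linarith [D.pos]), fun t _ => by unfold tail; ring⟩
  have h2 := D.first_variation M hν (κ := fun _ => -1) (by simp)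
    (half_pos D.pos) fun s hs hs' => ⟨γ, Δ - s, D.const_mass (by linarith [D.pos]), fun t _ => by
      unfold tail; ring⟩
  simp only [mul_one, mul_neg, intervalIntegral.integral_neg] at h1 h2
  linarith

/-- The indicator function of `[u, 1)`. -/
def unitStep (u : ℝ) : ℝ → ℝ := (Ico u 1).indicator fun _ => 1

theorem unitStep_of_mem {u x : ℝ} (h1 : u ≤ x) (h2 : x < 1) : unitStep u x = 1 :=
  indicator_of_mem (mem_Ico.2 ⟨h1, h2⟩) _

theorem unitStep_of_lt {u x : ℝ} (h : x < u) : unitStep u x = 0 :=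
  indicator_of_notMem (fun h' => absurd (mem_Ico.1 h').1 (not_le.2 h)) _

theorem integral_unitStep {u t : ℝ} (hu : u ≤ 1) (ht : t ≤ 1) :
    ∫ s in t..1, unitStep u s = 1 - max t u := by
  have hint : ∀ a b, IntervalIntegrable (unitStep u) volume a b := fun a b =>
    ((integrable_indicator_iff measurableSet_Ico).2 (by simp)).intervalIntegrable
  have h1 : ∀ a, u ≤ a → a ≤ 1 → ∫ s in a..1, unitStep u s = 1 - a := by
    intro a ha ha1
    rw [intervalIntegral.integral_congr_Ioo_of_le (g := fun _ => 1) ha1 fun r hr =>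
      unitStep_of_mem (ha.trans hr.1.le) hr.2]
    simp
  rcases le_total u t with h | h
  · rw [h1 t h ht, max_eq_left h]
  · rw [← intervalIntegral.integral_add_adjacent_intervals (hint t u) (hint u 1), h1 u le_rfl hu,
      max_eq_right h, intervalIntegral.integral_congr_Ioo_of_le (g := fun _ => 0) h fun r hr =>
      unitStep_of_lt hr.2]
    simp

theorem isDensity_unitStep {u : ℝ} (hu : 0 ≤ u) : IsDensity (unitStep u) 1 where
  nonneg x _ := indicator_nonneg (fun _ _ => zero_le_one) x
  cont x hx := by
    rcases le_or_gt u x with h | h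
    · refine (continuousWithinAt_const (b := 1)).congr_of_eventuallyEq ?_
        (unitStep_of_mem h hx.2)
      filter_upwards [Ico_mem_nhdsGE hx.2] with y hy
      exact unitStep_of_mem (h.trans hy.1) hy.2
    · refine (continuousWithinAt_const (b := 0)).congr_of_eventuallyEq ?_
        (unitStep_of_lt h)
      filter_upwards [Ico_mem_nhdsGE h] with y hy
      exact unitStep_of_lt hy.2
  mono := by
    intro x _ y hy hxy
    rcases le_or_gt u x with h | h
    · exact (unitStep_of_mem h (hxy.trans_lt hy.2)).trans_le
        (unitStep_of_mem (h.trans hxy) hy.2).ge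
    · exact (unitStep_of_lt h).trans_le
        (indicator_nonneg (fun _ _ => zero_le_one) y)
  pos := one_pos
  zero x hx := indicator_of_notMem (fun h => hx ⟨hu.trans h.1, h.2⟩) _
  integrable := (integrable_indicator_iff measurableSet_Ico).2 (by simp)

theorem IsDensity.add_mul (D : IsDensity γ Δ) {γ₁ : ℝ → ℝ} {Δ₁ : ℝ} (D₁ : IsDensity γ₁ Δ₁) {s : ℝ}
    (hs : 0 ≤ s) : IsDensity (fun x => γ x + s * γ₁ x) Δ where
  nonneg x hx := add_nonneg (D.nonneg x hx) (mul_nonneg hs (D₁.nonneg x hx))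
  cont x hx := (D.cont x hx).add (continuousWithinAt_const.mul (D₁.cont x hx))
  mono x hx y hy hxy := add_le_add (D.mono hx hy hxy)
    (mul_le_mul_of_nonneg_left (D₁.mono hx hy hxy) hs)
  pos := D.pos
  zero x hx := by rw [D.zero x hx, D₁.zero x hx, mul_zero, add_zero]
  integrable := D.integrable.add (D₁.integrable.const_mul s)

theorem IsDensity.tail_add_mul_unitStep (D : IsDensity γ Δ) {u s t : ℝ} (hu : u ∈ Icc (0 : ℝ) 1)
    (ht : t ≤ 1) :
    tail (fun x => γ x + s * unitStep u x) Δ t = tail γ Δ t + s * (1 - max t u) := by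
  rw [tail, intervalIntegral.integral_add (D.intervalIntegrable _ _)
    (((isDensity_unitStep hu.1).intervalIntegrable _ _).const_mul s),
    intervalIntegral.integral_const_mul, integral_unitStep hu.2 ht, tail]
  ring

theorem abs_one_sub_max_le {u t : ℝ} (hu : u ∈ Icc (0 : ℝ) 1) (ht : t ∈ Icc (0 : ℝ) 1) :
    |1 - max t u| ≤ 1 := by
  have h1 := max_le ht.2 hu.2
  have h2 := ht.1.trans (le_max_left t u)
  rw [abs_le]
  constructor <;> linarith

/-- The first variation in the direction of `1_{[u, 1)}` is the obstacle function. -/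
theorem integral_mul_one_sub_max {q : ℝ → ℝ} (hq : Continuous q) {u : ℝ} (hu : u ∈ Icc (0 : ℝ) 1) :
    ∫ t in (0 : ℝ)..1, q t * (1 - max t u) = ∫ t in u..1, (∫ r in (0 : ℝ)..t, q r) := by
  have hc : Continuous fun t => 1 - max t u := by fun_prop
  rw [← intervalIntegral.integral_add_adjacent_intervals (intervalIntegrable_mul hq hc 0 u)
    (intervalIntegrable_mul hq hc u 1), integral_primitive_eq hq]
  congr 1
  · rw [← intervalIntegral.integral_const_mul]
    refine intervalIntegral.integral_congr fun t ht => ?_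
    rw [uIcc_of_le hu.1] at ht
    rw [max_eq_right ht.2, mul_comm]
  · refine intervalIntegral.integral_congr fun t ht => ?_
    rw [uIcc_of_le hu.2] at ht
    simp only [max_eq_left ht.1]

/-- Adding a multiple of `1_{[u,1)}` to the density is always admissible; the resulting first
variation is `g(u)`. -/
theorem IsDensity.integral_primitive_nonneg (M : IsMixture p lam) (D : IsDensity γ Δ)
    (hν : IsParisiMeasure (mixture p lam) (parisi γ Δ)) {u : ℝ} (hu : u ∈ Icc (0 : ℝ) 1) :
    0 ≤ ∫ t in u..1, (∫ r in (0 : ℝ)..t, drift p lam (tail γ Δ) r) := by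
  rw [← integral_mul_one_sub_max D.continuous_drift hu]
  exact D.first_variation M hν (fun t ht => abs_one_sub_max_le hu ht) one_pos
    fun s hs _ => ⟨_, Δ, D.add_mul (isDensity_unitStep hu.1) hs.le,
      fun t ht => D.tail_add_mul_unitStep hu ht.2⟩

theorem IsStep.sub_unitStep (S : IsStep k c m γ) (P : IsPartition k c) {l : ℕ} (hl : l ≤ k) (s : ℝ) :
    IsStep k c (fun j => if j < l then m j else m j + -s) fun x => γ x + -s * unitStep (c l) x where
  eq j hj t ht := by
    have ht1 := P.mem_Ico hj ht
    rw [S.eq j hj t ht]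
    split_ifs with h
    · rw [unitStep, indicator_of_notMem]
      · ring
      · intro h'
        have := P.le_of_le (i := j + 1) (j := l) (by omega) (by omega)
        linarith [ht.2, h'.1]
    · rw [unitStep, indicator_of_mem, mul_one]
      exact ⟨(P.le_of_le (by omega) (by omega)).trans ht.1, ht1.2⟩
  zero t ht := by
    rw [S.zero t ht, unitStep, indicator_of_notMem fun h =>
      ht ⟨(P.mem_Icc (by omega)).1.trans h.1, h.2⟩]
    ring

/-- The obstacle function vanishes where the density jumps. -/
theorem IsStep.integral_primitive_eq_zero (S : IsStep k c m γ) (P : IsPartition k c)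
    (hm : ∀ j < k, m j < m (j + 1)) (h0 : 0 < m 0) (M : IsMixture p lam) (D : IsDensity γ Δ)
    (hν : IsParisiMeasure (mixture p lam) (parisi γ Δ)) {l : ℕ} (hl : l ≤ k + 1) :
    ∫ t in c l..1, (∫ r in (0 : ℝ)..t, drift p lam (tail γ Δ) r) = 0 := by
  rcases hl.eq_or_lt with rfl | hl
  · rw [P.last, intervalIntegral.integral_same]
  have hu := P.mem_Icc hl.le
  refine le_antisymm ?_ (D.integral_primitive_nonneg M hν hu)
  -- The reverse variation, subtracting `s 1_{[c l, 1)}`, stays admissible while `s` is at most the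
  -- jump at `c l` and `m 0`; at `l = 0` the latter is itself the jump.
  obtain ⟨s₀, hs₀, hs₁, hs₂⟩ : ∃ s₀ > 0, s₀ ≤ m 0 ∧ ∀ j, j + 1 = l → m j ≤ m (j + 1) - s₀ := by
    rcases l.eq_zero_or_pos with rfl | hpos
    · exact ⟨m 0, h0, le_rfl, fun j hj => absurd hj (by omega)⟩
    · obtain ⟨j, rfl⟩ := Nat.exists_eq_add_of_le' hpos
      refine ⟨min (m 0) (m (j + 1) - m j), lt_min h0 (sub_pos.2 (hm j (by omega))), min_le_left _ _,
        fun i hi => ?_⟩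
      obtain rfl : i = j := by omega
      linarith [min_le_right (m 0) (m (i + 1) - m i)]
  have h := D.first_variation M hν (κ := fun t => -(1 - max t (c l)))
    (fun t ht => by rw [abs_neg]; exact abs_one_sub_max_le hu ht) hs₀ fun s hs hs' => by
      refine ⟨_, Δ, (S.sub_unitStep P (Nat.lt_succ_iff.1 hl) s).isDensity P (fun j hj => ?_) ?_ D.pos,
        fun t ht => ?_⟩
      · have := hm j hj
        split_ifs with h1 h2 h2
        · exact this.le
        · have := hs₂ j (by omega); linarith
        · omega
        · linarith
      · split_ifs
        · exact h0.le
        · linarith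
      · rw [D.tail_add_mul_unitStep hu ht.2]
        ring
  simp only [mul_neg, intervalIntegral.integral_neg] at h
  rw [integral_mul_one_sub_max D.continuous_drift hu] at h
  linarith

end

/-! ### From replica symmetry breaking to `𝓗` -/

/-- Let `g(u) = ∫_u^1 G` with `G' = q`. If `g ≥ 0` on `[0, 1]`, with equality at `x`, and `G(x) = 0`,
then `q(x) ≤ 0`. -/
theorem nonpos_of_integral_primitive {q : ℝ → ℝ} (hq : Continuous q) {x : ℝ} (hx0 : 0 < x)
    (hg : ∀ u ∈ Icc 0 x, 0 ≤ ∫ t in u..1, (∫ r in (0 : ℝ)..t, q r))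
    (hgx : ∫ t in x..1, (∫ r in (0 : ℝ)..t, q r) = 0) (hG : ∫ r in (0 : ℝ)..x, q r = 0) :
    q x ≤ 0 := by
  by_contra h
  rw [not_le] at h
  have hii := fun a b => hq.intervalIntegrable (μ := volume) a b
  have hprim := intervalIntegral.continuous_primitive hii 0
  have hii' := fun a b => hprim.intervalIntegrable (μ := volume) a b
  obtain ⟨ε, hε, hball⟩ := Metric.eventually_nhds_iff.1 (hq.continuousAt.eventually (lt_mem_nhds h))
  -- If `q(x) > 0`, then `G < 0` just to the left of `x`, so `g(y)`, which is `∫_y^x G`, would be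
  -- negative.
  set y := max 0 (x - ε / 2) with hy
  have hyx : y < x := max_lt hx0 (by linarith)
  have hqp : ∀ t ∈ Icc y x, 0 < q t := fun t ht => hball (by
    have := (le_max_right 0 (x - ε / 2)).trans ht.1
    rw [Real.dist_eq, abs_lt]
    constructor <;> linarith [ht.2])
  have hGneg : ∀ t ∈ Ico y x, ∫ r in (0 : ℝ)..t, q r < 0 := by
    intro t ht
    have h1 := intervalIntegral.integral_add_adjacent_intervals (hii 0 t) (hii t x)
    have h2 := intervalIntegral.integral_pos ht.2 hq.continuousOn
      (fun r hr => (hqp r ⟨ht.1.trans hr.1.le, hr.2⟩).le) ⟨t, ⟨le_rfl, ht.2.le⟩, hqp t ⟨ht.1, ht.2.le⟩⟩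
    linarith
  have h3 := intervalIntegral.integral_pos (f := fun t => -∫ r in (0 : ℝ)..t, q r) hyx
    hprim.neg.continuousOn (fun t ht => by
      rcases ht.2.eq_or_lt with rfl | h'
      · rw [hG, neg_zero]
      · exact (neg_pos.2 (hGneg t ⟨ht.1.le, h'⟩)).le) ⟨y, ⟨le_rfl, hyx.le⟩, neg_pos.2 (hGneg y ⟨le_rfl, hyx⟩)⟩
  rw [intervalIntegral.integral_neg] at h3
  have h4 := hg y ⟨le_max_left _ _, hyx.le⟩
  rw [← intervalIntegral.integral_add_adjacent_intervals (hii' y x) (hii' x 1), hgx] at h4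
  linarith

section
variable {n k : ℕ} {p : Fin n → ℕ} {lam : Fin n → ℝ} {γ : ℝ → ℝ} {Δ : ℝ} {c m : ℕ → ℝ}

/-- The nodes are critical points of the obstacle function. -/
theorem IsStep.integral_drift_eq_zero (S : IsStep k c m γ) (P : IsPartition k c)
    (hm : ∀ j < k, m j < m (j + 1)) (h0 : 0 < m 0) (M : IsMixture p lam) (D : IsDensity γ Δ)
    (hν : IsParisiMeasure (mixture p lam) (parisi γ Δ)) {l : ℕ} (hl : l ≤ k + 1) :
    ∫ r in (0 : ℝ)..c l, drift p lam (tail γ Δ) r = 0 := by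
  rcases l.eq_zero_or_pos with rfl | hpos
  · rw [P.zero, intervalIntegral.integral_same]
  rcases hl.eq_or_lt with rfl | hlt
  · rw [P.last]; exact D.integral_drift M hν
  have hc : Continuous (drift p lam (tail γ Δ)) := D.continuous_drift
  have hprim := intervalIntegral.continuous_primitive
    (fun a b => hc.intervalIntegrable (μ := volume) a b) 0
  have hi0 : 0 < c l := P.zero ▸ P.lt_of_lt hpos hl
  have hi1 : c l < 1 := P.last ▸ P.lt_of_lt hlt le_rfl
  -- At an interior node `g` attains its minimum `0`, and its derivative there is minus the integral
  -- in question.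
  have hmin : IsLocalMin (fun u => ∫ t in u..1, (∫ r in (0 : ℝ)..t, drift p lam (tail γ Δ) r))
      (c l) := by
    filter_upwards [Icc_mem_nhds hi0 hi1] with u hu
    rw [S.integral_primitive_eq_zero P hm h0 M D hν hl]
    exact D.integral_primitive_nonneg M hν hu
  have hd := intervalIntegral.integral_hasDerivAt_left (hprim.intervalIntegrable (c l) 1)
    (hprim.stronglyMeasurableAtFilter _ _) hprim.continuousAt
  have := hmin.hasDerivAt_eq_zero hd
  linarith

/-- In other words, the tail is at most `ψ` at the nodes: `g` has a minimum there, and its second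
derivative is minus the force. -/
theorem IsStep.drift_nonpos (S : IsStep k c m γ) (P : IsPartition k c)
    (hm : ∀ j < k, m j < m (j + 1)) (h0 : 0 < m 0) (M : IsMixture p lam) (D : IsDensity γ Δ)
    (hν : IsParisiMeasure (mixture p lam) (parisi γ Δ)) {l : ℕ} (hl0 : 1 ≤ l) (hl : l ≤ k + 1) :
    drift p lam (tail γ Δ) (c l) ≤ 0 :=
  nonpos_of_integral_primitive D.continuous_drift (P.zero ▸ P.lt_of_lt hl0 hl)
    (fun _ hu => D.integral_primitive_nonneg M hν ⟨hu.1, hu.2.trans (P.mem_Icc hl).2⟩)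
    (S.integral_primitive_eq_zero P hm h0 M D hν hl) (S.integral_drift_eq_zero P hm h0 M D hν hl)

theorem IsStep.tail_eq_seg (S : IsStep k c m γ) (P : IsPartition k c) (D : IsDensity γ Δ) {j : ℕ}
    (hj : j ≤ k) : steep (c j) (c (j + 1)) (tail γ Δ (c j)) (tail γ Δ (c (j + 1))) = m j ∧
      ∀ t ∈ Icc (c j) (c (j + 1)),
        tail γ Δ t = seg (c j) (c (j + 1)) (tail γ Δ (c j)) (tail γ Δ (c (j + 1))) t := by
  have hlt := P.lt j hj
  have e : steep (c j) (c (j + 1)) (tail γ Δ (c j)) (tail γ Δ (c (j + 1))) = m j := by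
    rw [steep, S.tail_sub_tail D hj le_rfl hlt.le le_rfl, mul_div_cancel_right₀ _ (sub_pos.2 hlt).ne']
  refine ⟨e, fun t ht => ?_⟩
  rw [seg_eq_left hlt, e]
  have := S.tail_sub_tail D hj le_rfl ht.1 ht.2
  linarith

/-- The balance of the force on the cells. -/
theorem IsStep.integral_force (S : IsStep k c m γ) (P : IsPartition k c)
    (hm : ∀ j < k, m j < m (j + 1)) (h0 : 0 < m 0) (M : IsMixture p lam) (D : IsDensity γ Δ)
    (hν : IsParisiMeasure (mixture p lam) (parisi γ Δ)) {j : ℕ} (hj : j ≤ k) :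
    ∫ t in c j..c (j + 1), force p lam Δ t
      (seg (c j) (c (j + 1)) (tail γ Δ (c j)) (tail γ Δ (c (j + 1))) t) = 0 ∧
    ∫ t in c j..c (j + 1), force p lam Δ t
      (seg (c j) (c (j + 1)) (tail γ Δ (c j)) (tail γ Δ (c (j + 1))) t) * (c (j + 1) - t) = 0 := by
  have hc : Continuous (drift p lam (tail γ Δ)) := D.continuous_drift
  have hii := fun a b => hc.intervalIntegrable (μ := volume) a b
  have hprim := intervalIntegral.continuous_primitive hii 0
  have hii' := fun a b => hprim.intervalIntegrable (μ := volume) a b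
  have hG := fun l hl => S.integral_drift_eq_zero P hm h0 M D hν (l := l) hl
  have hg := fun l hl => S.integral_primitive_eq_zero P hm h0 M D hν (l := l) hl
  have hforce : ∀ t ∈ Icc (c j) (c (j + 1)), force p lam Δ t
      (seg (c j) (c (j + 1)) (tail γ Δ (c j)) (tail γ Δ (c (j + 1))) t) =
      drift p lam (tail γ Δ) t := fun t ht => by
    rw [← (S.tail_eq_seg P D hj).2 t ht, force_of_le (D.le_tail' t), drift]
  constructor
  · rw [intervalIntegral.integral_congr (g := drift p lam (tail γ Δ)) fun t ht =>
      hforce t (uIcc_of_le (P.lt j hj).le ▸ ht)]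
    have := intervalIntegral.integral_add_adjacent_intervals (hii 0 (c j)) (hii (c j) (c (j + 1)))
    rw [hG j (by omega), hG (j + 1) (by omega), zero_add] at this
    exact this
  · rw [intervalIntegral.integral_congr
      (g := fun t => drift p lam (tail γ Δ) t * (c (j + 1) - t)) fun t ht => by
        simp only [hforce t (uIcc_of_le (P.lt j hj).le ▸ ht)]]
    have h1 := integral_primitive_eq hc (c j) (c (j + 1))
    have h2 := intervalIntegral.integral_add_adjacent_intervals (hii' (c j) (c (j + 1)))
      (hii' (c (j + 1)) 1)
    rw [hg j (by omega), hg (j + 1) (by omega), add_zero] at h2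
    rw [h2, hG j (by omega), mul_zero, zero_add] at h1
    exact h1.symm

end

section
variable {k : ℕ} {p : Fin (k + 1) → ℕ} {lam : Fin (k + 1) → ℝ} {γ : ℝ → ℝ} {Δ : ℝ} {c m : ℕ → ℝ}

/-- The nodes of a Parisi measure with `k + 1` steps satisfy the condition defining `𝓗`. -/
theorem IsStep.kappa (S : IsStep k c m γ) (P : IsPartition k c) (hk : 1 ≤ k)
    (hm : ∀ j < k, m j < m (j + 1)) (h0 : 0 < m 0) (M : IsMixture p lam) (D : IsDensity γ Δ)
    (hν : IsParisiMeasure (mixture p lam) (parisi γ Δ)) : Kappa (mixture p lam) (k + 1) c := by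
  have h1 : 1 ≤ k + 1 := by omega
  have h2 : 2 ≤ k + 1 := by omega
  have hx : ∀ l, 1 ≤ l → l ≤ k + 1 → c (l - 1) < c l := fun l hl1 hl2 => by
    obtain ⟨j, rfl⟩ := Nat.exists_eq_add_of_le' hl1
    exact P.lt j (by omega)
  set N := tail γ Δ with hN
  have hNp : ∀ t, 0 < N t := D.tail_pos
  -- At the last node the polygon with parameter `w` has the squared value `cellInv / w`. By balance
  -- on the last cell this is `N(1)²` precisely for this `w`; the common products then propagate
  -- equality to all nodes.
  set w := N (c k) / N (c (k + 1)) with hwdef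
  have hw : 0 < w := div_pos (hNp _) (hNp _)
  have hmul : ∀ j ≤ k, N (c j) * N (c (j + 1)) = cellInv (mixture p lam) c (j + 1) := by
    intro j hj
    have e := (integral_force_seg_eq_zero_iff D.pos (P.lt j hj) (D.le_tail' _) (D.le_tail' _)).1
      (S.integral_force P hm h0 M D hν hj).1
    have hD := sub_pos.2 (M.deriv_lt (P.mem_Icc (by omega)).1 (P.lt j hj))
    rw [cellInv, invSlope, Nat.add_sub_cancel, eq_div_iff hD.ne']
    exact e
  have hnode : ∀ d ≤ k + 1, nodeVal (mixture p lam) (k + 1) c w (k + 1 - d) = N (c (k + 1 - d)) := by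
    intro d
    induction d with
    | zero =>
      intro _
      rw [nodeVal, Nat.sub_zero, Nat.sub_self, endVal, if_pos Even.zero, endSq, ← hmul k le_rfl, hwdef,
        show N (c k) * N (c (k + 1)) / (N (c k) / N (c (k + 1))) = N (c (k + 1)) ^ 2 by
          have := hNp (c k); have := hNp (c (k + 1)); field_simp,
        Real.sqrt_sq (hNp _).le]
    | succ d ih =>
      intro hd
      have e1 := M.nodeVal_mul h1 P.zero hx hw (l := k + 1 - d) (by omega) (by omega)
      have e2 := hmul (k + 1 - (d + 1)) (by omega)
      rw [show k + 1 - (d + 1) + 1 = k + 1 - d by omega] at e2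
      rw [ih (by omega), show k + 1 - d - 1 = k + 1 - (d + 1) by omega, ← e2] at e1
      exact mul_right_cancel₀ (hNp _).ne' e1
  have hnode' : ∀ l ≤ k + 1, nodeVal (mixture p lam) (k + 1) c w l = N (c l) := fun l hl => by
    have := hnode (k + 1 - l) (by omega)
    rwa [show k + 1 - (k + 1 - l) = l by omega] at this
  have hmem : w ∈ Icc (calY (mixture p lam) (k + 1) c) (calZ (mixture p lam) (k + 1) c)⁻¹ := by
    refine (M.mem_Icc_iff h2 P.zero hx hw).2 ⟨fun l hl1 hl2 => ?_, fun l hl1 hl2 => ?_⟩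
    · rw [hnode' l hl2]
      have := S.drift_nonpos P hm h0 M D hν hl1 hl2
      rwa [drift, sub_nonpos, le_div_iff₀ (pow_pos (hNp _) 2)] at this
    · obtain ⟨j, rfl⟩ := Nat.exists_eq_add_of_le' hl1
      rw [Nat.add_sub_cancel, hnode' j (by omega), hnode' (j + 1) (by omega),
        hnode' (j + 1 + 1) (by omega), (S.tail_eq_seg P D (by omega)).1,
        (S.tail_eq_seg P D (by omega)).1]
      exact (hm j (by omega)).le
  refine (kappa_iff_signs _ _ _).2 ⟨hx, fun l hl1 hl2 => ?_⟩
  have hY := M.calY_pos h1 P.zero hx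
  have hx0 := nonneg_of_nodes P.zero hx (l - 1) (by omega)
  have hlt := hx l hl1 hl2
  have arg := fun w (hw : 0 < w) => M.kappa_arg h1 P.zero hx hw hl1 hl2
  have hpos : 0 < (calF (mixture p lam) (k + 1) c l)⁻¹ * r₂ (mixture p lam) (c (l - 1)) (c l) := by
    have := arg 1 one_pos
    rw [one_zpow, one_mul] at this
    rw [this]
    exact div_pos (M.nodeVal_pos h1 P.zero hx one_pos _) (M.nodeVal_pos h1 P.zero hx one_pos _)
  -- At the true parameter every first moment vanishes. As `𝓨 ≤ w ≤ 1/𝓩` and `h` is monotone, the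
  -- signs at both ends follow; they flip with the parity because the parameter enters with exponent
  -- `±1`.
  have hzero : h (mixture p lam) (c (l - 1)) (c l) (w ^ ((-1 : ℤ) ^ (k + 1 - l)) *
      ((calF (mixture p lam) (k + 1) c l)⁻¹ * r₂ (mixture p lam) (c (l - 1)) (c l))) = 0 := by
    rw [← mul_assoc, arg w hw, hnode' l hl2, hnode' (l - 1) (by omega)]
    obtain ⟨j, rfl⟩ := Nat.exists_eq_add_of_le' hl1
    rw [Nat.add_sub_cancel, h_eq_integral D.pos (P.lt j (by omega)) (D.le_tail' _) (D.le_tail' _)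
      ((integral_force_seg_eq_zero_iff D.pos (P.lt j (by omega)) (D.le_tail' _) (D.le_tail' _)).1
      (S.integral_force P hm h0 M D hν (by omega)).1)]
    exact (S.integral_force P hm h0 M D hν (by omega)).2
  rw [mul_assoc (_ ^ _), mul_assoc (_ ^ _)]
  rcases Nat.even_or_odd (k + 1 - l) with hp | hp
  · rw [hp.neg_one_pow, one_mul, one_mul]
    rw [hp.neg_one_pow, zpow_one] at hzero ⊢
    rw [zpow_one]
    constructor
    · rw [← hzero]
      exact M.h_mono hx0 hlt (mul_pos hw hpos) (mul_le_mul_of_nonneg_right hmem.2 hpos.le)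
    · rw [← hzero]
      exact M.h_mono hx0 hlt (mul_pos hY hpos) (mul_le_mul_of_nonneg_right hmem.1 hpos.le)
  · rw [hp.neg_one_pow, neg_one_mul, neg_one_mul]
    rw [hp.neg_one_pow, zpow_neg, zpow_one] at hzero ⊢
    rw [zpow_neg, zpow_one, neg_nonneg, neg_nonpos]
    have hWp := hw.trans_le hmem.2
    constructor
    · rw [← hzero]
      exact M.h_mono hx0 hlt (mul_pos (inv_pos.2 hWp) hpos)
        (mul_le_mul_of_nonneg_right (inv_anti₀ hw hmem.2) hpos.le)
    · rw [← hzero]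
      exact M.h_mono hx0 hlt (mul_pos (inv_pos.2 hw) hpos)
        (mul_le_mul_of_nonneg_right (inv_anti₀ hY hmem.1) hpos.le)

/-- A Parisi measure with `n` steps gives a point of `𝓗^n` between `0` and `1`. -/
theorem IsMixture.exists_mem_setH (M : IsMixture p lam) (hk : 1 ≤ k) {ν : Measure ℝ}
    (hν : IsParisiMeasure (mixture p lam) ν) (h : IsRSB (k + 1) ν) :
    ∃ x ∈ setH (mixture p lam) (k + 1), x 0 = 0 ∧ x (Fin.last (k + 1)) = 1 := by
  obtain ⟨q, hq⟩ := h
  obtain ⟨m, γ, Δ, P, S, hm, h0, D, rfl⟩ := hq.exists_step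
  refine ⟨q, ⟨fun i => ?_, S.kappa P hk hm h0 M D hν⟩, hq.2.1 (by omega), hq.2.2.1⟩
  have := P.mem_Icc (j := i) (by omega)
  rwa [toSeq, dif_pos i.2] at this

end
end SphericalSpinGlass

end

theorem corollary4 (n : ℕ) (hn : 2 ≤ n)
    (p : Fin n → ℕ) (hp : StrictMono p) (hp2 : ∀ j, 2 < p j)
    (lam : Fin n → ℝ) (hlam : ∀ j, 0 ≤ lam j) (hsum : ∑ j, lam j = 1)
    (ν : MeasureTheory.Measure ℝ)
    (hν : SphericalSpinGlass.IsParisiMeasure (SphericalSpinGlass.mixture p lam) ν) :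
    (SphericalSpinGlass.IsRSB n ν →
      ∃ x ∈ SphericalSpinGlass.setH (SphericalSpinGlass.mixture p lam) n,
        x 0 = 0 ∧ x (Fin.last n) = 1) ∧
    (SphericalSpinGlass.IsNondegenerate n (SphericalSpinGlass.mixture p lam) ν →
      (SphericalSpinGlass.IsRSB n ν ↔
        ∃ x ∈ SphericalSpinGlass.setH (SphericalSpinGlass.mixture p lam) n,
          x 0 = 0 ∧ x (Fin.last n) = 1)) := by
  obtain ⟨k, rfl⟩ : ∃ k, n = k + 1 := ⟨n - 1, by omega⟩
  have M : SphericalSpinGlass.IsMixture p lam := ⟨hp, hp2, hlam, hsum⟩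
  have hk : 1 ≤ k := by omega
  refine ⟨M.exists_mem_setH hk hν, fun hnd => ⟨M.exists_mem_setH hk hν, ?_⟩⟩
  rintro ⟨x, ⟨-, hK⟩, hx0, hx1⟩
  refine M.isRSB_of_kappa hk hν hnd ?_ ?_ hK
  · rw [SphericalSpinGlass.toSeq, dif_pos (Nat.succ_pos _)]; exact hx0
  · rw [SphericalSpinGlass.toSeq, dif_pos (Nat.lt_succ_self _)]; exact hx1
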